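/- **Setting.** A circuit prepares a state on its output qubits (further qubits are discarded at the end) from a fixed initial state of all its qubits by CNOTs, other unitary gates, Pauli measurements, and Pauli gates conditioned on the parity of earlier outcomes. A fault $F$ is a Pauli string (modulo phase) on the pairs (time step, qubit), and $C^F$ is the circuit with these Paulis inserted. Under circuit-level noise the atomic faults are: any Pauli on a single wire; for every gate or measurement, any Pauli on its output qubits; for every Pauli measurement, a measurement flip (a Pauli on the measured qubits anticommuting with the measured one, inserted immediately before and after the measurement), possibly multiplied by any Pauli on the outputs of the measurement. Wires and operations may be idealised as fault-free; a measurement may also be idealised as fault-tolerant, its atomic faults then being the measurement flips, possibly multiplied by a Pauli on a single output. The weight $wt(F)$ is the least number of atomic faults whose product is $F$. A set of measurements is detecting if the parity of its outcomes is predetermined in the fault-free circuit; $F$ is detectable if it flips the parity of a detecting set. Circuits $C_1,C_2$ are $w$-fault-equivalent if every fault $F_1$ of $C_1$ generated by atomic faults with $wt(F_1)<w$ is detectable or admits a fault $F_2$ of $C_2$ generated by atomic faults with $wt(F_2)\le wt(F_1)$ such that $C_1^{F_1}$ and $C_2^{F_2}$ prepare the same state, and vice versa. A circuit with $m$ output qubits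 is a *$w$-fault-tolerant $m$-legged cat state* if it is $w$-fault-equivalent to the idealised preparation of $(|0\rangle^{\otimes m}+|1\rangle^{\otimes m})/\sqrt2$, whose only atomic faults are Paulis on a single output qubit. **Proposition.** Let $w\le n$, and let $A$ and $B$ be $w$-fault-tolerant $n$-legged cat states (for instance fault-tolerant ones, i.e. $w'$-fault-tolerant for all $w'$), under circuit-level noise or idealisations thereof. Prepare $A$ and $B$ on disjoint qubits; for each $i\le w$ measure $Z\otimes Z$ on the $i$-th leg of $A$ and the $i$-th leg of $B$; finally, if the outcome of the first check is $-1$, apply $X$ to each leg of $B$ (by $n$ single-qubit gates, themselves subject to noise). The resulting circuit is a $w$-fault-tolerant $2n$-legged cat state in each of the following two cases: 1. the $w$ checks are fault-tolerant Pauli measurements; 2. each check is implemented under full circuit-level noise with a fresh ancilla in the state $|0\rangle$, by a CNOT from each of the two legs to the ancilla and a $Z$-basis measurement of the ancilla. In case 1 the construction adds $w$ measurements and no CNOT to those of $A$ and $B$. In case 2 it adds exactly $2w$ CNOTs and $w$ measurements. -/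

import Mathlib

open scoped BigOperators ComplexConjugate

noncomputable section

namespace FaultCircuit

/-- A one-qubit Pauli operator modulo its phase: `(x, z)` stands for `X ^ x * Z ^ z`. -/
abbrev Pauli : Type := ZMod 2 × ZMod 2

/-- An element of the `Q`-qubit Pauli group modulo its centre; the group law is `+`. -/
abbrev PauliString (Q : Type) : Type := Q → Pauli

/-- The Pauli operator `X`. -/
def pauliX : Pauli := (1, 0)

/-- The Pauli operator `Z`. -/
def pauliZ : Pauli := (0, 1)

/-- Pure states (not necessarily normalised) of the qubits in `Q`, in the computational basis. -/
abbrev State (Q : Type) : Type := (Q → ZMod 2) → ℂ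

/-- `(-1) ^ a`. -/
def sgn (a : ZMod 2) : ℂ := if a = 0 then 1 else -1

section Pauli

variable {Q : Type} [Fintype Q] [DecidableEq Q]

/-- The qubits on which a Pauli string acts non-trivially. -/
def supp (p : PauliString Q) : Finset Q := Finset.univ.filter fun q => p q ≠ 0

/-- The Hermitian Pauli operator `⨂ q, i ^ (x q * z q) X ^ (x q) Z ^ (z q)`
(so `(1, 1)` is `Y = i X Z`) applied to a state. -/
def applyPauli (p : PauliString Q) (ψ : State Q) : State Q := fun s =>
  (∏ q, if (p q).1 = 1 ∧ (p q).2 = 1 then Complex.I else 1) *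
    sgn (∑ q, (p q).2 * (s q + (p q).1)) * ψ (fun q => s q + (p q).1)

/-- The Pauli strings `p` and `r` anticommute. -/
def Anticommute (p r : PauliString Q) : Prop :=
  ∑ q, ((p q).1 * (r q).2 + (p q).2 * (r q).1) = 1

end Pauli

/-- How far a Pauli measurement is idealised. -/
inductive Grade
  | faulty
  | faultTolerant
  | faultFree

/-- One operation of a circuit on the qubits `Q` with classical bits `κ`.
The flag `ideal` says that a gate is idealised as fault-free. -/
inductive Op (Q κ : Type) : Type
  /-- A CNOT gate with control `c` and target `t`. -/
  | cnot (ideal : Bool) (c t : Q)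
  /-- Any other unitary gate `U`, acting on the `r` qubits `e 0, …, e (r - 1)`. -/
  | gate (ideal : Bool) (r : ℕ) (e : Fin r → Q) (U : Matrix.unitaryGroup (Fin r → ZMod 2) ℂ)
  /-- The Pauli measurement of `p`, whose outcome is stored in the classical bit `b`. -/
  | meas (g : Grade) (p : PauliString Q) (b : κ)
  /-- The Pauli gate `p`, applied if and only if the outcomes stored in `S` have odd parity. -/
  | condPauli (ideal : Bool) (p : PauliString Q) (S : Finset κ)

namespace Op

/-- Rename qubits and classical bits along injections. -/
def map {Q Q' κ κ' : Type} [DecidableEq κ'] (f : Q → Q') (g : κ → κ') : Op Q κ → Op Q' κ'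
  | cnot i c t => cnot i (f c) (f t)
  | gate i r e U => gate i r (fun j => f (e j)) U
  | meas l p b => meas l (Function.extend f p 0) (g b)
  | condPauli i p S => condPauli i (Function.extend f p 0) (S.image g)

def isCnot {Q κ : Type} : Op Q κ → Bool
  | cnot _ _ _ => true
  | _ => false

def isMeas {Q κ : Type} : Op Q κ → Bool
  | meas _ _ _ => true
  | _ => false

/-- The classical bit written by the operation, if it is a measurement. -/
def writes {Q κ : Type} : Op Q κ → Option κ
  | meas _ _ b => some b
  | _ => none

/-- The classical bits read by the operation. -/
def reads {Q κ : Type} : Op Q κ → Finset κ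
  | condPauli _ _ S => S
  | _ => ∅

/-- The qubits named by the operation are pairwise distinct. -/
def DistinctQubits {Q κ : Type} : Op Q κ → Prop
  | cnot _ c t => c ≠ t
  | gate _ _ e _ => Function.Injective e
  | _ => True

variable {Q κ : Type} [Fintype Q] [DecidableEq Q]

/-- The linear map performed by the operation when the measurement outcomes are `k`. A measurement
of `p` with outcome `0` (resp. `1`) projects on the `+1` (resp. `-1`) eigenspace of `p`. -/
def apply (k : κ → ZMod 2) : Op Q κ → State Q → State Q
  | cnot _ c t, ψ => fun s => ψ (Function.update s t (s t + s c))
  | gate _ r e U, ψ => fun s =>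
      ∑ y : Fin r → ZMod 2,
        (U : Matrix (Fin r → ZMod 2) (Fin r → ZMod 2) ℂ) (fun j => s (e j)) y *
          ψ (Function.extend e y s)
  | meas _ p b, ψ => fun s => (ψ s + sgn (k b) * applyPauli p ψ s) / 2
  | condPauli _ p S, ψ => if ∑ b ∈ S, k b = 1 then applyPauli p ψ else ψ

/-- The set of (input and output) qubits of the operation. -/
def support : Op Q κ → Finset Q
  | cnot _ c t => {c, t}
  | gate _ _ e _ => Finset.univ.image e
  | meas _ p _ => supp p
  | condPauli _ p _ => supp p

/-- The operation is not idealised in any way. -/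
def IsFaulty : Op Q κ → Prop
  | cnot i _ _ => i = false
  | gate i _ _ _ => i = false
  | meas g _ _ => g = Grade.faulty
  | condPauli i _ _ => i = false

end Op

/-- A fault: a Pauli string (modulo phase) at every time step. -/
abbrev Fault (Q : Type) : Type := ℕ → PauliString Q

namespace Op

variable {Q κ : Type} [Fintype Q] [DecidableEq Q]

/-- The atomic faults caused by an operation taking place between the time steps `t` and `t + 1`:
* *gate faults* of a faulty operation: any Pauli string on its outputs;
* *measurement flips* of a faulty or fault-tolerant measurement of `p`: a Pauli string `a` that
  anticommutes with `p`, immediately before and after the measurement, multiplied by a fault `r` on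
  its outputs, where `r` is arbitrary if the measurement is faulty, and acts on at most one output
  if it is fault-tolerant. -/
inductive AtomicFault (t : ℕ) : Op Q κ → Fault Q → Prop
  | gateFault (o : Op Q κ) (r : PauliString Q) (ho : o.IsFaulty) (hr : supp r ⊆ o.support) :
      AtomicFault t o (Pi.single (t + 1) r)
  | flip (p : PauliString Q) (b : κ) (a r : PauliString Q) (ha : supp a ⊆ supp p)
      (hap : Anticommute a p) (hr : supp r ⊆ supp p) :
      AtomicFault t (meas Grade.faulty p b) (Pi.single t a + Pi.single (t + 1) (a + r))
  | flipFT (p : PauliString Q) (b : κ) (a r : PauliString Q) (ha : supp a ⊆ supp p)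
      (hap : Anticommute a p) (hr : supp r ⊆ supp p) (hr1 : (supp r).card ≤ 1) :
      AtomicFault t (meas Grade.faultTolerant p b) (Pi.single t a + Pi.single (t + 1) (a + r))

end Op

/-- A state-preparation circuit with output qubits `α`, further qubits `β` (which are discarded at
the end) and classical bits `κ`. The operation number `t` of `ops` takes place between the time
steps `t` and `t + 1`, so the fault locations are the pairs `(t, q)` with `t ≤ ops.length`.
`init` is the state at time step `0`. `noisy t q` says that the wire `q` at time step `t` is not
idealised as fault-free; it only matters for `t ≤ ops.length`. -/
structure Circuit (α β κ : Type) where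
  init : State (α ⊕ β)
  ops : List (Op (α ⊕ β) κ)
  noisy : ℕ → α ⊕ β → Prop

/-- Perform the operations `l`, the first of which takes place after time step `t`, with the Paulis
of the fault `F` inserted at every time step, when the measurement outcomes are `k`. -/
def evolve {Q κ : Type} [Fintype Q] [DecidableEq Q] (F : Fault Q) (k : κ → ZMod 2) :
    List (Op Q κ) → ℕ → State Q → State Q
  | [], t, ψ => applyPauli (F t) ψ
  | o :: l, t, ψ => evolve F k l (t + 1) (o.apply k (applyPauli (F t) ψ))

namespace Circuit

variable {α β κ : Type}

def cnotCount (C : Circuit α β κ) : ℕ := C.ops.countP Op.isCnot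

def measCount (C : Circuit α β κ) : ℕ := C.ops.countP Op.isMeas

variable [Fintype α] [DecidableEq α] [Fintype β] [DecidableEq β] [Fintype κ] [DecidableEq κ]

/-- The circuit is physically meaningful: the initial state is normalised, gates act on distinct
qubits, every classical bit is written by exactly one measurement, and bits are read only after they
have been written. -/
structure Valid (C : Circuit α β κ) : Prop where
  init_norm : ∑ s, ‖C.init s‖ ^ 2 = 1
  distinct : ∀ o ∈ C.ops, o.DistinctQubits
  bits_nodup : (C.ops.filterMap Op.writes).Nodup
  bits_written : ∀ b : κ, b ∈ C.ops.filterMap Op.writes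
  causal : ∀ (l₁ l₂ : List (Op (α ⊕ β) κ)) (o : Op (α ⊕ β) κ), C.ops = l₁ ++ o :: l₂ →
    ∀ b ∈ o.reads, b ∈ l₁.filterMap Op.writes

/-- Circuit-level noise, idealised as the annotations of `C` prescribe: the atomic faults are the
Paulis on a single noisy wire, and the atomic faults of the operations. -/
def noise (C : Circuit α β κ) : Set (Fault (α ⊕ β)) :=
  {F | (∃ t q p, t ≤ C.ops.length ∧ C.noisy t q ∧ F = Pi.single t (Pi.single q p)) ∨
    ∃ t o, C.ops[t]? = some o ∧ Op.AtomicFault t o F}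

/-- The potential faults: the group generated by the atomic faults. -/
def faults (C : Circuit α β κ) : AddSubgroup (Fault (α ⊕ β)) := AddSubgroup.closure C.noise

/-- The weight of a potential fault: the least number of atomic faults that generate it. -/
def wt (C : Circuit α β κ) (F : Fault (α ⊕ β)) : ℕ :=
  sInf {m | ∃ l : List (Fault (α ⊕ β)), l.length = m ∧ (∀ f ∈ l, f ∈ C.noise) ∧ l.sum = F}

/-- The unnormalised final state of the circuit with the fault `F` inserted, for the measurement
outcomes `k`; its squared norm is the probability of these outcomes. -/
def branch (C : Circuit α β κ) (F : Fault (α ⊕ β)) (k : κ → ZMod 2) : State (α ⊕ β) :=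
  evolve F k C.ops 0 C.init

/-- The density matrix of the output qubits prepared by the circuit with the fault `F` inserted
(summed over all measurement outcomes, the qubits in `β` traced out). If it is a pure state, then
every outcome that occurs leaves the output qubits in this state, up to a scalar. -/
def output (C : Circuit α β κ) (F : Fault (α ⊕ β)) : Matrix (α → ZMod 2) (α → ZMod 2) ℂ :=
  Matrix.of fun x y => ∑ k : κ → ZMod 2, ∑ z : β → ZMod 2,
    C.branch F k (Sum.elim x z) * conj (C.branch F k (Sum.elim y z))

/-- `S` is a detecting set with predetermined parity `b`: without faults, the outcomes of the
measurements in `S` always have parity `b`. -/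
def DetectingSet (C : Circuit α β κ) (S : Finset κ) (b : ZMod 2) : Prop :=
  ∀ k, C.branch 0 k ≠ 0 → ∑ i ∈ S, k i = b

/-- `F` is detectable: it flips the parity of some detecting set. -/
def Detectable (C : Circuit α β κ) (F : Fault (α ⊕ β)) : Prop :=
  ∃ S b, C.DetectingSet S b ∧ ∀ k, C.branch F k ≠ 0 → ∑ i ∈ S, k i = b + 1

end Circuit

section FaultEquivalence

variable {α β κ β' κ' : Type} [Fintype α] [DecidableEq α] [Fintype β] [DecidableEq β]
  [Fintype κ] [DecidableEq κ] [Fintype β'] [DecidableEq β'] [Fintype κ'] [DecidableEq κ']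

/-- Every potential fault of `C` of weight less than `w` is detectable, or has the same effect as
some potential fault of `D` of at most the same weight. -/
def FaultBounded (w : ℕ) (C : Circuit α β κ) (D : Circuit α β' κ') : Prop :=
  ∀ F ∈ C.faults, C.wt F < w →
    C.Detectable F ∨ ∃ G ∈ D.faults, D.wt G ≤ C.wt F ∧ C.output F = D.output G

/-- `w`-fault equivalence of two state preparations under their noise models. -/
def FaultEquivalent (w : ℕ) (C : Circuit α β κ) (D : Circuit α β' κ') : Prop :=
  FaultBounded w C D ∧ FaultBounded w D C

/-- The cat state `(|0…0⟩ + |1…1⟩) / √2` on the qubits `Q`. -/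
def catState (Q : Type) [Fintype Q] [DecidableEq Q] : State Q := fun s =>
  ((if s = 0 then 1 else 0) + (if s = 1 then 1 else 0)) / (Real.sqrt 2 : ℂ)

/-- The idealised cat state preparation: the state is prepared without faults, and the only atomic
faults are Paulis on a single output qubit. -/
def idealCat (α : Type) [Fintype α] [DecidableEq α] : Circuit α Empty Empty where
  init := fun s => catState α fun i => s (Sum.inl i)
  ops := []
  noisy := fun _ _ => True

/-- `C` fault-tolerantly prepares the cat state on its outputs up to weight `w`. -/
def PreparesCat (w : ℕ) (C : Circuit α β κ) : Prop := FaultEquivalent w C (idealCat α)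

end FaultEquivalence

section Fusion

variable {α₁ α₂ β₁ β₂ γ κ₁ κ₂ : Type}

/-- The qubits of the first circuit among those of a joint circuit. -/
def qubit₁ : α₁ ⊕ β₁ → (α₁ ⊕ α₂) ⊕ (β₁ ⊕ β₂ ⊕ γ) :=
  Sum.map Sum.inl Sum.inl

/-- The qubits of the second circuit among those of a joint circuit. -/
def qubit₂ : α₂ ⊕ β₂ → (α₁ ⊕ α₂) ⊕ (β₁ ⊕ β₂ ⊕ γ) :=
  Sum.map Sum.inr fun i => Sum.inr (Sum.inl i)

/-- The additional ancillas among the qubits of a joint circuit. -/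
def ancilla : γ → (α₁ ⊕ α₂) ⊕ (β₁ ⊕ β₂ ⊕ γ) := fun i => Sum.inr (Sum.inr (Sum.inr i))

/-- Run `A` and `B` on disjoint sets of qubits, and then the operations `l` on all of these qubits
and on the additional ancillas `γ`, prepared in the state `|0⟩`. Wires of `A` and `B` keep the
annotation they have in these circuits while they wait for `l` or for the start of `B`;
afterwards no wire is idealised. -/
def Circuit.join {δ : Type} [Fintype γ] [DecidableEq γ] [DecidableEq κ₁] [DecidableEq κ₂]
    [DecidableEq δ]
    (A : Circuit α₁ β₁ κ₁) (B : Circuit α₂ β₂ κ₂)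
    (l : List (Op ((α₁ ⊕ α₂) ⊕ (β₁ ⊕ β₂ ⊕ γ)) (κ₁ ⊕ κ₂ ⊕ δ))) :
    Circuit (α₁ ⊕ α₂) (β₁ ⊕ β₂ ⊕ γ) (κ₁ ⊕ κ₂ ⊕ δ) where
  init := fun s => A.init (fun q => s (qubit₁ q)) * B.init (fun q => s (qubit₂ q)) *
    if ∀ a : γ, s (ancilla a) = 0 then 1 else 0
  ops := A.ops.map (Op.map qubit₁ Sum.inl) ++
    (B.ops.map (Op.map qubit₂ fun b => Sum.inr (Sum.inl b)) ++ l)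
  noisy := fun t q =>
    (∃ q₁, q = qubit₁ q₁ ∧ A.noisy (min t A.ops.length) q₁) ∨
    (∃ q₂, q = qubit₂ q₂ ∧ B.noisy (t - A.ops.length) q₂) ∨
    A.ops.length + B.ops.length ≤ t

variable {n w : ℕ} [DecidableEq β₁] [DecidableEq β₂] [DecidableEq γ]

/-- Leg `i` of the first block of `n` legs. -/
def leg₁ (i : Fin n) : (Fin n ⊕ Fin n) ⊕ (β₁ ⊕ β₂ ⊕ γ) := Sum.inl (Sum.inl i)

/-- Leg `i` of the second block of `n` legs. -/
def leg₂ (i : Fin n) : (Fin n ⊕ Fin n) ⊕ (β₁ ⊕ β₂ ⊕ γ) := Sum.inl (Sum.inr i)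

/-- The classical bit of check number `j`. -/
def checkBit (j : Fin w) : κ₁ ⊕ κ₂ ⊕ Fin w := Sum.inr (Sum.inr j)

/-- The Pauli correction: flip (by faulty one-qubit gates) every leg of the second block if the
first check has outcome `1`. -/
def corrections (n w : ℕ) [DecidableEq κ₁] [DecidableEq κ₂] :
    List (Op ((Fin n ⊕ Fin n) ⊕ (β₁ ⊕ β₂ ⊕ γ)) (κ₁ ⊕ κ₂ ⊕ Fin w)) :=
  (List.finRange n).map fun i =>
    Op.condPauli false (Pi.single (leg₂ i) pauliX)
      ((Finset.univ.filter fun j : Fin w => j.val = 0).image checkBit)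

/-- For every `i < w`, a fault-tolerant (but not fault-free) measurement of `Z ⊗ Z` on the legs
number `i` of the two blocks. -/
def idealChecks (h : w ≤ n) :
    List (Op ((Fin n ⊕ Fin n) ⊕ (β₁ ⊕ β₂ ⊕ Empty)) (κ₁ ⊕ κ₂ ⊕ Fin w)) :=
  (List.finRange w).map fun j =>
    Op.meas Grade.faultTolerant
      (Pi.single (leg₁ (Fin.castLE h j)) pauliZ + Pi.single (leg₂ (Fin.castLE h j)) pauliZ)
      (checkBit j)

/-- The same checks implemented with faulty operations only: CNOTs from the two legs to a fresh
ancilla, which is then measured in the `Z` basis. -/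
def cnotChecks (h : w ≤ n) :
    List (Op ((Fin n ⊕ Fin n) ⊕ (β₁ ⊕ β₂ ⊕ Fin w)) (κ₁ ⊕ κ₂ ⊕ Fin w)) :=
  (List.finRange w).flatMap fun j =>
    [Op.cnot false (leg₁ (Fin.castLE h j)) (ancilla j),
     Op.cnot false (leg₂ (Fin.castLE h j)) (ancilla j),
     Op.meas Grade.faulty (Pi.single (ancilla j) pauliZ) (checkBit j)]

variable [DecidableEq κ₁] [DecidableEq κ₂]

/-- Fusion of two `n`-legged cat state preparations by fault-tolerant checks on the first `w`
legs. -/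
def fuseIdeal (h : w ≤ n) (A : Circuit (Fin n) β₁ κ₁) (B : Circuit (Fin n) β₂ κ₂) :
    Circuit (Fin n ⊕ Fin n) (β₁ ⊕ β₂ ⊕ Empty) (κ₁ ⊕ κ₂ ⊕ Fin w) :=
  A.join B (idealChecks h ++ corrections n w)

/-- Fusion of two `n`-legged cat state preparations by checks on the first `w` legs, implemented
with CNOTs and ancillas under full circuit-level noise. -/
def fuseCnot (h : w ≤ n) (A : Circuit (Fin n) β₁ κ₁) (B : Circuit (Fin n) β₂ κ₂) :
    Circuit (Fin n ⊕ Fin n) (β₁ ⊕ β₂ ⊕ Fin w) (κ₁ ⊕ κ₂ ⊕ Fin w) :=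
  A.join B (cnotChecks h ++ corrections n w)

end Fusion

end FaultCircuit

end

noncomputable section

namespace FaultCircuit

/-! ### Signs and phases -/

lemma zmod2_cases (a : ZMod 2) : a = 0 ∨ a = 1 := by
  revert a; decide

lemma zmod2_add_eq_zero {a b : ZMod 2} : a + b = 0 ↔ a = b := by
  revert a b; decide

lemma sgn_zero : sgn 0 = 1 := by simp [sgn]

lemma sgn_add (a b : ZMod 2) : sgn (a + b) = sgn a * sgn b := by
  rcases zmod2_cases a with rfl | rfl <;> rcases zmod2_cases b with rfl | rfl <;>
    simp [sgn, show (1 : ZMod 2) + 1 = 0 from rfl]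

lemma norm_sgn (a : ZMod 2) : ‖sgn a‖ = 1 := by
  unfold sgn; split_ifs <;> simp

lemma one_add_sgn_mul (a b : ZMod 2) : (1 + sgn a * sgn b) / 2 = if b = a then 1 else 0 := by
  rcases zmod2_cases a with rfl | rfl <;> rcases zmod2_cases b with rfl | rfl <;>
    norm_num [sgn]

section Phase

variable {Q : Type}

/-- The two states agree up to a global phase. -/
def PhaseEq (ψ φ : State Q) : Prop := ∃ c : ℂ, ‖c‖ = 1 ∧ ψ = c • φ

lemma PhaseEq.refl (ψ : State Q) : PhaseEq ψ ψ := ⟨1, by simp, by simp⟩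

lemma PhaseEq.of_eq {ψ φ : State Q} (h : ψ = φ) : PhaseEq ψ φ := h ▸ PhaseEq.refl ψ

lemma PhaseEq.trans {ψ φ χ : State Q} (h₁ : PhaseEq ψ φ) (h₂ : PhaseEq φ χ) : PhaseEq ψ χ := by
  obtain ⟨c, hc, rfl⟩ := h₁
  obtain ⟨d, hd, rfl⟩ := h₂
  exact ⟨c * d, by simp [hc, hd], by rw [smul_smul]⟩

lemma PhaseEq.symm {ψ φ : State Q} (h : PhaseEq ψ φ) : PhaseEq φ ψ := by
  obtain ⟨c, hc, rfl⟩ := h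
  have h0 : c ≠ 0 := by rintro rfl; simp at hc
  exact ⟨c⁻¹, by simp [hc], by rw [smul_smul, inv_mul_cancel₀ h0, one_smul]⟩

lemma PhaseEq.eq_zero {ψ φ : State Q} (h : PhaseEq ψ φ) (h0 : φ = 0) : ψ = 0 := by
  obtain ⟨c, -, rfl⟩ := h
  simp [h0]

lemma PhaseEq.mul_conj {ψ φ : State Q} (h : PhaseEq ψ φ) (s s' : Q → ZMod 2) :
    ψ s * conj (ψ s') = φ s * conj (φ s') := by
  obtain ⟨c, hc, rfl⟩ := h
  have h1 : c * conj c = 1 := by rw [Complex.mul_conj, Complex.normSq_eq_norm_sq, hc]; simp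
  simp only [Pi.smul_apply, smul_eq_mul, map_mul]
  linear_combination (φ s * conj (φ s')) * h1

end Phase

/-! ### Pauli operators -/

lemma add_self_eq_zero {Q : Type} (p : PauliString Q) : p + p = 0 := by
  funext q
  exact Prod.ext (zmod2_add_eq_zero.2 rfl) (zmod2_add_eq_zero.2 rfl)

section Pauli

variable {Q : Type} [Fintype Q]

lemma mem_supp {p : PauliString Q} {q : Q} : q ∈ supp p ↔ p q ≠ 0 := by simp [supp]

/-- The scalar by which the Hermitian Pauli operator differs from `X ^ x * Z ^ z`. -/
def pauliPhase (p : PauliString Q) : ℂ :=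
  ∏ q, if (p q).1 = 1 ∧ (p q).2 = 1 then Complex.I else 1

lemma norm_pauliPhase (p : PauliString Q) : ‖pauliPhase p‖ = 1 := by
  unfold pauliPhase
  rw [norm_prod]
  exact Finset.prod_eq_one fun q _ => by split_ifs <;> simp

lemma applyPauli_apply (p : PauliString Q) (ψ : State Q) (s : Q → ZMod 2) :
    applyPauli p ψ s = pauliPhase p * sgn (∑ q, (p q).2 * (s q + (p q).1)) *
      ψ (fun q => s q + (p q).1) := rfl

lemma applyPauli_zero (ψ : State Q) : applyPauli 0 ψ = ψ := by
  funext s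
  simp [applyPauli, sgn_zero]

lemma applyPauli_smul (p : PauliString Q) (c : ℂ) (ψ : State Q) :
    applyPauli p (c • ψ) = c • applyPauli p ψ := by
  funext s
  simp only [applyPauli_apply, Pi.smul_apply, smul_eq_mul]; ring

lemma applyPauli_add (p : PauliString Q) (ψ φ : State Q) :
    applyPauli p (ψ + φ) = applyPauli p ψ + applyPauli p φ := by
  funext s
  simp only [applyPauli_apply, Pi.add_apply]; ring

lemma PhaseEq.applyPauli {ψ φ : State Q} (h : PhaseEq ψ φ) (p : PauliString Q) :
    PhaseEq (applyPauli p ψ) (applyPauli p φ) := by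
  obtain ⟨c, hc, rfl⟩ := h
  exact ⟨c, hc, applyPauli_smul p c φ⟩

lemma applyPauli_comp_apply (p r : PauliString Q) (ψ : State Q) (s : Q → ZMod 2) :
    applyPauli p (applyPauli r ψ) s = pauliPhase p * pauliPhase r * sgn (∑ q, (p q).2 * (r q).1) *
      (sgn (∑ q, ((p + r) q).2 * (s q + ((p + r) q).1)) * ψ fun q => s q + ((p + r) q).1) := by
  have h1 : (∑ q, (p q).2 * (r q).1) + ∑ q, ((p + r) q).2 * (s q + ((p + r) q).1) =
      (∑ q, (p q).2 * (s q + (p q).1)) + ∑ q, (r q).2 * (s q + (p q).1 + (r q).1) := by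
    rw [← Finset.sum_add_distrib, ← Finset.sum_add_distrib]
    refine Finset.sum_congr rfl fun q _ => ?_
    simp only [Pi.add_apply, Prod.fst_add, Prod.snd_add]
    have h2 : (p q).2 * (r q).1 + (p q).2 * (r q).1 = 0 := zmod2_add_eq_zero.2 rfl
    linear_combination h2
  have h3 := congrArg sgn h1
  rw [sgn_add, sgn_add] at h3
  have h4 : (fun q => s q + ((p + r) q).1) = fun q => s q + (p q).1 + (r q).1 := by
    funext q; simp [add_assoc]
  rw [applyPauli_apply, applyPauli_apply, h4]
  linear_combination (-pauliPhase p * pauliPhase r * ψ fun q => s q + (p q).1 + (r q).1) * h3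

lemma applyPauli_comp (p r : PauliString Q) (ψ : State Q) :
    PhaseEq (applyPauli p (applyPauli r ψ)) (applyPauli (p + r) ψ) := by
  have h0 : pauliPhase (p + r) ≠ 0 := by
    intro h; have := norm_pauliPhase (p + r); simp [h] at this
  refine ⟨pauliPhase p * pauliPhase r * sgn (∑ q, (p q).2 * (r q).1) * (pauliPhase (p + r))⁻¹,
    by simp [norm_pauliPhase, norm_sgn], ?_⟩
  funext s
  rw [applyPauli_comp_apply, Pi.smul_apply, smul_eq_mul, applyPauli_apply]
  field_simp

lemma applyPauli_comm (p r : PauliString Q) (ψ : State Q) :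
    applyPauli p (applyPauli r ψ) =
      sgn (∑ q, ((p q).1 * (r q).2 + (p q).2 * (r q).1)) • applyPauli r (applyPauli p ψ) := by
  funext s
  rw [Pi.smul_apply, smul_eq_mul, applyPauli_comp_apply, applyPauli_comp_apply, add_comm r p]
  have h : sgn (∑ q, ((p q).1 * (r q).2 + (p q).2 * (r q).1)) * sgn (∑ q, (r q).2 * (p q).1) =
      sgn (∑ q, (p q).2 * (r q).1) := by
    rw [← sgn_add, ← Finset.sum_add_distrib]
    congr 1
    refine Finset.sum_congr rfl fun q _ => ?_
    have h2 : (p q).1 * (r q).2 + (p q).1 * (r q).2 = 0 := zmod2_add_eq_zero.2 rfl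
    linear_combination h2
  rw [← h]; ring

lemma sum_norm_applyPauli [DecidableEq Q] (p : PauliString Q) (ψ : State Q) :
    ∑ s, ‖applyPauli p ψ s‖ ^ 2 = ∑ s, ‖ψ s‖ ^ 2 := by
  refine Fintype.sum_equiv (Equiv.addRight fun q => (p q).1) _ _ fun s => ?_
  rw [applyPauli_apply]
  simp only [norm_mul, norm_pauliPhase, norm_sgn, one_mul]
  rfl

lemma applyPauli_of_snd_eq_zero {p : PauliString Q} (hp : ∀ q, (p q).2 = 0) (ψ : State Q)
    (s : Q → ZMod 2) : applyPauli p ψ s = ψ fun q => s q + (p q).1 := by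
  simp [applyPauli, hp, sgn_zero]

lemma applyPauli_of_fst_eq_zero {p : PauliString Q} (hp : ∀ q, (p q).1 = 0) (ψ : State Q)
    (s : Q → ZMod 2) : applyPauli p ψ s = sgn (∑ q, (p q).2 * s q) * ψ s := by
  simp [applyPauli, hp]

end Pauli

/-! ### Linearity of the evolution -/

section Evolve

variable {Q κ : Type} [Fintype Q] [DecidableEq Q]

lemma Op.apply_smul (k : κ → ZMod 2) (o : Op Q κ) (c : ℂ) (ψ : State Q) :
    o.apply k (c • ψ) = c • o.apply k ψ := by
  cases o with
  | cnot i a b => rfl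
  | gate i r e U =>
    funext s
    simp only [Op.apply, Pi.smul_apply, smul_eq_mul, Finset.mul_sum]
    exact Finset.sum_congr rfl fun y _ => by ring
  | meas g p b =>
    funext s
    simp only [Op.apply, applyPauli_smul, Pi.smul_apply, smul_eq_mul]; ring
  | condPauli i p S =>
    simp only [Op.apply, applyPauli_smul]
    split_ifs <;> rfl

/-- The evolution of the state up to the last time step, whose Pauli string is not yet inserted. -/
def run (F : Fault Q) (k : κ → ZMod 2) : List (Op Q κ) → ℕ → State Q → State Q
  | [], _, ψ => ψ
  | o :: l, t, ψ => run F k l (t + 1) (o.apply k (applyPauli (F t) ψ))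

lemma evolve_eq_run (F : Fault Q) (k : κ → ZMod 2) (l : List (Op Q κ)) (t : ℕ) (ψ : State Q) :
    evolve F k l t ψ = applyPauli (F (t + l.length)) (run F k l t ψ) := by
  induction l generalizing t ψ with
  | nil => rfl
  | cons o l ih => 
    rw [evolve, ih, run, List.length_cons, add_right_comm, add_assoc]

lemma run_append (F : Fault Q) (k : κ → ZMod 2) (l l' : List (Op Q κ)) (t : ℕ) (ψ : State Q) :
    run F k (l ++ l') t ψ = run F k l' (t + l.length) (run F k l t ψ) := by
  induction l generalizing t ψ with
  | nil => rfl
  | cons o l ih =>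
    rw [List.cons_append, run, ih, run, List.length_cons, add_right_comm, add_assoc]

lemma evolve_append (F : Fault Q) (k : κ → ZMod 2) (l l' : List (Op Q κ)) (t : ℕ) (ψ : State Q) :
    evolve F k (l ++ l') t ψ = evolve F k l' (t + l.length) (run F k l t ψ) := by
  rw [evolve_eq_run, evolve_eq_run, run_append, List.length_append, add_assoc]

lemma run_smul (F : Fault Q) (k : κ → ZMod 2) (l : List (Op Q κ)) (t : ℕ) (c : ℂ) (ψ : State Q) :
    run F k l t (c • ψ) = c • run F k l t ψ := by
  induction l generalizing t ψ with
  | nil => rfl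
  | cons o l ih => rw [run, applyPauli_smul, Op.apply_smul, ih, run]

lemma evolve_smul (F : Fault Q) (k : κ → ZMod 2) (l : List (Op Q κ)) (t : ℕ) (c : ℂ)
    (ψ : State Q) : evolve F k l t (c • ψ) = c • evolve F k l t ψ := by
  rw [evolve_eq_run, evolve_eq_run, run_smul, applyPauli_smul]

lemma evolve_zero (F : Fault Q) (k : κ → ZMod 2) (l : List (Op Q κ)) (t : ℕ) :
    evolve F k l t 0 = 0 := by
  have := evolve_smul F k l t 0 0
  simpa using this

lemma PhaseEq.opApply {ψ φ : State Q} (h : PhaseEq ψ φ) (k : κ → ZMod 2) (o : Op Q κ) :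
    PhaseEq (o.apply k ψ) (o.apply k φ) := by
  obtain ⟨c, hc, rfl⟩ := h
  exact ⟨c, hc, Op.apply_smul k o c φ⟩

lemma PhaseEq.run {ψ φ : State Q} (h : PhaseEq ψ φ) (F : Fault Q) (k : κ → ZMod 2)
    (l : List (Op Q κ)) (t : ℕ) : PhaseEq (run F k l t ψ) (FaultCircuit.run F k l t φ) := by
  obtain ⟨c, hc, rfl⟩ := h
  exact ⟨c, hc, run_smul F k l t c φ⟩

lemma PhaseEq.evolve {ψ φ : State Q} (h : PhaseEq ψ φ) (F : Fault Q) (k : κ → ZMod 2)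
    (l : List (Op Q κ)) (t : ℕ) : PhaseEq (evolve F k l t ψ) (FaultCircuit.evolve F k l t φ) := by
  obtain ⟨c, hc, rfl⟩ := h
  exact ⟨c, hc, evolve_smul F k l t c φ⟩

lemma run_congr {F F' : Fault Q} (k : κ → ZMod 2) (l : List (Op Q κ)) (t t' : ℕ) (ψ : State Q)
    (h : ∀ i < l.length, F (t + i) = F' (t' + i)) : run F k l t ψ = run F' k l t' ψ := by
  induction l generalizing t t' ψ with
  | nil => rfl
  | cons o l ih =>
    rw [run, run, show F t = F' t' from h 0 (by simp)]
    refine ih _ _ _ fun i hi => ?_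
    have := h (i + 1) (by simpa using hi)
    rwa [show t + 1 + i = t + (i + 1) by omega, show t' + 1 + i = t' + (i + 1) by omega]

lemma evolve_congr {F F' : Fault Q} (k : κ → ZMod 2) (l : List (Op Q κ)) (t t' : ℕ) (ψ : State Q)
    (h : ∀ i ≤ l.length, F (t + i) = F' (t' + i)) : evolve F k l t ψ = evolve F' k l t' ψ := by
  rw [evolve_eq_run, evolve_eq_run, h _ le_rfl, run_congr k l t t' ψ fun i hi => h i hi.le]

/-- A Pauli string acting before the evolution can be merged with the fault. -/
lemma evolve_applyPauli (F F' : Fault Q) (k : κ → ZMod 2) (l : List (Op Q κ)) (t t' : ℕ)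
    (R : PauliString Q) (ψ : State Q) (h0 : F' t' = F t + R)
    (h : ∀ i < l.length, F' (t' + 1 + i) = F (t + 1 + i)) :
    PhaseEq (evolve F k l t (applyPauli R ψ)) (evolve F' k l t' ψ) := by
  cases l with
  | nil => rw [evolve, evolve, h0]; exact applyPauli_comp _ _ _
  | cons o l =>
    rw [evolve, evolve, h0, evolve_congr (F := F') (F' := F) k l (t' + 1) (t + 1)]
    · exact ((applyPauli_comp _ _ _).opApply k o).evolve _ _ _ _
    · exact fun i hi => h i (by simpa [Nat.lt_succ_iff] using hi)

end Evolve

/-! ### Operations on a factor of a product state -/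

section Factor

variable {Q₁ Q κ₁ κ : Type} [Fintype Q₁] [Fintype Q]

/-- The state does not depend on the qubits in the range of `f`. -/
def IndepOf (f : Q₁ → Q) (φ : State Q) : Prop :=
  ∀ s s' : Q → ZMod 2, (∀ q, q ∉ Set.range f → s q = s' q) → φ s = φ s'

lemma applyPauli_extend {f : Q₁ → Q} (hf : f.Injective) {φ : State Q} (hφ : IndepOf f φ)
    (p : PauliString Q₁) (ψ : State Q₁) :
    applyPauli (Function.extend f p 0) (fun s => ψ (fun q => s (f q)) * φ s) =
      fun s => applyPauli p ψ (fun q => s (f q)) * φ s := by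
  funext s
  rw [applyPauli_apply, applyPauli_apply]
  have h1 : pauliPhase (Function.extend f p 0) = pauliPhase p := by
    refine (Fintype.prod_of_injective f hf _ _ (fun q hq => ?_) fun q => ?_).symm
    · rw [Function.extend_apply' _ _ _ hq]; simp
    · rw [hf.extend_apply]
  have h2 : ∑ q, (Function.extend f p 0 q).2 * (s q + (Function.extend f p 0 q).1) =
      ∑ q, (p q).2 * (s (f q) + (p q).1) := by
    refine (Fintype.sum_of_injective f hf _ _ (fun q hq => ?_) fun q => ?_).symm
    · rw [Function.extend_apply' _ _ _ hq]; simp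
    · rw [hf.extend_apply]
  rw [h1, h2, hφ _ s fun q hq => by rw [Function.extend_apply' _ _ _ hq]; simp]
  simp only [hf.extend_apply]
  ring

lemma Op.apply_map [DecidableEq Q₁] [DecidableEq Q] [DecidableEq κ] {f : Q₁ → Q} (hf : f.Injective) {g : κ₁ → κ} (hg : g.Injective) {φ : State Q}
    (hφ : IndepOf f φ) (k : κ → ZMod 2) (o : Op Q₁ κ₁) (ψ : State Q₁) :
    (o.map f g).apply k (fun s => ψ (fun q => s (f q)) * φ s) =
      fun s => o.apply (fun b => k (g b)) ψ (fun q => s (f q)) * φ s := by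
  cases o with
  | cnot i c t =>
    funext s
    simp only [Op.map, Op.apply]
    congr 1
    · congr 1
      funext q
      by_cases h : q = t
      · subst h; simp
      · rw [Function.update_of_ne h, Function.update_of_ne (hf.ne h)]
    · exact hφ _ _ fun q hq => Function.update_of_ne (fun h => hq ⟨t, h.symm⟩) _ _
  | gate i r e U =>
    funext s
    simp only [Op.map, Op.apply, Finset.sum_mul]
    refine Finset.sum_congr rfl fun y _ => ?_
    rw [mul_assoc]
    congr 2
    · congr 1
      funext q
      simp only [Function.extend_def, hf.eq_iff]
    · refine hφ _ _ fun q hq => Function.extend_apply' _ _ _ ?_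
      rintro ⟨j, rfl⟩
      exact hq ⟨_, rfl⟩
  | meas l p b =>
    funext s
    simp only [Op.map, Op.apply, applyPauli_extend hf hφ]
    ring
  | condPauli i p S =>
    simp only [Op.map, Op.apply, applyPauli_extend hf hφ, Finset.sum_image hg.injOn]
    split_ifs <;> rfl

end Factor

/-! ### Product states of two circuits and additional ancillas -/

section Tens

variable {α₁ α₂ β₁ β₂ γ : Type}

/-- A product state of the qubits of the first circuit, those of the second one, and the
additional ancillas. -/
def tens (ψ₁ : State (α₁ ⊕ β₁)) (ψ₂ : State (α₂ ⊕ β₂)) (χ : State γ) :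
    State ((α₁ ⊕ α₂) ⊕ (β₁ ⊕ β₂ ⊕ γ)) := fun s =>
  ψ₁ (fun q => s (qubit₁ q)) * ψ₂ (fun q => s (qubit₂ q)) * χ fun a => s (ancilla a)

lemma PhaseEq.tens {ψ₁ φ₁ : State (α₁ ⊕ β₁)} {ψ₂ φ₂ : State (α₂ ⊕ β₂)} (h₁ : PhaseEq ψ₁ φ₁)
    (h₂ : PhaseEq ψ₂ φ₂) (χ : State γ) : PhaseEq (tens ψ₁ ψ₂ χ) (FaultCircuit.tens φ₁ φ₂ χ) := by
  obtain ⟨c, hc, rfl⟩ := h₁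
  obtain ⟨d, hd, rfl⟩ := h₂
  refine ⟨c * d, by simp [hc, hd], ?_⟩
  funext s
  simp only [FaultCircuit.tens, Pi.smul_apply, smul_eq_mul]; ring

lemma qubit₁_injective : Function.Injective
    (qubit₁ : α₁ ⊕ β₁ → (α₁ ⊕ α₂) ⊕ (β₁ ⊕ β₂ ⊕ γ)) :=
  Sum.inl_injective.sumMap Sum.inl_injective

lemma qubit₂_injective : Function.Injective
    (qubit₂ : α₂ ⊕ β₂ → (α₁ ⊕ α₂) ⊕ (β₁ ⊕ β₂ ⊕ γ)) :=
  Sum.inr_injective.sumMap (Sum.inr_injective.comp Sum.inl_injective)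

lemma qubit₁_ne_qubit₂ (q₁ : α₁ ⊕ β₁) (q₂ : α₂ ⊕ β₂) :
    (qubit₁ q₁ : (α₁ ⊕ α₂) ⊕ (β₁ ⊕ β₂ ⊕ γ)) ≠ qubit₂ q₂ := by
  rcases q₁ with q₁ | q₁ <;> rcases q₂ with q₂ | q₂ <;> simp [qubit₁, qubit₂]

lemma qubit₁_ne_ancilla (q₁ : α₁ ⊕ β₁) (a : γ) :
    (qubit₁ q₁ : (α₁ ⊕ α₂) ⊕ (β₁ ⊕ β₂ ⊕ γ)) ≠ ancilla a := by
  rcases q₁ with q₁ | q₁ <;> simp [qubit₁, ancilla]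

lemma qubit₂_ne_ancilla (q₂ : α₂ ⊕ β₂) (a : γ) :
    (qubit₂ q₂ : (α₁ ⊕ α₂) ⊕ (β₁ ⊕ β₂ ⊕ γ)) ≠ ancilla a := by
  rcases q₂ with q₂ | q₂ <;> simp [qubit₂, ancilla]

variable [Fintype α₁] [Fintype α₂] [Fintype β₁] [Fintype β₂] [Fintype γ]

@[to_additive]
lemma prod_joint_qubits {M : Type*} [CommMonoid M] (g : (α₁ ⊕ α₂) ⊕ (β₁ ⊕ β₂ ⊕ γ) → M) :
    ∏ q, g q = (∏ q, g (qubit₁ q)) * (∏ q, g (qubit₂ q)) * ∏ a, g (ancilla a) := by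
  simp only [Fintype.prod_sum_type, qubit₁, qubit₂, ancilla, Sum.map_inl, Sum.map_inr]
  simp only [mul_assoc, mul_left_comm]

lemma applyPauli_tens (P : PauliString ((α₁ ⊕ α₂) ⊕ (β₁ ⊕ β₂ ⊕ γ))) (ψ₁ : State (α₁ ⊕ β₁))
    (ψ₂ : State (α₂ ⊕ β₂)) (χ : State γ) :
    applyPauli P (tens ψ₁ ψ₂ χ) = tens (applyPauli (fun q => P (qubit₁ q)) ψ₁)
      (applyPauli (fun q => P (qubit₂ q)) ψ₂) (applyPauli (fun a => P (ancilla a)) χ) := by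
  funext s
  simp only [tens, applyPauli_apply]
  rw [sum_joint_qubits, sgn_add, sgn_add, show pauliPhase P = _ from prod_joint_qubits _]
  simp only [pauliPhase]
  ring

variable [DecidableEq α₁] [DecidableEq α₂] [DecidableEq β₁] [DecidableEq β₂] [DecidableEq γ]
variable {κ₁ κ : Type} [DecidableEq κ]

lemma Op.apply_map_qubit₁ {g : κ₁ → κ} (hg : g.Injective) (k : κ → ZMod 2)
    (o : Op (α₁ ⊕ β₁) κ₁) (ψ₁ : State (α₁ ⊕ β₁)) (ψ₂ : State (α₂ ⊕ β₂)) (χ : State γ) :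
    (o.map qubit₁ g).apply k (tens ψ₁ ψ₂ χ) = tens (o.apply (fun b => k (g b)) ψ₁) ψ₂ χ := by
  have := Op.apply_map (f := (qubit₁ : α₁ ⊕ β₁ → (α₁ ⊕ α₂) ⊕ (β₁ ⊕ β₂ ⊕ γ))) qubit₁_injective hg
    (φ := fun s => ψ₂ (fun q => s (qubit₂ q)) * χ fun a => s (ancilla a)) ?_ k o ψ₁
  · have e : ∀ ψ : State (α₁ ⊕ β₁), tens ψ ψ₂ χ = fun s => ψ (fun q => s (qubit₁ q)) *
        (ψ₂ (fun q => s (qubit₂ q)) * χ fun a => s (ancilla a)) := fun ψ => by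
      funext s; simp only [tens]; ring
    rw [e, e]; exact this
  · intro s s' h
    have h2 : ∀ q : α₂ ⊕ β₂, s (qubit₂ q) = s' (qubit₂ q) := fun q =>
      h _ (by rintro ⟨q', h'⟩; exact qubit₁_ne_qubit₂ _ _ h')
    have h3 : ∀ q : γ, s (ancilla q) = s' (ancilla q) := fun q =>
      h _ (by rintro ⟨q', h'⟩; exact qubit₁_ne_ancilla _ _ h')
    simp only [h2, h3]

lemma Op.apply_map_qubit₂ {g : κ₁ → κ} (hg : g.Injective) (k : κ → ZMod 2)
    (o : Op (α₂ ⊕ β₂) κ₁) (ψ₁ : State (α₁ ⊕ β₁)) (ψ₂ : State (α₂ ⊕ β₂)) (χ : State γ) :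
    (o.map qubit₂ g).apply k (tens ψ₁ ψ₂ χ) = tens ψ₁ (o.apply (fun b => k (g b)) ψ₂) χ := by
  have := Op.apply_map (f := (qubit₂ : α₂ ⊕ β₂ → (α₁ ⊕ α₂) ⊕ (β₁ ⊕ β₂ ⊕ γ))) qubit₂_injective hg
    (φ := fun s => ψ₁ (fun q => s (qubit₁ q)) * χ fun a => s (ancilla a)) ?_ k o ψ₂
  · have e : ∀ ψ : State (α₂ ⊕ β₂), tens ψ₁ ψ χ = fun s => ψ (fun q => s (qubit₂ q)) *
        (ψ₁ (fun q => s (qubit₁ q)) * χ fun a => s (ancilla a)) := fun ψ => by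
      funext s; simp only [tens]; ring
    rw [e, e]; exact this
  · intro s s' h
    have h2 : ∀ q : α₁ ⊕ β₁, s (qubit₁ q) = s' (qubit₁ q) := fun q =>
      h _ (by rintro ⟨q', h'⟩; exact qubit₁_ne_qubit₂ _ _ h'.symm)
    have h3 : ∀ q : γ, s (ancilla q) = s' (ancilla q) := fun q =>
      h _ (by rintro ⟨q', h'⟩; exact qubit₂_ne_ancilla _ _ h')
    simp only [h2, h3]

lemma run_map_qubit₁ {g : κ₁ → κ} (hg : g.Injective)
    (F : Fault ((α₁ ⊕ α₂) ⊕ (β₁ ⊕ β₂ ⊕ γ))) (hF : ∀ t a, F t (ancilla a) = 0) (k : κ → ZMod 2)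
    (l : List (Op (α₁ ⊕ β₁) κ₁)) (t : ℕ) (ψ₁ : State (α₁ ⊕ β₁)) (ψ₂ : State (α₂ ⊕ β₂))
    (χ : State γ) :
    PhaseEq (run F k (l.map (Op.map qubit₁ g)) t (tens ψ₁ ψ₂ χ))
      (tens (run (fun u q => F u (qubit₁ q)) (fun b => k (g b)) l t ψ₁)
        (applyPauli (∑ i ∈ Finset.range l.length, fun q => F (t + i) (qubit₂ q)) ψ₂) χ) := by
  induction l generalizing t ψ₁ ψ₂ with
  | nil => exact PhaseEq.of_eq (by simp [run, applyPauli_zero])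
  | cons o l ih =>
    have h0 : (fun a => F t (ancilla a)) = 0 := funext fun a => hF t a
    rw [List.map_cons, run, applyPauli_tens, h0, applyPauli_zero, Op.apply_map_qubit₁ hg, run]
    refine (ih _ _ _).trans ((PhaseEq.refl _).tens ((applyPauli_comp _ _ _).trans
      (PhaseEq.of_eq ?_)) _)
    rw [List.length_cons, Finset.sum_range_succ']
    simp only [add_assoc, add_comm 1, add_zero]

lemma run_map_qubit₂ {g : κ₁ → κ} (hg : g.Injective)
    (F : Fault ((α₁ ⊕ α₂) ⊕ (β₁ ⊕ β₂ ⊕ γ))) (hF : ∀ t a, F t (ancilla a) = 0) (k : κ → ZMod 2)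
    (l : List (Op (α₂ ⊕ β₂) κ₁)) (t : ℕ) (ψ₁ : State (α₁ ⊕ β₁)) (ψ₂ : State (α₂ ⊕ β₂))
    (χ : State γ) :
    PhaseEq (run F k (l.map (Op.map qubit₂ g)) t (tens ψ₁ ψ₂ χ))
      (tens (applyPauli (∑ i ∈ Finset.range l.length, fun q => F (t + i) (qubit₁ q)) ψ₁)
        (run (fun u q => F u (qubit₂ q)) (fun b => k (g b)) l t ψ₂) χ) := by
  induction l generalizing t ψ₁ ψ₂ with
  | nil => exact PhaseEq.of_eq (by simp [run, applyPauli_zero])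
  | cons o l ih =>
    have h0 : (fun a => F t (ancilla a)) = 0 := funext fun a => hF t a
    rw [List.map_cons, run, applyPauli_tens, h0, applyPauli_zero, Op.apply_map_qubit₂ hg, run]
    refine (ih _ _ _).trans (PhaseEq.tens ((applyPauli_comp _ _ _).trans
      (PhaseEq.of_eq ?_)) (PhaseEq.refl _) _)
    rw [List.length_cons, Finset.sum_range_succ']
    simp only [add_assoc, add_comm 1, add_zero]

end Tens

/-! ### Restriction of faults of a joint circuit -/

section Reindex

/-- Restrict a fault to the qubits in the range of `f` and to the time steps below `N`, and move
the faults at time step `u` to the time step `τ u`. -/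
def reindex {Q₁ Q : Type} (f : Q₁ → Q) (τ : ℕ → ℕ) (N : ℕ) : Fault Q →+ Fault Q₁ where
  toFun F t := ∑ u ∈ Finset.range N, if τ u = t then fun q => F u (f q) else 0
  map_zero' := by
    funext t
    refine Finset.sum_eq_zero fun u _ => ?_
    split_ifs <;> rfl
  map_add' F G := by
    funext t
    rw [Pi.add_apply, ← Finset.sum_add_distrib]
    refine Finset.sum_congr rfl fun u _ => ?_
    split_ifs
    · rfl
    · simp

lemma reindex_apply {Q₁ Q : Type} (f : Q₁ → Q) (τ : ℕ → ℕ) (N : ℕ) (F : Fault Q) (t : ℕ) :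
    reindex f τ N F t = ∑ u ∈ Finset.range N, if τ u = t then fun q => F u (f q) else 0 := rfl

lemma reindex_single {Q₁ Q : Type} (f : Q₁ → Q) (τ : ℕ → ℕ) {N u : ℕ} (hu : u < N)
    (p : PauliString Q) :
    reindex f τ N (Pi.single u p) = Pi.single (τ u) fun q => p (f q) := by
  funext t
  rw [reindex_apply, Finset.sum_eq_single u]
  · by_cases h : τ u = t
    · subst h; simp
    · rw [if_neg h, Pi.single_eq_of_ne (Ne.symm h)]
  · intro v _ hv
    rw [Pi.single_eq_of_ne hv]
    split_ifs <;> rfl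
  · intro h; exact absurd (Finset.mem_range.2 hu) h

lemma reindex_eq_zero {Q₁ Q : Type} (f : Q₁ → Q) (τ : ℕ → ℕ) (N : ℕ) (F : Fault Q)
    (h : ∀ t q, F t (f q) = 0) : reindex f τ N F = 0 := by
  funext t
  rw [reindex_apply]
  refine Finset.sum_eq_zero fun u _ => ?_
  simp only [h]
  split_ifs <;> rfl

lemma reindex_min_of_lt {Q₁ Q : Type} (f : Q₁ → Q) {a b t : ℕ} (ht : t < a) (F : Fault Q) :
    reindex f (fun u => min u a) (a + b + 1) F t = fun q => F t (f q) := by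
  rw [reindex_apply, Finset.sum_eq_single t]
  · rw [if_pos (by omega)]
  · intro v _ hv
    rw [if_neg (by omega)]
  · intro h; exact absurd (Finset.mem_range.2 (by omega)) h

lemma reindex_min_self {Q₁ Q : Type} (f : Q₁ → Q) (a b : ℕ) (F : Fault Q) :
    reindex f (fun u => min u a) (a + b + 1) F a =
      (fun q => F (a + b) (f q)) + ∑ i ∈ Finset.range b, fun q => F (a + i) (f q) := by
  rw [reindex_apply, show a + b + 1 = a + (b + 1) by omega, Finset.sum_range_add,
    Finset.sum_eq_zero fun u hu => if_neg (by have := Finset.mem_range.1 hu; omega), zero_add,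
    Finset.sum_range_succ, add_comm]
  congr 1
  · rw [if_pos (by omega)]
  · exact Finset.sum_congr rfl fun i _ => if_pos (by omega)

lemma reindex_sub_zero {Q₁ Q : Type} (f : Q₁ → Q) (a b : ℕ) (F : Fault Q) :
    reindex f (fun u => u - a) (a + b + 1) F 0 =
      (fun q => F a (f q)) + ∑ i ∈ Finset.range a, fun q => F i (f q) := by
  rw [reindex_apply, show a + b + 1 = (a + 1) + b by omega, Finset.sum_range_add,
    Finset.sum_eq_zero (s := Finset.range b) fun u hu => if_neg (by omega), add_zero,
    Finset.sum_range_succ, add_comm]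
  congr 1
  · rw [if_pos (by omega)]
  · exact Finset.sum_congr rfl fun i hi =>
      if_pos (by have := Finset.mem_range.1 hi; omega)

lemma reindex_sub_succ {Q₁ Q : Type} (f : Q₁ → Q) {a b i : ℕ} (hi : i < b) (F : Fault Q) :
    reindex f (fun u => u - a) (a + b + 1) F (i + 1) = fun q => F (a + (i + 1)) (f q) := by
  rw [reindex_apply, Finset.sum_eq_single (a + (i + 1))]
  · rw [if_pos (by omega)]
  · intro v _ hv
    rw [if_neg (by omega)]
  · intro h; exact absurd (Finset.mem_range.2 (by omega)) h

end Reindex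

section Joint

variable {α₁ α₂ β₁ β₂ γ κ₁ κ₂ κ : Type} [Fintype α₁] [Fintype α₂] [Fintype β₁] [Fintype β₂]
  [Fintype γ] [DecidableEq α₁] [DecidableEq α₂] [DecidableEq β₁] [DecidableEq β₂] [DecidableEq γ]
  [DecidableEq κ]

/-- Two circuits executed one after the other on disjoint qubits. -/
lemma evolve_joint {g₁ : κ₁ → κ} (hg₁ : g₁.Injective) {g₂ : κ₂ → κ} (hg₂ : g₂.Injective)
    (F : Fault ((α₁ ⊕ α₂) ⊕ (β₁ ⊕ β₂ ⊕ γ))) (hF : ∀ t a, F t (ancilla a) = 0) (k : κ → ZMod 2)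
    (l₁ : List (Op (α₁ ⊕ β₁) κ₁)) (l₂ : List (Op (α₂ ⊕ β₂) κ₂)) (ψ₁ : State (α₁ ⊕ β₁))
    (ψ₂ : State (α₂ ⊕ β₂)) (χ : State γ) :
    PhaseEq (evolve F k (l₁.map (Op.map qubit₁ g₁) ++ l₂.map (Op.map qubit₂ g₂)) 0 (tens ψ₁ ψ₂ χ))
      (tens
        (evolve (reindex qubit₁ (fun u => min u l₁.length) (l₁.length + l₂.length + 1) F)
          (fun b => k (g₁ b)) l₁ 0 ψ₁)
        (evolve (reindex qubit₂ (fun u => u - l₁.length) (l₁.length + l₂.length + 1) F)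
          (fun b => k (g₂ b)) l₂ 0 ψ₂) χ) := by
  have h0 : ∀ t, (fun a => F t (ancilla a)) = 0 := fun t => funext fun a => hF t a
  rw [evolve_append, List.length_map]
  refine ((run_map_qubit₁ hg₁ F hF k l₁ 0 ψ₁ ψ₂ χ).evolve _ _ _ _).trans ?_
  rw [evolve_eq_run, List.length_map]
  refine ((run_map_qubit₂ hg₂ F hF k l₂ _ _ _ χ).applyPauli _).trans ?_
  rw [applyPauli_tens, h0, applyPauli_zero]
  simp only [zero_add]
  refine PhaseEq.tens ((applyPauli_comp _ _ _).trans (PhaseEq.of_eq ?_)) ?_ χ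
  · rw [evolve_eq_run, zero_add, reindex_min_self]
    congr 1
    refine run_congr _ _ _ _ _ fun i hi => ?_
    rw [zero_add, reindex_min_of_lt _ hi]
  · rw [← evolve_eq_run (fun u q => F u (qubit₂ q))]
    refine evolve_applyPauli _ _ _ _ _ _ _ _ (reindex_sub_zero _ _ _ _) fun i hi => ?_
    rw [show 0 + 1 + i = i + 1 by omega, reindex_sub_succ _ hi, show l₁.length + 1 + i =
      l₁.length + (i + 1) by omega]

end Joint

/-! ### Propagation of Pauli strings through Clifford operations -/

section Frame

variable {Q κ : Type} [DecidableEq Q]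

namespace Op

/-- A CNOT gate, a Pauli measurement or a conditioned Pauli gate. -/
def IsClifford : Op Q κ → Prop
  | cnot _ c t => c ≠ t
  | gate _ _ _ _ => False
  | _ => True

/-- The Pauli string after the operation that has the same effect as `P` before it. -/
def push : Op Q κ → PauliString Q → PauliString Q
  | cnot _ c t, P => fun q =>
      ((P q).1 + if q = t then (P c).1 else 0, (P q).2 + if q = c then (P t).2 else 0)
  | _, P => P

/-- The classical bits whose value is flipped by `P` before the operation. -/
def flip [Fintype Q] [DecidableEq κ] : Op Q κ → PauliString Q → κ → ZMod 2
  | meas _ p b, P => Pi.single b (∑ q, ((p q).1 * (P q).2 + (p q).2 * (P q).1))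
  | _, _ => 0

omit [DecidableEq Q] in
lemma flip_of_writes_ne [Fintype Q] [DecidableEq κ] {o : Op Q κ} {b : κ} (h : o.writes ≠ some b)
    (P : PauliString Q) : o.flip P b = 0 := by
  cases o with
  | meas g p b' =>
    refine Pi.single_eq_of_ne ?_ _
    rintro rfl
    exact h rfl
  | _ => rfl

end Op

/-- The Pauli string after the operations `l` that has the same effect as `P` before them and the
fault `F` inserted into them. -/
def frame (F : Fault Q) : List (Op Q κ) → ℕ → PauliString Q → PauliString Q
  | [], _, P => P
  | o :: l, t, P => frame F l (t + 1) (o.push (F t + P))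

variable [Fintype Q] [DecidableEq κ]

/-- The classical bits flipped by `P` before the operations `l` and the fault `F`. -/
def flips (F : Fault Q) : List (Op Q κ) → ℕ → PauliString Q → κ → ZMod 2
  | [], _, _ => 0
  | o :: l, t, P => o.flip (F t + P) + flips F l (t + 1) (o.push (F t + P))

lemma sum_cnot_exponent {c t : Q} (hct : c ≠ t) (P : PauliString Q) (s : Q → ZMod 2) :
    ∑ q, (P q).2 * ((Function.update s t (s t + s c)) q + (P q).1) =
      ∑ q, ((P q).2 + if q = c then (P t).2 else 0) *
        (s q + ((P q).1 + if q = t then (P c).1 else 0)) := by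
  have hz : ∀ a : ZMod 2, a + a = 0 := fun a => zmod2_add_eq_zero.2 rfl
  have key : ∀ q, (P q).2 * ((Function.update s t (s t + s c)) q + (P q).1) =
      ((P q).2 + if q = c then (P t).2 else 0) * (s q + ((P q).1 + if q = t then (P c).1 else 0)) +
      ((if q = t then (P t).2 * (s c + (P c).1) else 0) +
        if q = c then (P t).2 * (s c + (P c).1) else 0) := by
    intro q
    by_cases h1 : q = t
    · subst h1
      simp only [Function.update_self, if_true, if_neg hct.symm]
      linear_combination -hz ((P q).2 * (P c).1)
    · by_cases h2 : q = c
      · subst h2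
        simp only [Function.update_of_ne h1, if_true, if_neg h1]
        linear_combination -hz ((P t).2 * (s q + (P q).1))
      · simp [h1, h2]
  rw [Finset.sum_congr rfl fun q _ => key q, Finset.sum_add_distrib, Finset.sum_add_distrib]
  simp [hz]

lemma Op.apply_applyPauli {o : Op Q κ} (ho : o.IsClifford) {k k' : κ → ZMod 2} {P : PauliString Q}
    (hw : ∀ b, o.writes = some b → k' b = k b + o.flip P b) (hr : ∀ b ∈ o.reads, k' b = k b)
    (ψ : State Q) : PhaseEq (o.apply k (applyPauli P ψ)) (applyPauli (o.push P) (o.apply k' ψ)) := by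
  cases o with
  | cnot i c t =>
    have hct : c ≠ t := ho
    have h0 : pauliPhase (push (cnot (κ := κ) i c t) P) ≠ 0 := by
      intro h; have := norm_pauliPhase (push (cnot (κ := κ) i c t) P); simp [h] at this
    refine ⟨pauliPhase P * (pauliPhase (push (cnot (κ := κ) i c t) P))⁻¹,
      by simp [norm_pauliPhase], ?_⟩
    funext s
    have h1 : (fun q => (Function.update s t (s t + s c)) q + (P q).1) =
        Function.update (fun q => s q + (push (cnot (κ := κ) i c t) P q).1) t
          ((s t + (push (cnot (κ := κ) i c t) P t).1) +
            (s c + (push (cnot (κ := κ) i c t) P c).1)) := by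
      funext q
      by_cases h : q = t
      · subst h
        simp only [Function.update_self, push, if_true, if_neg hct]
        linear_combination -(zmod2_add_eq_zero (a := (P c).1)).2 rfl
      · simp [push, h]
    simp only [apply, Pi.smul_apply, smul_eq_mul]
    rw [applyPauli_apply, applyPauli_apply, sum_cnot_exponent hct, h1]
    field_simp
    rw [mul_right_comm]
    rfl
  | gate => exact ho.elim
  | meas g p b =>
    refine PhaseEq.of_eq ?_
    have hb := hw b rfl
    simp only [flip, Pi.single_eq_same] at hb
    have h1 : (meas g p b).apply k (applyPauli P ψ) =
        (2⁻¹ : ℂ) • (applyPauli P ψ + sgn (k b) • applyPauli p (applyPauli P ψ)) := by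
      funext s; simp only [apply, Pi.smul_apply, Pi.add_apply, smul_eq_mul]; ring
    have h2 : (meas g p b).apply k' ψ = (2⁻¹ : ℂ) • (ψ + sgn (k' b) • applyPauli p ψ) := by
      funext s; simp only [apply, Pi.smul_apply, Pi.add_apply, smul_eq_mul]; ring
    rw [h1, h2, applyPauli_smul, push, applyPauli_add, applyPauli_smul, applyPauli_comm p P, hb,
      sgn_add, smul_smul]
    · exact fun _ _ _ h => nomatch h
  | condPauli i p S =>
    have hS : ∑ b ∈ S, k' b = ∑ b ∈ S, k b := Finset.sum_congr rfl hr
    simp only [apply, push, hS]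
    split_ifs
    · rw [applyPauli_comm]
      exact ⟨_, norm_sgn _, rfl⟩
    · exact PhaseEq.refl _

lemma flips_eq_zero_of_not_written (F : Fault Q) (l : List (Op Q κ)) (t : ℕ) (P : PauliString Q)
    {b : κ} (hb : b ∉ l.filterMap Op.writes) : flips F l t P b = 0 := by
  induction l generalizing t P with
  | nil => rfl
  | cons o l ih =>
    rw [List.mem_filterMap] at hb
    push Not at hb
    rw [flips, Pi.add_apply, Op.flip_of_writes_ne (hb o (by simp)), zero_add]
    refine ih _ _ ?_
    rw [List.mem_filterMap]
    rintro ⟨o', ho', h⟩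
    exact hb o' (by simp [ho']) h

/-- A Clifford circuit with a fault is the fault-free circuit with some outcomes flipped, followed
by a Pauli string. -/
lemma run_applyPauli (F : Fault Q) (k k' : κ → ZMod 2) (l : List (Op Q κ))
    (hl : ∀ o ∈ l, o.IsClifford) (hn : (l.filterMap Op.writes).Nodup) (t : ℕ) (P : PauliString Q)
    (hw : ∀ b ∈ l.filterMap Op.writes, k' b = k b + flips F l t P b)
    (hr : ∀ o ∈ l, ∀ b ∈ o.reads, k' b = k b) (ψ : State Q) :
    PhaseEq (run F k l t (applyPauli P ψ)) (applyPauli (frame F l t P) (run 0 k' l t ψ)) := by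
  induction l generalizing t P ψ with
  | nil => exact PhaseEq.refl _
  | cons o l ih =>
    simp only [run, frame, Pi.zero_apply, applyPauli_zero]
    have hn' : (l.filterMap Op.writes).Nodup :=
      hn.sublist ((List.sublist_cons_self o l).filterMap _)
    refine ((((applyPauli_comp _ _ _).opApply k o).trans
      (Op.apply_applyPauli (hl o (by simp)) (k' := k') ?_ (hr o (by simp)) ψ)).run _ _ _ _).trans
      (ih (fun o' ho' => hl o' (by simp [ho'])) hn' _ _ ?_
        (fun o' ho' => hr o' (by simp [ho'])) _)
    · intro b hb
      have hm : b ∉ l.filterMap Op.writes := by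
        rw [List.filterMap_cons_some hb] at hn
        exact (List.nodup_cons.1 hn).1
      rw [hw b (by rw [List.filterMap_cons_some hb]; simp), flips, Pi.add_apply,
        flips_eq_zero_of_not_written _ _ _ _ hm, add_zero]
    · intro b hb
      have h1 : b ∈ (o :: l).filterMap Op.writes := by
        rw [List.mem_filterMap] at hb ⊢
        obtain ⟨o', ho', h⟩ := hb
        exact ⟨o', by simp [ho'], h⟩
      have h2 : o.writes ≠ some b := by
        intro h
        rw [List.filterMap_cons_some h] at hn
        exact (List.nodup_cons.1 hn).1 hb
      rw [hw b h1, flips, Pi.add_apply, Op.flip_of_writes_ne h2, zero_add]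

omit [Fintype Q] [DecidableEq κ] in
/-- The `X` part of a Pauli string on a qubit that is not the target of a CNOT is preserved. -/
lemma frame_fst {q : Q} (F : Fault Q) (l : List (Op Q κ)) (hl : ∀ i c, Op.cnot i c q ∉ l) (t : ℕ)
    (P : PauliString Q) :
    (frame F l t P q).1 = (P q).1 + ∑ i ∈ Finset.range l.length, (F (t + i) q).1 := by
  induction l generalizing t P with
  | nil => simp [frame]
  | cons o l ih =>
    rw [frame, ih (fun i c h => hl i c (by simp [h])), List.length_cons, Finset.sum_range_succ']
    have : (o.push (F t + P) q).1 = (P q).1 + (F t q).1 := by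
      cases o with
      | cnot i c t' =>
        have : q ≠ t' := by
          rintro rfl
          exact hl i c (by simp)
        simp [Op.push, this, add_comm]
      | _ => simp [Op.push, add_comm]
    rw [this]
    simp only [add_assoc, add_comm 1, add_zero]
    congr 1
    rw [add_comm]

/-- All the operations that can affect the bit `b` act inside or outside of the set `B`. -/
def Op.Confined (B : Set Q) (b : κ) : Op Q κ → Prop
  | cnot _ c t => c ∈ B ↔ t ∈ B
  | meas _ p b' => b' = b → ∀ q, p q ≠ 0 → q ∈ B
  | _ => True

lemma flips_eq_zero_of_confined {B : Set Q} {b : κ} {F : Fault Q} (l : List (Op Q κ))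
    (hl : ∀ o ∈ l, o.Confined B b) (hF : ∀ t, ∀ q ∈ B, F t q = 0) (t : ℕ) (P : PauliString Q)
    (hP : ∀ q ∈ B, P q = 0) : flips F l t P b = 0 := by
  induction l generalizing t P with
  | nil => rfl
  | cons o l ih =>
    have hP' : ∀ q ∈ B, (F t + P) q = 0 := fun q hq => by simp [hF t q hq, hP q hq]
    have ho := hl o (by simp)
    rw [flips, Pi.add_apply, ih (fun o' ho' => hl o' (by simp [ho'])), add_zero]
    · cases o with
      | meas g p b' =>
        by_cases hb : b' = b
        · subst hb
          rw [Op.flip, Pi.single_eq_same]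
          refine Finset.sum_eq_zero fun q _ => ?_
          by_cases hq : p q = 0
          · simp [hq]
          · rw [hP' q (ho rfl q hq)]; simp
        · exact Pi.single_eq_of_ne (Ne.symm hb) _
      | _ => rfl
    · intro q hq
      cases o with
      | cnot i c t' =>
        have h1 : (if q = t' then ((F t + P) c).1 else 0) = 0 := by
          split_ifs with h
          · subst h; rw [hP' c (ho.2 hq)]; rfl
          · rfl
        have h2 : (if q = c then ((F t + P) t').2 else 0) = 0 := by
          split_ifs with h
          · subst h; rw [hP' t' (ho.1 hq)]; rfl
          · rfl
        simp only [Op.push, h1, h2, hP' q hq]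
        rfl
      | _ => exact hP' q hq

end Frame

/-! ### Faults and their weights -/

section Weight

variable {α β κ : Type} [Fintype α] [DecidableEq α] [Fintype β] [DecidableEq β]

lemma Circuit.mem_faults_iff {C : Circuit α β κ} {F : Fault (α ⊕ β)} :
    F ∈ C.faults ↔ ∃ l : List (Fault (α ⊕ β)), (∀ f ∈ l, f ∈ C.noise) ∧ l.sum = F := by
  constructor
  · intro hF
    refine AddSubgroup.closure_induction (fun x hx => ⟨[x], by simpa using hx, by simp⟩)
      ⟨[], by simp, rfl⟩ ?_ ?_ hF
    · rintro x y - - ⟨l, hl, rfl⟩ ⟨l', hl', rfl⟩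
      refine ⟨l ++ l', fun f hf => ?_, List.sum_append⟩
      rcases List.mem_append.1 hf with h | h
      exacts [hl f h, hl' f h]
    · rintro x - ⟨l, hl, rfl⟩
      refine ⟨l, hl, ?_⟩
      rw [eq_neg_iff_add_eq_zero]
      funext t
      exact add_self_eq_zero _
  · rintro ⟨l, hl, rfl⟩
    exact AddSubgroup.list_sum_mem _ fun f hf => AddSubgroup.subset_closure (hl f hf)

lemma Circuit.exists_list_of_mem_faults {C : Circuit α β κ} {F : Fault (α ⊕ β)}
    (hF : F ∈ C.faults) :
    ∃ l : List (Fault (α ⊕ β)), l.length = C.wt F ∧ (∀ f ∈ l, f ∈ C.noise) ∧ l.sum = F := by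
  obtain ⟨l, hl, h⟩ := mem_faults_iff.1 hF
  exact Nat.sInf_mem (s := {m | ∃ l : List (Fault (α ⊕ β)), l.length = m ∧ (∀ f ∈ l, f ∈ C.noise) ∧
    l.sum = F}) ⟨_, l, rfl, hl, h⟩

lemma Circuit.wt_sum_le {C : Circuit α β κ} {l : List (Fault (α ⊕ β))}
    (hl : ∀ f ∈ l, f ∈ C.noise) : C.wt l.sum ≤ l.length :=
  Nat.sInf_le ⟨l, rfl, hl, rfl⟩

lemma sum_single_supp {Q : Type} [Fintype Q] [DecidableEq Q] (p : PauliString Q) :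
    ((supp p).toList.map fun q => (Pi.single q (p q) : PauliString Q)).sum = p := by
  rw [Finset.sum_map_toList]
  have : ∑ q ∈ supp p, (Pi.single q (p q) : PauliString Q) = ∑ q, Pi.single q (p q) :=
    Finset.sum_subset (Finset.subset_univ _) fun q _ hq => by
      rw [mem_supp, not_not] at hq
      rw [hq, Pi.single_zero]
  rw [this, Finset.univ_sum_single]

/-- A Pauli string on noisy wires is a fault of weight at most the number of these wires. -/
lemma Circuit.single_mem_faults {C : Circuit α β κ} {t : ℕ} (ht : t ≤ C.ops.length)
    {p : PauliString (α ⊕ β)} (hp : ∀ q, p q ≠ 0 → C.noisy t q) :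
    Pi.single t p ∈ C.faults ∧ C.wt (Pi.single t p) ≤ (supp p).card := by
  have h : ∀ f ∈ (supp p).toList.map fun q =>
      (Pi.single t (Pi.single q (p q)) : Fault (α ⊕ β)), f ∈ C.noise := by
    intro f hf
    obtain ⟨q, hq, rfl⟩ := List.mem_map.1 hf
    exact Or.inl ⟨t, q, p q, ht, hp q (mem_supp.1 (Finset.mem_toList.1 hq)), rfl⟩
  have hs : ((supp p).toList.map fun q =>
      (Pi.single t (Pi.single q (p q)) : Fault (α ⊕ β))).sum = Pi.single t p := by
    have := map_list_sum (AddMonoidHom.single (fun _ : ℕ => PauliString (α ⊕ β)) t)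
      ((supp p).toList.map fun q => (Pi.single q (p q) : PauliString (α ⊕ β)))
    rw [sum_single_supp, List.map_map] at this
    exact this.symm
  refine ⟨mem_faults_iff.2 ⟨_, h, hs⟩, ?_⟩
  have := wt_sum_le h
  rwa [hs, List.length_map, Finset.length_toList] at this

lemma card_supp_list_sum {Q : Type} [Fintype Q] [DecidableEq Q] (l : List (PauliString Q))
    (hl : ∀ p ∈ l, (supp p).card ≤ 1) : (supp l.sum).card ≤ l.length := by
  induction l with
  | nil => simp [supp]
  | cons p l ih =>
    have h1 : supp (p + l.sum) ⊆ supp p ∪ supp l.sum := by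
      intro q hq
      rw [Finset.mem_union, mem_supp, mem_supp]
      by_contra! h
      exact mem_supp.1 hq (by simp [h.1, h.2])
    rw [List.sum_cons, List.length_cons]
    have h2 := Finset.card_le_card h1
    have h3 := Finset.card_union_le (supp p) (supp l.sum)
    have h4 := hl p (by simp)
    have h5 := ih fun p' hp' => hl p' (by simp [hp'])
    omega

end Weight

/-! ### Purity -/

lemma exists_scalars_of_sum_eq_pure {ι X : Type*} [Fintype ι] (v : ι → X → ℂ) (g : X → ℂ)
    (hg : g ≠ 0) (h : ∀ x y, ∑ i, v i x * conj (v i y) = g x * conj (g y)) :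
    ∃ c : ι → ℂ, (∀ i x, v i x = g x * c i) ∧ ∑ i, ‖c i‖ ^ 2 = 1 := by
  obtain ⟨x₀, hx₀⟩ := Function.ne_iff.1 hg
  have hx₀' : g x₀ ≠ 0 := hx₀
  have key : ∀ i x, g x₀ * v i x = g x * v i x₀ := by
    intro i x
    have h1 : ∑ i, (g x₀ * v i x - g x * v i x₀) * conj (g x₀ * v i x - g x * v i x₀) = 0 := by
      have : ∀ i, (g x₀ * v i x - g x * v i x₀) * conj (g x₀ * v i x - g x * v i x₀) =
          g x₀ * conj (g x₀) * (v i x * conj (v i x)) - g x₀ * conj (g x) * (v i x * conj (v i x₀))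
          - g x * conj (g x₀) * (v i x₀ * conj (v i x))
          + g x * conj (g x) * (v i x₀ * conj (v i x₀)) := by
        intro i; simp only [map_sub, map_mul]; ring
      simp only [this, Finset.sum_add_distrib, Finset.sum_sub_distrib, ← Finset.mul_sum, h]
      ring
    have h2 : ∑ i, ‖g x₀ * v i x - g x * v i x₀‖ ^ 2 = 0 := by
      have : ((∑ i, ‖g x₀ * v i x - g x * v i x₀‖ ^ 2 : ℝ) : ℂ) = 0 := by
        rw [← h1, Complex.ofReal_sum]
        refine Finset.sum_congr rfl fun i _ => ?_
        rw [Complex.mul_conj, Complex.normSq_eq_norm_sq]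
      exact_mod_cast this
    have h3 := (Finset.sum_eq_zero_iff_of_nonneg fun i _ => by positivity).1 h2 i
      (Finset.mem_univ _)
    exact sub_eq_zero.1 (norm_eq_zero.1 (pow_eq_zero_iff two_ne_zero |>.1 h3))
  refine ⟨fun i => v i x₀ / g x₀, fun i x => ?_, ?_⟩
  · have := key i x
    field_simp
    linear_combination this
  · have h1 := h x₀ x₀
    simp only [Complex.mul_conj, Complex.normSq_eq_norm_sq] at h1
    have h2 : ∑ i, ‖v i x₀‖ ^ 2 = ‖g x₀‖ ^ 2 := by exact_mod_cast h1
    have h3 : ‖g x₀‖ ^ 2 ≠ 0 := by simpa using hx₀'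
    simp only [norm_div, div_pow, ← Finset.sum_div, h2, div_self h3]

/-! ### Cat states with Pauli errors -/

section Cat

variable {α : Type} [Fintype α] [DecidableEq α]

omit [DecidableEq α] in
lemma applyPauli_sum {β : Type} [Fintype β] (P : PauliString (α ⊕ β)) (ψ : State α) (φ : State β) :
    applyPauli P (fun s => ψ (fun q => s (Sum.inl q)) * φ fun q => s (Sum.inr q)) =
      fun s => applyPauli (fun q => P (Sum.inl q)) ψ (fun q => s (Sum.inl q)) *
        applyPauli (fun q => P (Sum.inr q)) φ fun q => s (Sum.inr q) := by
  funext s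
  simp only [applyPauli_apply, pauliPhase, Fintype.sum_sum_type, Fintype.prod_sum_type, sgn_add]
  ring

/-- The density matrix of the cat state with a Pauli error. -/
def catOutput (p : PauliString α) : Matrix (α → ZMod 2) (α → ZMod 2) ℂ :=
  Matrix.of fun x y => applyPauli p (catState α) x * conj (applyPauli p (catState α) y)

lemma idealCat_branch (G : Fault (α ⊕ Empty)) (k : Empty → ZMod 2) :
    (idealCat α).branch G k = fun s =>
      applyPauli (fun q => G 0 (Sum.inl q)) (catState α) fun q => s (Sum.inl q) := by
  have := applyPauli_sum (G 0) (catState α) (fun _ : Empty → ZMod 2 => (1 : ℂ))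
  have h0 : (fun q : Empty => G 0 (Sum.inr q)) = 0 := Subsingleton.elim _ _
  rw [h0, applyPauli_zero] at this
  simp only [mul_one] at this
  exact this

lemma idealCat_output (G : Fault (α ⊕ Empty)) :
    (idealCat α).output G = catOutput fun q => G 0 (Sum.inl q) := by
  ext x y
  simp [Circuit.output, catOutput, idealCat_branch]

lemma catState_norm [Nonempty α] : ∑ s, ‖catState α s‖ ^ 2 = 1 := by
  have h01 : (0 : α → ZMod 2) ≠ 1 := fun h =>
    zero_ne_one (α := ZMod 2) (congrFun h (Classical.arbitrary α))
  have h : ∀ s : α → ZMod 2, ‖catState α s‖ ^ 2 =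
      (if s = 0 then 1 / 2 else 0) + if s = 1 then 1 / 2 else 0 := by
    intro s
    have h2 : ‖((Real.sqrt 2 : ℝ) : ℂ)‖ ^ 2 = 2 := by
      rw [Complex.norm_real, Real.norm_eq_abs, sq_abs, Real.sq_sqrt (by norm_num)]
    unfold catState
    rw [norm_div, div_pow, h2]
    by_cases h0 : s = 0
    · subst h0; simp [h01]
    · by_cases h1 : s = 1
      · subst h1; simp [h01.symm]
      · simp [h0, h1]
  simp only [h, Finset.sum_add_distrib, Finset.sum_ite_eq', Finset.mem_univ, if_true]
  norm_num

lemma applyPauli_catState_ne_zero [Nonempty α] (p : PauliString α) :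
    applyPauli p (catState α) ≠ 0 := by
  intro h
  have := sum_norm_applyPauli p (catState α)
  rw [h, catState_norm] at this
  simp at this

lemma catState_eq_zero {s : α → ZMod 2} (h0 : s ≠ 0) (h1 : s ≠ 1) : catState α s = 0 := by
  simp [catState, h0, h1]

lemma catOutput_congr {p p' : PauliString α} (h1 : ∀ q, (p q).1 = (p' q).1)
    (h2 : ∑ q, (p q).2 = ∑ q, (p' q).2) : catOutput p = catOutput p' := by
  have h0 : pauliPhase p' ≠ 0 := by
    intro h; have := norm_pauliPhase p'; simp [h] at this
  have h : PhaseEq (applyPauli p (catState α)) (applyPauli p' (catState α)) := by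
    refine ⟨pauliPhase p * (pauliPhase p')⁻¹, by simp [norm_pauliPhase], ?_⟩
    funext s
    rw [Pi.smul_apply, smul_eq_mul, applyPauli_apply, applyPauli_apply]
    simp only [h1]
    have h3 : sgn (∑ q, (p q).2 * (s q + (p' q).1)) * catState α (fun q => s q + (p' q).1) =
        sgn (∑ q, (p' q).2 * (s q + (p' q).1)) * catState α (fun q => s q + (p' q).1) := by
      by_cases ha : (fun q => s q + (p' q).1) = 0
      · have : ∀ q, s q + (p' q).1 = 0 := fun q => congrFun ha q
        simp [this]
      · by_cases hb : (fun q => s q + (p' q).1) = 1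
        · have : ∀ q, s q + (p' q).1 = 1 := fun q => congrFun hb q
          simp [this, h2]
        · rw [catState_eq_zero ha hb]; simp
    field_simp
    linear_combination pauliPhase p * h3
  ext x y
  exact h.mul_conj x y

/-- Up to stabilisers of the cat state, the weight of a Pauli error is that of its `X` part, or one
if the error is purely of `Z` type. -/
lemma exists_catOutput_eq [Nonempty α] (p : PauliString α) {m : ℕ}
    (hm : (Finset.univ.filter fun q => (p q).1 ≠ 0).card ≤ m) (h0 : m = 0 → p = 0) :
    ∃ p' : PauliString α, (supp p').card ≤ m ∧ catOutput p = catOutput p' := by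
  by_cases hm0 : m = 0
  · exact ⟨p, by simp [h0 hm0, supp], rfl⟩
  obtain ⟨q₀, hq₀⟩ : ∃ q₀, (∃ q, (p q).1 ≠ 0) → (p q₀).1 ≠ 0 := by
    by_cases h : ∃ q, (p q).1 ≠ 0
    · obtain ⟨q, hq⟩ := h; exact ⟨q, fun _ => hq⟩
    · exact ⟨Classical.arbitrary α, fun h' => absurd h' h⟩
  refine ⟨fun q => ((p q).1, if q = q₀ then ∑ q, (p q).2 else 0), ?_, ?_⟩
  · by_cases h : ∃ q, (p q).1 ≠ 0
    · refine (Finset.card_le_card fun q hq => ?_).trans hm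
      rw [Finset.mem_filter]
      refine ⟨Finset.mem_univ _, fun hq1 => mem_supp.1 hq ?_⟩
      have : q ≠ q₀ := by rintro rfl; exact hq₀ h hq1
      simp [hq1, this]
    · have hs : supp (fun q => ((p q).1, if q = q₀ then ∑ q, (p q).2 else 0) :
          PauliString α) ⊆ {q₀} := by
        intro q hq
        rw [Finset.mem_singleton]
        by_contra hne
        push Not at h
        exact mem_supp.1 hq (by simp [h q, hne])
      have := Finset.card_le_card hs
      rw [Finset.card_singleton] at this
      omega
  · exact catOutput_congr (fun _ => rfl) (by simp)

/-- The weight bounds the support of a fault of the idealised cat state preparation. -/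
lemma card_supp_le_wt_idealCat {G : Fault (α ⊕ Empty)} (hG : G ∈ (idealCat α).faults) :
    (supp fun q => G 0 (Sum.inl q)).card ≤ (idealCat α).wt G := by
  obtain ⟨l, hl, hn, rfl⟩ := Circuit.exists_list_of_mem_faults hG
  rw [← hl]
  let φ : Fault (α ⊕ Empty) →+ PauliString α :=
    { toFun := fun G q => G 0 (Sum.inl q)
      map_zero' := rfl
      map_add' := fun _ _ => rfl }
  have h : (fun q => l.sum 0 (Sum.inl q)) = (l.map φ).sum := map_list_sum φ l
  rw [h, ← List.length_map (f := φ)]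
  refine card_supp_list_sum _ fun p hp => ?_
  obtain ⟨f, hf, rfl⟩ := List.mem_map.1 hp
  rcases hn f hf with ⟨t, q, p, ht, -, rfl⟩ | ⟨t, o, ho, -⟩
  · refine (Finset.card_le_card (t := Finset.univ.filter fun q' => Sum.inl q' = q)
      fun q' hq' => ?_).trans ?_
    · rw [Finset.mem_filter]
      refine ⟨Finset.mem_univ _, ?_⟩
      by_contra hne
      refine mem_supp.1 hq' ?_
      obtain rfl : t = 0 := Nat.le_zero.1 ht
      simp [φ, hne]
    · refine Finset.card_le_one.2 fun a ha b hb => ?_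
      rw [Finset.mem_filter] at ha hb
      exact Sum.inl_injective (ha.2.trans hb.2.symm)
  · simp [idealCat] at ho

lemma single_mem_faults_idealCat (p : PauliString α) :
    (Pi.single 0 (Sum.elim p 0) : Fault (α ⊕ Empty)) ∈ (idealCat α).faults ∧
      (idealCat α).wt (Pi.single 0 (Sum.elim p 0)) ≤ (supp p).card := by
  obtain ⟨h1, h2⟩ := Circuit.single_mem_faults (C := idealCat α) (t := 0) (Nat.zero_le _)
    (p := Sum.elim p 0) fun _ _ => trivial
  refine ⟨h1, h2.trans ?_⟩
  refine Finset.card_le_card_of_surjOn Sum.inl ?_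
  rintro (q | q) hq
  · have := mem_supp.1 (Finset.mem_coe.1 hq)
    exact ⟨q, Finset.mem_coe.2 (mem_supp.2 this), rfl⟩
  · exact q.elim

end Cat

/-! ### Atomic faults of renamed operations -/

section MapFaults

variable {Q₁ Q κ₁ κ : Type} [Fintype Q₁] [DecidableEq Q₁] [Fintype Q] [DecidableEq Q]
  [DecidableEq κ]

omit [DecidableEq Q₁] in
lemma supp_extend_subset {f : Q₁ → Q} (hf : f.Injective) (p : PauliString Q₁) :
    supp (Function.extend f p 0) ⊆ (supp p).image f := by
  intro q hq
  rw [mem_supp] at hq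
  by_cases h : ∃ q', f q' = q
  · obtain ⟨q', rfl⟩ := h
    rw [hf.extend_apply] at hq
    exact Finset.mem_image_of_mem _ (mem_supp.2 hq)
  · rw [Function.extend_apply' _ _ _ h] at hq
    exact absurd rfl hq

lemma Op.support_map_subset {f : Q₁ → Q} (hf : f.Injective) (g : κ₁ → κ) (o : Op Q₁ κ₁) :
    (o.map f g).support ⊆ o.support.image f := by
  cases o with
  | cnot i c t => simp [map, support, Finset.image_insert]
  | gate i r e U => simp [map, support, Finset.image_image, Function.comp_def]
  | meas => exact supp_extend_subset hf _
  | condPauli => exact supp_extend_subset hf _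

omit [DecidableEq Q₁] in
lemma supp_comp_subset {f : Q₁ → Q} (hf : f.Injective) {r : PauliString Q}
    {S : Finset Q₁} (h : supp r ⊆ S.image f) : supp (fun q => r (f q)) ⊆ S := by
  intro q hq
  have hq1 := mem_supp.1 hq
  obtain ⟨q', hq', he⟩ := Finset.mem_image.1 (h (mem_supp.2 hq1))
  rwa [← hf he]

lemma Op.AtomicFault.of_map {f : Q₁ → Q} (hf : f.Injective) {g : κ₁ → κ} {t : ℕ} {o : Op Q₁ κ₁}
    {F : Fault Q} (h : (o.map f g).AtomicFault t F) :
    (∀ u q, q ∉ Set.range f → F u q = 0) ∧ (∀ u, u ≠ t → u ≠ t + 1 → F u = 0) ∧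
      ∀ (τ : ℕ → ℕ) (N : ℕ), t + 1 < N → τ (t + 1) = τ t + 1 →
        o.AtomicFault (τ t) (reindex f τ N F) := by
  have hout : ∀ (r : PauliString Q) (S : Finset Q₁), supp r ⊆ S.image f →
      ∀ q, q ∉ Set.range f → r q = 0 := by
    intro r S hr q hq
    by_contra hne
    obtain ⟨q', -, he⟩ := Finset.mem_image.1 (hr (mem_supp.2 hne))
    exact hq ⟨q', he⟩
  have hanti : ∀ (a : PauliString Q) (p : PauliString Q₁),
      Anticommute a (Function.extend f p 0) → Anticommute (fun q => a (f q)) p := by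
    intro a p ha
    rw [Anticommute] at ha ⊢
    rw [← ha]
    refine Fintype.sum_of_injective f hf _ _ (fun q hq => ?_) fun q => ?_
    · rw [Function.extend_apply' _ _ _ hq]; simp
    · rw [hf.extend_apply]
  have hsingle : ∀ (u v : ℕ) (r : PauliString Q), r = 0 ∨ u ≠ v →
      (Pi.single v r : Fault Q) u = 0 := by
    rintro u v r (rfl | h)
    · simp
    · exact Pi.single_eq_of_ne h _
  have hgate : ∀ r : PauliString Q, supp r ⊆ (o.map f g).support → (o.map f g).IsFaulty →
      (∀ u q, q ∉ Set.range f → (Pi.single (t + 1) r : Fault Q) u q = 0) ∧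
      (∀ u, u ≠ t → u ≠ t + 1 → (Pi.single (t + 1) r : Fault Q) u = 0) ∧
      ∀ (τ : ℕ → ℕ) (N : ℕ), t + 1 < N → τ (t + 1) = τ t + 1 →
        o.AtomicFault (τ t) (reindex f τ N (Pi.single (t + 1) r)) := by
    intro r hr ho
    have hr' := hr.trans (support_map_subset hf g o)
    refine ⟨fun u q hq => ?_, fun u _ h => Pi.single_eq_of_ne h _, fun τ N hN hτ => ?_⟩
    · by_cases hu : u = t + 1
      · subst hu; rw [Pi.single_eq_same]; exact hout r _ hr' q hq
      · rw [Pi.single_eq_of_ne hu]; rfl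
    · rw [reindex_single f τ hN, hτ]
      refine .gateFault o _ ?_ (supp_comp_subset hf hr')
      cases o <;> exact ho
  have hflip : ∀ (p : PauliString Q₁) (a r : PauliString Q),
      supp a ⊆ supp (Function.extend f p 0) → supp r ⊆ supp (Function.extend f p 0) →
      (∀ u q, q ∉ Set.range f →
        (Pi.single t a + Pi.single (t + 1) (a + r) : Fault Q) u q = 0) ∧
      (∀ u, u ≠ t → u ≠ t + 1 → (Pi.single t a + Pi.single (t + 1) (a + r) : Fault Q) u = 0) ∧
      supp (fun q => a (f q)) ⊆ supp p ∧ supp (fun q => r (f q)) ⊆ supp p ∧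
      (supp fun q => r (f q)).card ≤ (supp r).card ∧
      ∀ (τ : ℕ → ℕ) (N : ℕ), t + 1 < N → τ (t + 1) = τ t + 1 →
        reindex f τ N (Pi.single t a + Pi.single (t + 1) (a + r)) =
          Pi.single (τ t) (fun q => a (f q)) +
            Pi.single (τ t + 1) ((fun q => a (f q)) + fun q => r (f q)) := by
    intro p a r ha hr
    have ha' := ha.trans (supp_extend_subset hf p)
    have hr' := hr.trans (supp_extend_subset hf p)
    refine ⟨fun u q hq => ?_, fun u h1 h2 => ?_, supp_comp_subset hf ha', supp_comp_subset hf hr',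
      ?_, fun τ N hN hτ => ?_⟩
    · have h1 := hout a _ ha' q hq
      have h2 := hout r _ hr' q hq
      simp only [Pi.add_apply, Pi.single_apply]
      split_ifs <;> simp [h1, h2]
    · rw [Pi.add_apply, Pi.single_eq_of_ne h1, Pi.single_eq_of_ne h2, add_zero]
    · refine Finset.card_le_card_of_injOn f (fun q hq => ?_) hf.injOn
      have := mem_supp.1 (Finset.mem_coe.1 hq)
      exact Finset.mem_coe.2 (mem_supp.2 this)
    · rw [map_add, reindex_single f τ (by omega), reindex_single f τ hN, hτ]
      rfl
  cases o with
  | cnot => cases h with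
    | gateFault _ r ho hr => exact hgate r hr ho
  | gate => cases h with
    | gateFault _ r ho hr => exact hgate r hr ho
  | condPauli => cases h with
    | gateFault _ r ho hr => exact hgate r hr ho
  | meas l p b =>
    cases h with
    | gateFault _ r ho hr => exact hgate r hr ho
    | flip _ _ a r ha hap hr =>
      obtain ⟨h1, h2, h3, h4, -, h6⟩ := hflip p a r ha hr
      refine ⟨h1, h2, fun τ N hN hτ => ?_⟩
      rw [h6 τ N hN hτ]
      exact .flip _ _ _ _ h3 (hanti a p hap) h4
    | flipFT _ _ a r ha hap hr hr1 =>
      obtain ⟨h1, h2, h3, h4, h5, h6⟩ := hflip p a r ha hr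
      refine ⟨h1, h2, fun τ N hN hτ => ?_⟩
      rw [h6 τ N hN hτ]
      exact .flipFT _ _ _ _ h3 (hanti a p hap) h4 (h5.trans hr1)

end MapFaults

/-! ### Faults of a joint circuit -/

section JoinNoise

variable {Q κ : Type} [Fintype Q] [DecidableEq Q]

lemma Op.AtomicFault.eq_zero_of_lt {o : Op Q κ} {t u : ℕ} {F : Fault Q} (h : o.AtomicFault t F)
    (hu : u < t) : F u = 0 := by
  cases h with
  | gateFault r ho hr => exact Pi.single_eq_of_ne (by omega) _
  | flip p b a r =>
    rw [Pi.add_apply, Pi.single_eq_of_ne (by omega), Pi.single_eq_of_ne (by omega), add_zero]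
  | flipFT p b a r =>
    rw [Pi.add_apply, Pi.single_eq_of_ne (by omega), Pi.single_eq_of_ne (by omega), add_zero]

variable {α₁ α₂ β₁ β₂ γ κ₁ κ₂ δ : Type} [Fintype α₁] [Fintype α₂] [Fintype β₁] [Fintype β₂]
  [Fintype γ] [DecidableEq α₁] [DecidableEq α₂] [DecidableEq β₁] [DecidableEq β₂] [DecidableEq γ]
  [DecidableEq κ₁] [DecidableEq κ₂] [DecidableEq δ]
  (A : Circuit α₁ β₁ κ₁) (B : Circuit α₂ β₂ κ₂)
  (l : List (Op ((α₁ ⊕ α₂) ⊕ (β₁ ⊕ β₂ ⊕ γ)) (κ₁ ⊕ κ₂ ⊕ δ)))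

/-- The fault of the first circuit that is caused by a fault of the joint circuit. -/
abbrev restrict₁ : Fault ((α₁ ⊕ α₂) ⊕ (β₁ ⊕ β₂ ⊕ γ)) →+ Fault (α₁ ⊕ β₁) :=
  reindex qubit₁ (fun u => min u A.ops.length) (A.ops.length + B.ops.length + 1)

/-- The fault of the second circuit that is caused by a fault of the joint circuit. -/
abbrev restrict₂ : Fault ((α₁ ⊕ α₂) ⊕ (β₁ ⊕ β₂ ⊕ γ)) →+ Fault (α₂ ⊕ β₂) :=
  reindex qubit₂ (fun u => u - A.ops.length) (A.ops.length + B.ops.length + 1)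

/-- A fault of the joint circuit that is an atomic fault of the first circuit. -/
structure IsFirstFault (F : Fault ((α₁ ⊕ α₂) ⊕ (β₁ ⊕ β₂ ⊕ γ))) : Prop where
  late : ∀ t, A.ops.length + B.ops.length < t → F t = 0
  outside : ∀ t q, q ∉ Set.range (qubit₁ : α₁ ⊕ β₁ → _) → F t q = 0
  mem : restrict₁ A B F ∈ A.noise

/-- A fault of the joint circuit that is an atomic fault of the second circuit. -/
structure IsSecondFault (F : Fault ((α₁ ⊕ α₂) ⊕ (β₁ ⊕ β₂ ⊕ γ))) : Prop where
  late : ∀ t, A.ops.length + B.ops.length < t → F t = 0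
  outside : ∀ t q, q ∉ Set.range (qubit₂ : α₂ ⊕ β₂ → _) → F t q = 0
  mem : restrict₂ A B F ∈ B.noise

/-- A fault on a single wire, or an atomic fault of one of the operations `l`, the first of which
takes place after time step `T`. -/
structure IsLateFault (l : List (Op Q κ)) (T : ℕ) (F : Fault Q) : Prop where
  early : ∀ t, t < T → F t = 0
  cases : (∃ t q p, F = Pi.single t (Pi.single q p)) ∨
    ∃ (t : ℕ) (o : Op Q κ), l[t]? = some o ∧ o.AtomicFault (T + t) F

lemma Circuit.noise_join {F : Fault ((α₁ ⊕ α₂) ⊕ (β₁ ⊕ β₂ ⊕ γ))} (hF : F ∈ (A.join B l).noise) :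
    IsFirstFault A B F ∨ IsSecondFault A B F ∨
      IsLateFault l (A.ops.length + B.ops.length) F := by
  rcases hF with ⟨t, q, p, ht, hn, rfl⟩ | ⟨t, o, ho, hF⟩
  · by_cases hT : A.ops.length + B.ops.length ≤ t
    · exact Or.inr (Or.inr ⟨fun u hu => Pi.single_eq_of_ne (by omega) _, Or.inl ⟨t, q, p, rfl⟩⟩)
    · rcases hn with ⟨q, rfl, hn⟩ | ⟨q, rfl, hn⟩ | hn
      · refine Or.inl ⟨fun u hu => Pi.single_eq_of_ne (by omega) _, fun u q' hq' => ?_, ?_⟩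
        · have : q' ≠ qubit₁ q := fun h => hq' ⟨q, h.symm⟩
          simp only [Pi.single_apply]
          split_ifs <;> simp [this]
        · rw [restrict₁, reindex_single _ _ (by omega)]
          refine Or.inl ⟨_, q, p, min_le_right _ _, hn, ?_⟩
          congr 1
          funext q'
          simp only [Pi.single_apply, qubit₁_injective.eq_iff]
      · refine Or.inr (Or.inl ⟨fun u hu => Pi.single_eq_of_ne (by omega) _, fun u q' hq' => ?_, ?_⟩)
        · have : q' ≠ qubit₂ q := fun h => hq' ⟨q, h.symm⟩
          simp only [Pi.single_apply]
          split_ifs <;> simp [this]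
        · rw [restrict₂, reindex_single _ _ (by omega)]
          refine Or.inl ⟨_, q, p, by omega, hn, ?_⟩
          congr 1
          funext q'
          simp only [Pi.single_apply, qubit₂_injective.eq_iff]
      · exact absurd hn hT
  · simp only [Circuit.join, List.getElem?_append, List.length_map, List.getElem?_map] at ho
    split_ifs at ho with h1 h2
    · obtain ⟨o', ho', rfl⟩ := Option.map_eq_some_iff.1 ho
      obtain ⟨h3, h4, h5⟩ := hF.of_map qubit₁_injective
      refine Or.inl ⟨fun u hu => h4 u (by omega) (by omega), h3, Or.inr ⟨t, o', ho', ?_⟩⟩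
      have := h5 (fun u => min u A.ops.length) (A.ops.length + B.ops.length + 1) (by omega)
        (by omega)
      rwa [min_eq_left h1.le] at this
    · obtain ⟨o', ho', rfl⟩ := Option.map_eq_some_iff.1 ho
      obtain ⟨h3, h4, h5⟩ := hF.of_map qubit₂_injective
      exact Or.inr (Or.inl ⟨fun u hu => h4 u (by omega) (by omega), h3,
        Or.inr ⟨t - A.ops.length, o', ho', h5 (fun u => u - A.ops.length)
          (A.ops.length + B.ops.length + 1) (by omega) (by omega)⟩⟩)
    · refine Or.inr (Or.inr ⟨fun u hu => hF.eq_zero_of_lt (by omega), Or.inr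
        ⟨t - A.ops.length - B.ops.length, o, ho, ?_⟩⟩)
      rwa [show A.ops.length + B.ops.length + (t - A.ops.length - B.ops.length) = t by omega]

/-- Every list of atomic faults of a joint circuit consists of faults of its three parts. -/
lemma Circuit.exists_split_noise_join (L : List (Fault ((α₁ ⊕ α₂) ⊕ (β₁ ⊕ β₂ ⊕ γ))))
    (hL : ∀ f ∈ L, f ∈ (A.join B l).noise) :
    ∃ L₁ L₂ L₃ : List (Fault ((α₁ ⊕ α₂) ⊕ (β₁ ⊕ β₂ ⊕ γ))),
      L₁.length + L₂.length + L₃.length = L.length ∧ L₁.sum + L₂.sum + L₃.sum = L.sum ∧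
      (∀ f ∈ L₁, IsFirstFault A B f) ∧ (∀ f ∈ L₂, IsSecondFault A B f) ∧
      ∀ f ∈ L₃, IsLateFault l (A.ops.length + B.ops.length) f := by
  induction L with
  | nil => exact ⟨[], [], [], by simp⟩
  | cons f L ih =>
    obtain ⟨L₁, L₂, L₃, h1, h2, h3, h4, h5⟩ := ih fun f hf => hL f (by simp [hf])
    rcases noise_join A B l (hL f (by simp)) with h | h | h
    · refine ⟨f :: L₁, L₂, L₃, by simp only [List.length_cons]; omega, ?_, ?_, h4, h5⟩
      · rw [List.sum_cons, List.sum_cons, ← h2]; abel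
      · simpa using ⟨h, h3⟩
    · refine ⟨L₁, f :: L₂, L₃, by simp only [List.length_cons]; omega, ?_, h3, ?_, h5⟩
      · rw [List.sum_cons, List.sum_cons, ← h2]; abel
      · simpa using ⟨h, h4⟩
    · refine ⟨L₁, L₂, f :: L₃, by simp only [List.length_cons]; omega, ?_, h3, h4, ?_⟩
      · rw [List.sum_cons, List.sum_cons, ← h2]; abel
      · simpa using ⟨h, h5⟩

/-- The state `|0…0⟩`. -/
def zeroState (Q : Type) [Fintype Q] [DecidableEq Q] : State Q := fun s =>
  if ∀ a, s a = 0 then 1 else 0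

/-- The joint circuit runs the two circuits with their faults, and then the operations `l`. -/
lemma Circuit.branch_join (F G : Fault ((α₁ ⊕ α₂) ⊕ (β₁ ⊕ β₂ ⊕ γ)))
    (hF : ∀ t, A.ops.length + B.ops.length < t → F t = 0) (hFa : ∀ t a, F t (ancilla a) = 0)
    (hG : ∀ t, t < A.ops.length + B.ops.length → G t = 0) (k : κ₁ ⊕ κ₂ ⊕ δ → ZMod 2) :
    PhaseEq ((A.join B l).branch (F + G) k)
      (evolve G k l (A.ops.length + B.ops.length)
        (tens (A.branch (restrict₁ A B F) fun b => k (Sum.inl b))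
          (B.branch (restrict₂ A B F) fun b => k (Sum.inr (Sum.inl b))) (zeroState γ))) := by
  have hi : (A.join B l).init = tens A.init B.init (zeroState γ) := rfl
  have hops : (A.join B l).ops = (A.ops.map (Op.map qubit₁ Sum.inl) ++
      B.ops.map (Op.map qubit₂ fun b => Sum.inr (Sum.inl b))) ++ l := by
    rw [List.append_assoc]; rfl
  rw [branch, hops, hi, evolve_append]
  have hlen : 0 + (A.ops.map (Op.map qubit₁ Sum.inl) ++
      B.ops.map (Op.map qubit₂ fun b => Sum.inr (Sum.inl b)) :
        List (Op ((α₁ ⊕ α₂) ⊕ (β₁ ⊕ β₂ ⊕ γ)) (κ₁ ⊕ κ₂ ⊕ δ))).length =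
      A.ops.length + B.ops.length := by simp
  rw [hlen, run_congr (F' := F) _ _ 0 0]
  · refine PhaseEq.trans ?_ ((evolve_joint (g₂ := fun b => Sum.inr (Sum.inl b)) Sum.inl_injective
      (Sum.inr_injective.comp Sum.inl_injective) F hFa k A.ops B.ops _ _ _).evolve _ _ _ _)
    rw [evolve_eq_run F, hlen]
    refine (evolve_applyPauli _ _ _ _ _ _ _ _ ?_ fun i hi => ?_).symm
    · rw [Pi.add_apply, add_comm]
    · rw [Pi.add_apply, hF _ (by omega), zero_add]
  · intro i hi
    rw [Pi.add_apply, hG (0 + i) (by omega), add_zero]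

/-- A detectable fault of the first circuit is detectable in the joint circuit. -/
lemma Circuit.Detectable.join₁ {F G : Fault ((α₁ ⊕ α₂) ⊕ (β₁ ⊕ β₂ ⊕ γ))}
    (hF : ∀ t, A.ops.length + B.ops.length < t → F t = 0) (hFa : ∀ t a, F t (ancilla a) = 0)
    (hG : ∀ t, t < A.ops.length + B.ops.length → G t = 0)
    (h : A.Detectable (restrict₁ A B F)) : (A.join B l).Detectable (F + G) := by
  obtain ⟨S, b, hS, hd⟩ := h
  have ht : ∀ ψ (χ : State γ), tens (0 : State (α₁ ⊕ β₁)) (ψ : State (α₂ ⊕ β₂)) χ = 0 :=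
    fun ψ χ => by funext s; simp [tens]
  refine ⟨S.map ⟨Sum.inl, Sum.inl_injective⟩, b, fun k hk => ?_, fun k hk => ?_⟩ <;>
    rw [Finset.sum_map]
  · refine hS (fun b => k (Sum.inl b)) fun h0 => hk ?_
    have := branch_join A B l 0 0 (fun _ _ => rfl) (fun _ _ => rfl) (fun _ _ => rfl) k
    rw [add_zero] at this
    refine this.eq_zero ?_
    rw [map_zero (restrict₁ A B), h0, ht, evolve_zero]
  · refine hd (fun b => k (Sum.inl b)) fun h0 => hk ?_
    refine (branch_join A B l F G hF hFa hG k).eq_zero ?_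
    rw [h0, ht, evolve_zero]

/-- A detectable fault of the second circuit is detectable in the joint circuit. -/
lemma Circuit.Detectable.join₂ {F G : Fault ((α₁ ⊕ α₂) ⊕ (β₁ ⊕ β₂ ⊕ γ))}
    (hF : ∀ t, A.ops.length + B.ops.length < t → F t = 0) (hFa : ∀ t a, F t (ancilla a) = 0)
    (hG : ∀ t, t < A.ops.length + B.ops.length → G t = 0)
    (h : B.Detectable (restrict₂ A B F)) : (A.join B l).Detectable (F + G) := by
  obtain ⟨S, b, hS, hd⟩ := h
  have ht : ∀ ψ (χ : State γ), tens (ψ : State (α₁ ⊕ β₁)) (0 : State (α₂ ⊕ β₂)) χ = 0 :=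
    fun ψ χ => by funext s; simp [tens]
  refine ⟨S.map ⟨fun b => Sum.inr (Sum.inl b), Sum.inr_injective.comp Sum.inl_injective⟩, b,
    fun k hk => ?_, fun k hk => ?_⟩ <;> rw [Finset.sum_map]
  · refine hS (fun b => k (Sum.inr (Sum.inl b))) fun h0 => hk ?_
    have := branch_join A B l 0 0 (fun _ _ => rfl) (fun _ _ => rfl) (fun _ _ => rfl) k
    rw [add_zero] at this
    refine this.eq_zero ?_
    rw [map_zero (restrict₂ A B), h0, ht, evolve_zero]
  · refine hd (fun b => k (Sum.inr (Sum.inl b))) fun h0 => hk ?_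
    refine (branch_join A B l F G hF hFa hG k).eq_zero ?_
    rw [h0, ht, evolve_zero]

end JoinNoise

/-! ### Circuits that prepare the cat state -/

section CatBranches

variable {α β κ : Type} [Fintype α] [DecidableEq α] [Fintype β] [DecidableEq β]
  [Fintype κ] [DecidableEq κ]

lemma exists_branch_eq_of_output [Nonempty α] {C : Circuit α β κ} {F : Fault (α ⊕ β)}
    {p : PauliString α} (h : C.output F = catOutput p) :
    ∃ c : (κ → ZMod 2) → State β, (∑ k, ∑ z, ‖c k z‖ ^ 2 = 1) ∧ ∀ k, C.branch F k = fun s =>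
      applyPauli p (catState α) (fun q => s (Sum.inl q)) * c k fun q => s (Sum.inr q) := by
  obtain ⟨c, hc, hn⟩ := exists_scalars_of_sum_eq_pure
    (ι := (κ → ZMod 2) × (β → ZMod 2)) (fun i x => C.branch F i.1 (Sum.elim x i.2))
    (applyPauli p (catState α)) (applyPauli_catState_ne_zero p) (fun x y => by
      rw [Fintype.sum_prod_type]
      exact congrFun (congrFun h x) y)
  refine ⟨fun k z => c (k, z), ?_, fun k => ?_⟩
  · rw [← hn, Fintype.sum_prod_type]
  · funext s
    have := hc (k, fun q => s (Sum.inr q)) fun q => s (Sum.inl q)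
    rw [← this]
    congr 1
    funext q
    cases q <;> rfl

lemma not_detectable_idealCat [Nonempty α] (F : Fault (α ⊕ Empty)) :
    ¬ (idealCat α).Detectable F := by
  rintro ⟨S, b, hS, hF⟩
  have hne : ∀ (G : Fault (α ⊕ Empty)) k, (idealCat α).branch G k ≠ 0 := by
    intro G k h
    rw [idealCat_branch] at h
    refine applyPauli_catState_ne_zero (fun q => G 0 (Sum.inl q)) (funext fun s => ?_)
    exact congrFun h (Sum.elim s 0)
  obtain rfl : S = ∅ := Finset.eq_empty_of_isEmpty S
  have h1 := hS 0 (hne _ _)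
  have h2 := hF 0 (hne _ _)
  rw [← h1] at h2
  simp at h2

lemma PreparesCat.output_zero [Nonempty α] {w : ℕ} (hw : 0 < w) {C : Circuit α β κ}
    (h : PreparesCat w C) : C.output 0 = catOutput 0 := by
  have h0 : (idealCat α).wt 0 = 0 :=
    Nat.le_zero.1 (Circuit.wt_sum_le (C := idealCat α) (l := []) (by simp))
  rcases h.2 0 (zero_mem _) (by omega) with h1 | ⟨G, hG, hle, ho⟩
  · exact absurd h1 (not_detectable_idealCat _)
  · obtain ⟨l, hl, -, rfl⟩ := Circuit.exists_list_of_mem_faults hG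
    obtain rfl : l = [] := List.length_eq_zero_iff.1 (by omega)
    rw [List.sum_nil] at ho
    rw [← ho, idealCat_output]
    rfl

end CatBranches

/-! ### Fusion by parity checks -/

section Checks

variable {n w : ℕ} {β₁ β₂ γ κ₁ κ₂ : Type} [Fintype β₁] [Fintype β₂] [Fintype γ] [DecidableEq β₁]
  [DecidableEq β₂] [DecidableEq γ] [DecidableEq κ₁] [DecidableEq κ₂]

/-- The operations that occur in a fusion; the ancilla `a` is used for the check number `ι a`. -/
inductive FusionOp (h : w ≤ n) (ι : γ → Fin w) :
    Op ((Fin n ⊕ Fin n) ⊕ (β₁ ⊕ β₂ ⊕ γ)) (κ₁ ⊕ κ₂ ⊕ Fin w) → Prop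
  | cnot₁ (a : γ) : FusionOp h ι (Op.cnot false (leg₁ (Fin.castLE h (ι a))) (ancilla a))
  | cnot₂ (a : γ) : FusionOp h ι (Op.cnot false (leg₂ (Fin.castLE h (ι a))) (ancilla a))
  | measAncilla (a : γ) :
      FusionOp h ι (Op.meas Grade.faulty (Pi.single (ancilla a) pauliZ) (checkBit (ι a)))
  | measLegs (j : Fin w) : FusionOp h ι (Op.meas Grade.faultTolerant
      (Pi.single (leg₁ (Fin.castLE h j)) pauliZ + Pi.single (leg₂ (Fin.castLE h j)) pauliZ)
      (checkBit j))
  | correct (i : Fin n) (S : Finset (κ₁ ⊕ κ₂ ⊕ Fin w)) :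
      FusionOp h ι (Op.condPauli false (Pi.single (leg₂ i) pauliX) S)

/-- The qubits involved in the check number `j`. -/
def checkQubits (h : w ≤ n) (ι : γ → Fin w) (j : Fin w) :
    Set ((Fin n ⊕ Fin n) ⊕ (β₁ ⊕ β₂ ⊕ γ)) :=
  {q | q = leg₁ (Fin.castLE h j) ∨ q = leg₂ (Fin.castLE h j) ∨ ∃ a, ι a = j ∧ q = ancilla a}

variable {h : w ≤ n} {ι : γ → Fin w}

omit [Fintype β₁] [Fintype β₂] [Fintype γ] [DecidableEq β₁] [DecidableEq β₂] [DecidableEq γ] in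
lemma eq_of_mem_checkQubits {j j' : Fin w} {q : (Fin n ⊕ Fin n) ⊕ (β₁ ⊕ β₂ ⊕ γ)}
    (hj : q ∈ checkQubits h ι j) (hj' : q ∈ checkQubits h ι j') : j = j' := by
  rcases hj with rfl | rfl | ⟨a, rfl, rfl⟩ <;> rcases hj' with h' | h' | ⟨a', rfl, h'⟩ <;>
    simp [leg₁, leg₂, ancilla, Fin.ext_iff] at h'
  · exact Fin.ext h'
  · exact Fin.ext h'
  · rw [h']

omit [Fintype β₁] [Fintype β₂] [Fintype γ] [DecidableEq κ₁] [DecidableEq κ₂] in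
lemma FusionOp.isClifford {o : Op ((Fin n ⊕ Fin n) ⊕ (β₁ ⊕ β₂ ⊕ γ)) (κ₁ ⊕ κ₂ ⊕ Fin w)}
    (ho : FusionOp h ι o) : o.IsClifford := by
  cases ho <;> simp [Op.IsClifford, leg₁, leg₂, ancilla]

omit [Fintype β₁] [Fintype β₂] [Fintype γ] [DecidableEq κ₁] [DecidableEq κ₂] in
lemma FusionOp.not_target {q : Fin n ⊕ Fin n} {i : Bool}
    {c : (Fin n ⊕ Fin n) ⊕ (β₁ ⊕ β₂ ⊕ γ)} :
    ¬ FusionOp h ι (Op.cnot i c (Sum.inl q) : Op _ (κ₁ ⊕ κ₂ ⊕ Fin w)) := by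
  generalize ho : (Op.cnot i c (Sum.inl q) :
    Op ((Fin n ⊕ Fin n) ⊕ (β₁ ⊕ β₂ ⊕ γ)) (κ₁ ⊕ κ₂ ⊕ Fin w)) = o
  intro h
  cases h <;> simp [ancilla] at ho

omit [Fintype β₁] [Fintype β₂] [Fintype γ] [DecidableEq κ₁] [DecidableEq κ₂] in
lemma FusionOp.confined {o : Op ((Fin n ⊕ Fin n) ⊕ (β₁ ⊕ β₂ ⊕ γ)) (κ₁ ⊕ κ₂ ⊕ Fin w)}
    (ho : FusionOp h ι o) (j : Fin w) : o.Confined (checkQubits h ι j) (checkBit j) := by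
  have h1 : ∀ j', (leg₁ (Fin.castLE h j') : (Fin n ⊕ Fin n) ⊕ (β₁ ⊕ β₂ ⊕ γ)) ∈
    checkQubits h ι j' := fun j' => Or.inl rfl
  have h2 : ∀ j', (leg₂ (Fin.castLE h j') : (Fin n ⊕ Fin n) ⊕ (β₁ ⊕ β₂ ⊕ γ)) ∈
    checkQubits h ι j' := fun j' => Or.inr (Or.inl rfl)
  have h3 : ∀ a : γ, (ancilla a : (Fin n ⊕ Fin n) ⊕ (β₁ ⊕ β₂ ⊕ γ)) ∈
    checkQubits h ι (ι a) := fun a => Or.inr (Or.inr ⟨a, rfl, rfl⟩)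
  cases ho with
  | cnot₁ a =>
    refine ⟨fun hc => ?_, fun hc => ?_⟩
    · rw [eq_of_mem_checkQubits hc (h1 _)]; exact h3 a
    · rw [eq_of_mem_checkQubits hc (h3 _)]; exact h1 _
  | cnot₂ a =>
    refine ⟨fun hc => ?_, fun hc => ?_⟩
    · rw [eq_of_mem_checkQubits hc (h2 _)]; exact h3 a
    · rw [eq_of_mem_checkQubits hc (h3 _)]; exact h2 _
  | measAncilla a =>
    intro hj q hq
    obtain rfl : ι a = j := by simpa [checkBit] using hj
    by_cases hqa : q = ancilla a
    · subst hqa; exact h3 a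
    · exact absurd (Pi.single_eq_of_ne hqa _) hq
  | measLegs j' =>
    intro hj q hq
    obtain rfl : j' = j := by simpa [checkBit] using hj
    by_cases hq1 : q = leg₁ (Fin.castLE h j')
    · subst hq1; exact h1 _
    · by_cases hq2 : q = leg₂ (Fin.castLE h j')
      · subst hq2; exact h2 _
      · rw [Pi.add_apply, Pi.single_eq_of_ne hq1, Pi.single_eq_of_ne hq2] at hq
        exact absurd rfl hq
  | correct => trivial

/-- The `X` part on the qubit `q` of the product of all Pauli strings of a fault from time step `T`
to time step `T + N`. -/
def totalX {Q : Type} (T N : ℕ) (q : Q) : Fault Q →+ ZMod 2 where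
  toFun F := ∑ i ∈ Finset.range (N + 1), (F (T + i) q).1
  map_zero' := by simp
  map_add' F G := by simp [Finset.sum_add_distrib]

lemma totalX_apply {Q : Type} (T N : ℕ) (q : Q) (F : Fault Q) :
    totalX T N q F = ∑ i ∈ Finset.range (N + 1), (F (T + i) q).1 := rfl

lemma totalX_single {Q : Type} {T N i : ℕ} (hi : i ≤ N) (q : Q) (r : PauliString Q) :
    totalX T N q (Pi.single (T + i) r) = (r q).1 := by
  rw [totalX_apply, Finset.sum_eq_single i]
  · simp
  · intro j _ hj
    rw [Pi.single_eq_of_ne (by omega)]; rfl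
  · intro hi'; exact absurd (Finset.mem_range.2 (by omega)) hi'

lemma totalX_single_eq_zero {Q : Type} {T N t : ℕ} {q : Q} {r : PauliString Q} (hr : (r q).1 = 0) :
    totalX T N q (Pi.single t r) = 0 := by
  rw [totalX_apply]
  refine Finset.sum_eq_zero fun i _ => ?_
  rw [Pi.single_apply]
  split_ifs
  · exact hr
  · rfl

/-- The fault can affect the outcome of at most one check, and its `X` part at most one leg. -/
structure IsSmall (h : w ≤ n) (ι : γ → Fin w) (T N : ℕ)
    (F : Fault ((Fin n ⊕ Fin n) ⊕ (β₁ ⊕ β₂ ⊕ γ))) : Prop where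
  check : ∀ j j', (∃ t, ∃ q ∈ checkQubits h ι j, F t q ≠ 0) →
    (∃ t, ∃ q ∈ checkQubits h ι j', F t q ≠ 0) → j = j'
  leg : ∀ q q' : Fin n ⊕ Fin n, totalX T N (Sum.inl q) F ≠ 0 → totalX T N (Sum.inl q') F ≠ 0 →
    q = q'

omit [Fintype β₁] [Fintype β₂] [Fintype γ] [DecidableEq β₁] [DecidableEq β₂] [DecidableEq γ] in
lemma isSmall_single (T N t : ℕ) (r : PauliString ((Fin n ⊕ Fin n) ⊕ (β₁ ⊕ β₂ ⊕ γ)))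
    (hc : ∀ j j', ∀ q ∈ checkQubits h ι j, ∀ q' ∈ checkQubits h ι j', r q ≠ 0 → r q' ≠ 0 → j = j')
    (hl : ∀ q q' : Fin n ⊕ Fin n, r (Sum.inl q) ≠ 0 → r (Sum.inl q') ≠ 0 → q = q') :
    IsSmall h ι T N (Pi.single t r) := by
  constructor
  · rintro j j' ⟨u, q, hq, hu⟩ ⟨u', q', hq', hu'⟩
    refine hc j j' q hq q' hq' ?_ ?_
    · intro h0
      rw [Pi.single_apply] at hu
      split_ifs at hu
      exacts [hu h0, hu rfl]
    · intro h0
      rw [Pi.single_apply] at hu'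
      split_ifs at hu'
      exacts [hu' h0, hu' rfl]
  · intro q q' hq hq'
    refine hl q q' (fun h0 => hq ?_) fun h0 => hq' ?_
    · exact totalX_single_eq_zero (by rw [h0]; rfl)
    · exact totalX_single_eq_zero (by rw [h0]; rfl)

omit [Fintype β₁] [Fintype β₂] [Fintype γ] in
lemma isSmall_wire (T N t : ℕ) (q : (Fin n ⊕ Fin n) ⊕ (β₁ ⊕ β₂ ⊕ γ)) (p : Pauli) :
    IsSmall h ι T N (Pi.single t (Pi.single q p)) := by
  have h1 : ∀ q', (Pi.single q p : PauliString ((Fin n ⊕ Fin n) ⊕ (β₁ ⊕ β₂ ⊕ γ))) q' ≠ 0 →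
      q' = q := fun q' hq' => by
    by_contra hne
    exact hq' (Pi.single_eq_of_ne hne _)
  refine isSmall_single T N t _ (fun j j' q₁ hq₁ q₂ hq₂ hr₁ hr₂ => ?_) fun q₁ q₂ hr₁ hr₂ => ?_
  · rw [h1 _ hr₁] at hq₁
    rw [h1 _ hr₂] at hq₂
    exact eq_of_mem_checkQubits hq₁ hq₂
  · exact Sum.inl_injective ((h1 _ hr₁).trans (h1 _ hr₂).symm)

omit [DecidableEq κ₁] [DecidableEq κ₂] in
/-- Every atomic fault of an operation of a fusion is small. -/
lemma FusionOp.isSmall {o : Op ((Fin n ⊕ Fin n) ⊕ (β₁ ⊕ β₂ ⊕ γ)) (κ₁ ⊕ κ₂ ⊕ Fin w)}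
    (ho : FusionOp h ι o) {T N i : ℕ} (hi : i < N)
    {F : Fault ((Fin n ⊕ Fin n) ⊕ (β₁ ⊕ β₂ ⊕ γ))} (hF : o.AtomicFault (T + i) F) :
    IsSmall h ι T N F := by
  have hsub : ∀ {r : PauliString ((Fin n ⊕ Fin n) ⊕ (β₁ ⊕ β₂ ⊕ γ))} {S}, supp r ⊆ S →
      ∀ q, r q ≠ 0 → q ∈ S := fun hr q hq => hr (mem_supp.2 hq)
  have h1 : ∀ j', (leg₁ (Fin.castLE h j') : (Fin n ⊕ Fin n) ⊕ (β₁ ⊕ β₂ ⊕ γ)) ∈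
    checkQubits h ι j' := fun j' => Or.inl rfl
  have h2 : ∀ j', (leg₂ (Fin.castLE h j') : (Fin n ⊕ Fin n) ⊕ (β₁ ⊕ β₂ ⊕ γ)) ∈
    checkQubits h ι j' := fun j' => Or.inr (Or.inl rfl)
  have h3 : ∀ a : γ, (ancilla a : (Fin n ⊕ Fin n) ⊕ (β₁ ⊕ β₂ ⊕ γ)) ∈
    checkQubits h ι (ι a) := fun a => Or.inr (Or.inr ⟨a, rfl, rfl⟩)
  have hpair : ∀ (j₀ : Fin w) (q₀ : Fin n ⊕ Fin n) (a : γ) (t : ℕ)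
      (r : PauliString ((Fin n ⊕ Fin n) ⊕ (β₁ ⊕ β₂ ⊕ γ))),
      Sum.inl q₀ ∈ checkQubits (β₁ := β₁) (β₂ := β₂) h ι j₀ → ι a = j₀ →
      supp r ⊆ {Sum.inl q₀, ancilla a} → IsSmall h ι T N (Pi.single t r) := by
    intro j₀ q₀ a t r hq₀ ha hr
    have hm : ∀ q, r q ≠ 0 → q ∈ checkQubits h ι j₀ := by
      intro q hq
      have := hsub hr q hq
      rw [Finset.mem_insert, Finset.mem_singleton] at this
      rcases this with rfl | rfl
      · exact hq₀
      · rw [← ha]; exact h3 a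
    have hl : ∀ q : Fin n ⊕ Fin n, r (Sum.inl q) ≠ 0 → q = q₀ := by
      intro q hq
      have := hsub hr _ hq
      rw [Finset.mem_insert, Finset.mem_singleton] at this
      rcases this with h' | h'
      · exact Sum.inl_injective h'
      · simp [ancilla] at h'
    refine isSmall_single T N t r (fun j j' q hq q' hq' hr hr' => ?_) fun q q' hq hq' => ?_
    · rw [eq_of_mem_checkQubits hq (hm _ hr), eq_of_mem_checkQubits hq' (hm _ hr')]
    · rw [hl q hq, hl q' hq']
  have hone : ∀ (q₀ : (Fin n ⊕ Fin n) ⊕ (β₁ ⊕ β₂ ⊕ γ)) (p : Pauli) (t : ℕ)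
      (r : PauliString ((Fin n ⊕ Fin n) ⊕ (β₁ ⊕ β₂ ⊕ γ))),
      supp r ⊆ supp (Pi.single q₀ p) → IsSmall h ι T N (Pi.single t r) := by
    intro q₀ p t r hr
    have : r = Pi.single q₀ (r q₀) := by
      funext q
      by_cases hq : q = q₀
      · subst hq; simp
      · rw [Pi.single_eq_of_ne hq]
        by_contra hne
        exact mem_supp.1 (hr (mem_supp.2 hne)) (Pi.single_eq_of_ne hq _)
    rw [this]
    exact isSmall_wire T N t q₀ _
  cases ho with
  | cnot₁ a => cases hF with
    | gateFault _ r _ hr => exact hpair (ι a) _ a _ r (h1 _) rfl hr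
  | cnot₂ a => cases hF with
    | gateFault _ r _ hr => exact hpair (ι a) _ a _ r (h2 _) rfl hr
  | correct i' S => cases hF with
    | gateFault _ r _ hr => exact hone _ _ _ r hr
  | measAncilla a =>
    cases hF with
    | gateFault _ r _ hr => exact hone _ _ _ r hr
    | flip _ _ b r hb _ hr =>
      have hm : ∀ q, b q ≠ 0 ∨ r q ≠ 0 → q = ancilla a := by
        intro q hq
        have : q ∈ supp (Pi.single (ancilla a) pauliZ :
            PauliString ((Fin n ⊕ Fin n) ⊕ (β₁ ⊕ β₂ ⊕ γ))) :=
          hq.elim (fun hq => hsub hb q hq) fun hq => hsub hr q hq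
        by_contra hne
        exact mem_supp.1 this (Pi.single_eq_of_ne hne _)
      have hz : ∀ t q, q ≠ ancilla a →
          (Pi.single (T + i) b + Pi.single (T + i + 1) (b + r) : Fault _) t q = 0 := by
        intro t q hq
        have hb0 : b q = 0 := by by_contra hne; exact hq (hm q (Or.inl hne))
        have hr0 : r q = 0 := by by_contra hne; exact hq (hm q (Or.inr hne))
        simp only [Pi.add_apply, Pi.single_apply]
        split_ifs <;> simp [hb0, hr0]
      have hzl : ∀ q : Fin n ⊕ Fin n, totalX T N (Sum.inl q)
          (Pi.single (T + i) b + Pi.single (T + i + 1) (b + r) :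
            Fault ((Fin n ⊕ Fin n) ⊕ (β₁ ⊕ β₂ ⊕ γ))) = 0 := by
        intro q
        rw [totalX_apply]
        refine Finset.sum_eq_zero fun u _ => ?_
        rw [hz _ _ (by simp [ancilla])]
        rfl
      constructor
      · rintro j j' ⟨u, q, hq, hu⟩ ⟨u', q', hq', hu'⟩
        have e1 : q = ancilla a := by by_contra hne; exact hu (hz _ _ hne)
        have e2 : q' = ancilla a := by by_contra hne; exact hu' (hz _ _ hne)
        rw [e1] at hq
        rw [e2] at hq'
        exact eq_of_mem_checkQubits hq hq'
      · intro q q' hq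
        exact absurd (hzl q) hq
  | measLegs j₀ =>
    cases hF with
    | gateFault _ r ho => cases ho
    | flipFT _ _ b r hb _ hr hr1 =>
      have hm : ∀ q, b q ≠ 0 ∨ r q ≠ 0 → q ∈ checkQubits h ι j₀ := by
        intro q hq
        have : q ∈ supp (Pi.single (leg₁ (Fin.castLE h j₀)) pauliZ +
            Pi.single (leg₂ (Fin.castLE h j₀)) pauliZ :
            PauliString ((Fin n ⊕ Fin n) ⊕ (β₁ ⊕ β₂ ⊕ γ))) :=
          hq.elim (fun hq => hsub hb q hq) fun hq => hsub hr q hq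
        exact (FusionOp.measLegs (β₁ := β₁) (β₂ := β₂) (γ := γ) (κ₁ := κ₁) (κ₂ := κ₂) (h := h)
          (ι := ι) j₀).confined j₀ rfl q (mem_supp.1 this)
      have hz : ∀ t q, q ∉ checkQubits h ι j₀ →
          (Pi.single (T + i) b + Pi.single (T + i + 1) (b + r) : Fault _) t q = 0 := by
        intro t q hq
        have hb0 : b q = 0 := by by_contra hne; exact hq (hm q (Or.inl hne))
        have hr0 : r q = 0 := by by_contra hne; exact hq (hm q (Or.inr hne))
        simp only [Pi.add_apply, Pi.single_apply]
        split_ifs <;> simp [hb0, hr0]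
      have hl : ∀ q : Fin n ⊕ Fin n, totalX T N (Sum.inl q)
          (Pi.single (T + i) b + Pi.single (T + i + 1) (b + r) :
            Fault ((Fin n ⊕ Fin n) ⊕ (β₁ ⊕ β₂ ⊕ γ))) = (r (Sum.inl q)).1 := by
        intro q
        rw [map_add, totalX_single hi.le, add_assoc, totalX_single hi, Pi.add_apply, Prod.fst_add,
          ← add_assoc, show (b (Sum.inl q)).1 + (b (Sum.inl q)).1 = 0 from
            zmod2_add_eq_zero.2 rfl, zero_add]
      constructor
      · rintro j j' ⟨u, q, hq, hu⟩ ⟨u', q', hq', hu'⟩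
        have e1 : q ∈ checkQubits h ι j₀ := by by_contra hne; exact hu (hz _ _ hne)
        have e2 : q' ∈ checkQubits h ι j₀ := by by_contra hne; exact hu' (hz _ _ hne)
        rw [eq_of_mem_checkQubits hq e1, eq_of_mem_checkQubits hq' e2]
      · intro q q' hq hq'
        rw [hl] at hq hq'
        have e1 : Sum.inl q ∈ supp r := mem_supp.2 fun h0 => hq (by rw [h0]; rfl)
        have e2 : Sum.inl q' ∈ supp r := mem_supp.2 fun h0 => hq' (by rw [h0]; rfl)
        exact Sum.inl_injective (Finset.card_le_one.1 hr1 _ e1 _ e2)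

/-- The parities of the corresponding legs of the two blocks are the recorded outcomes. -/
def ParitiesAgree (h : w ≤ n) (k : κ₁ ⊕ κ₂ ⊕ Fin w → ZMod 2)
    (s : (Fin n ⊕ Fin n) ⊕ (β₁ ⊕ β₂ ⊕ γ) → ZMod 2) : Prop :=
  ∀ j : Fin w, s (leg₁ (Fin.castLE h j)) + s (leg₂ (Fin.castLE h j)) = k (checkBit j)

instance (h : w ≤ n) (k : κ₁ ⊕ κ₂ ⊕ Fin w → ZMod 2)
    (s : (Fin n ⊕ Fin n) ⊕ (β₁ ⊕ β₂ ⊕ γ) → ZMod 2) : Decidable (ParitiesAgree h k s) :=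
  inferInstanceAs (Decidable (∀ _, _))

/-- The state of the ancillas that have stored the outcomes `k`. -/
def recordState (ι : γ → Fin w) (k : κ₁ ⊕ κ₂ ⊕ Fin w → ZMod 2) : State γ := fun u =>
  if ∀ a, u a = k (checkBit (ι a)) then 1 else 0

/-- The operations measure the parity of the legs number `j` of the two blocks for all `j < w`. -/
structure IsCheckList (h : w ≤ n) (ι : γ → Fin w)
    (l : List (Op ((Fin n ⊕ Fin n) ⊕ (β₁ ⊕ β₂ ⊕ γ)) (κ₁ ⊕ κ₂ ⊕ Fin w))) : Prop where
  op : ∀ o ∈ l, FusionOp h ι o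
  reads : ∀ o ∈ l, o.reads = ∅
  writes : l.filterMap Op.writes = (List.finRange w).map checkBit
  run_tens : ∀ k t ψ₁ ψ₂ s, run 0 k l t (tens ψ₁ ψ₂ (zeroState γ)) s =
    if ParitiesAgree h k s then tens ψ₁ ψ₂ (recordState ι k) s else 0

end Checks

section FrameLemmas

variable {Q κ : Type} [DecidableEq Q]

lemma Op.push_zero (o : Op Q κ) : o.push 0 = 0 := by
  cases o with
  | cnot i c t => funext q; simp [push]
  | _ => rfl

lemma frame_eq_zero (F : Fault Q) (l : List (Op Q κ)) (t : ℕ)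
    (h : ∀ i < l.length, F (t + i) = 0) : frame F l t 0 = 0 := by
  induction l generalizing t with
  | nil => rfl
  | cons o l ih =>
    rw [frame, show F t = 0 from h 0 (by simp), add_zero, Op.push_zero]
    refine ih _ fun i hi => ?_
    rw [show t + 1 + i = t + (i + 1) by omega]
    exact h _ (by simpa using hi)

variable [Fintype Q] [DecidableEq κ]

omit [DecidableEq Q] in
lemma Op.flip_zero (o : Op Q κ) : o.flip 0 = 0 := by
  cases o with
  | meas g p b => simp [flip]
  | _ => rfl

lemma flips_eq_zero (F : Fault Q) (l : List (Op Q κ)) (t : ℕ)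
    (h : ∀ i < l.length, F (t + i) = 0) : flips F l t 0 = 0 := by
  induction l generalizing t with
  | nil => rfl
  | cons o l ih =>
    rw [flips, show F t = 0 from h 0 (by simp), add_zero, Op.push_zero, Op.flip_zero, zero_add]
    refine ih _ fun i hi => ?_
    rw [show t + 1 + i = t + (i + 1) by omega]
    exact h _ (by simpa using hi)

lemma flips_append (F : Fault Q) (l l' : List (Op Q κ)) (t : ℕ) (P : PauliString Q) :
    flips F (l ++ l') t P = flips F l t P + flips F l' (t + l.length) (frame F l t P) := by
  induction l generalizing t P with
  | nil => simp [flips, frame]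
  | cons o l ih =>
    rw [List.cons_append, flips, ih, flips, frame, List.length_cons]
    simp only [add_assoc, add_comm 1]

end FrameLemmas

section Corrections

variable {n w : ℕ} {β₁ β₂ γ κ₁ κ₂ : Type} [Fintype β₁] [Fintype β₂] [Fintype γ] [DecidableEq β₁]
  [DecidableEq β₂] [DecidableEq γ] [DecidableEq κ₁] [DecidableEq κ₂]

omit [DecidableEq κ₁] [DecidableEq κ₂] in
lemma run_map_condPauli (js : List (Fin n)) (S : Finset (κ₁ ⊕ κ₂ ⊕ Fin w))
    (k : κ₁ ⊕ κ₂ ⊕ Fin w → ZMod 2) (t : ℕ) (ψ : State ((Fin n ⊕ Fin n) ⊕ (β₁ ⊕ β₂ ⊕ γ))) :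
    run 0 k (js.map fun i => Op.condPauli false (Pi.single (leg₂ i) pauliX) S) t ψ = fun s =>
      ψ fun q => s q + (∑ b ∈ S, k b) * (js.map fun i => if q = leg₂ i then 1 else 0).sum := by
  induction js generalizing t ψ with
  | nil => simp [run]
  | cons i js ih =>
    rw [List.map_cons, run, ih]
    have h : Op.apply k (Op.condPauli false (Pi.single (leg₂ i) pauliX) S)
        (applyPauli ((0 : Fault _) t) ψ) =
        fun s => ψ fun q => s q + (∑ b ∈ S, k b) * if q = leg₂ i then 1 else 0 := by
      have hX : ∀ q, ((Pi.single (leg₂ i) pauliX :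
          PauliString ((Fin n ⊕ Fin n) ⊕ (β₁ ⊕ β₂ ⊕ γ))) q) =
          (if q = leg₂ i then 1 else 0, 0) := fun q => by
        rw [Pi.single_apply]; split_ifs <;> rfl
      funext s
      rw [Pi.zero_apply, applyPauli_zero, Op.apply]
      rcases zmod2_cases (∑ b ∈ S, k b) with h0 | h1
      · simp [h0]
      · rw [if_pos h1, h1, applyPauli_of_snd_eq_zero fun q => by rw [hX]]
        simp only [hX, one_mul]
    funext s
    rw [h]
    simp only [List.map_cons, List.sum_cons, mul_add]
    congr 1
    funext q
    rw [add_assoc, add_comm (_ * List.sum _)]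

/-- The bit flip of all legs of the second block. -/
def legShift (β₁ β₂ γ : Type) (n : ℕ) (m : ZMod 2) : (Fin n ⊕ Fin n) ⊕ (β₁ ⊕ β₂ ⊕ γ) → ZMod 2 :=
  Sum.elim (Sum.elim (fun _ => 0) fun _ => m) fun _ => 0

lemma run_corrections (hw : 0 < w) (k : κ₁ ⊕ κ₂ ⊕ Fin w → ZMod 2) (t : ℕ)
    (ψ : State ((Fin n ⊕ Fin n) ⊕ (β₁ ⊕ β₂ ⊕ γ))) :
    run 0 k (corrections n w) t ψ = fun s =>
      ψ fun q => s q + legShift β₁ β₂ γ n (k (checkBit ⟨0, hw⟩)) q := by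
  rw [corrections, run_map_condPauli]
  have h1 : (Finset.univ.filter fun j : Fin w => j.val = 0) = {⟨0, hw⟩} := by
    ext j; simp [Fin.ext_iff]
  rw [h1, Finset.image_singleton, Finset.sum_singleton]
  funext s
  congr 1
  funext q
  rw [← Fin.sum_univ_def]
  rcases q with (q | q) | q <;> simp [leg₂, legShift]

end Corrections

section CatFusion

lemma catState_eq_ite {α : Type} [Fintype α] [DecidableEq α] [Nonempty α] (s : α → ZMod 2) :
    catState α s = if ∃ a, ∀ q, s q = a then 1 / (Real.sqrt 2 : ℂ) else 0 := by
  have h01 : (0 : α → ZMod 2) ≠ 1 := fun h =>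
    zero_ne_one (α := ZMod 2) (congrFun h (Classical.arbitrary α))
  by_cases h0 : s = 0
  · subst h0
    rw [if_pos ⟨0, fun _ => rfl⟩]
    simp [catState, h01]
  · by_cases h1 : s = 1
    · subst h1
      rw [if_pos ⟨1, fun _ => rfl⟩]
      simp [catState, h01.symm]
    · rw [catState_eq_zero h0 h1, if_neg]
      rintro ⟨a, ha⟩
      rcases zmod2_cases a with rfl | rfl
      exacts [h0 (funext ha), h1 (funext ha)]

/-- The amplitudes of two cat states whose parities have been checked and corrected are those of a
joint cat state. -/
lemma catState_mul_catState {n w : ℕ} (h : w ≤ n) (hw : 0 < w) (x : Fin n ⊕ Fin n → ZMod 2)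
    (k : Fin w → ZMod 2) :
    (if ∀ j, x (Sum.inl (Fin.castLE h j)) + (x (Sum.inr (Fin.castLE h j)) + k ⟨0, hw⟩) = k j then
      catState (Fin n) (fun i => x (Sum.inl i)) *
        catState (Fin n) (fun i => x (Sum.inr i) + k ⟨0, hw⟩) else 0) =
      catState (Fin n ⊕ Fin n) x *
        if ∀ j, k j = k ⟨0, hw⟩ then 1 / (Real.sqrt 2 : ℂ) else 0 := by
  have : Nonempty (Fin n) := ⟨Fin.castLE h ⟨0, hw⟩⟩
  have hz : ∀ a : ZMod 2, a + a = 0 := fun a => zmod2_add_eq_zero.2 rfl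
  have key : ((∀ j, x (Sum.inl (Fin.castLE h j)) + (x (Sum.inr (Fin.castLE h j)) + k ⟨0, hw⟩) =
      k j) ∧ (∃ a, ∀ i, x (Sum.inl i) = a) ∧ ∃ a, ∀ i, x (Sum.inr i) + k ⟨0, hw⟩ = a) ↔
      (∃ a, ∀ q, x q = a) ∧ ∀ j, k j = k ⟨0, hw⟩ := by
    constructor
    · rintro ⟨hj, ⟨a, ha⟩, b, hb⟩
      simp only [ha, hb] at hj
      refine ⟨⟨a, ?_⟩, fun j => (hj j).symm.trans (hj _)⟩
      rintro (i | i)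
      · exact ha i
      · have h1 := hb i
        have h2 := hj ⟨0, hw⟩
        linear_combination h1 + h2 - hz a
    · rintro ⟨⟨a, ha⟩, hk⟩
      refine ⟨fun j => ?_, ⟨a, fun i => ha _⟩, a + k ⟨0, hw⟩, fun i => by rw [ha]⟩
      rw [ha, ha, hk j]
      linear_combination hz a
  simp only [catState_eq_ite, mul_ite, ite_mul, mul_zero, zero_mul, ← ite_and]
  refine if_congr ?_ rfl rfl
  rw [and_comm (a := ∃ a, ∀ q, x q = a)] at key
  constructor
  · rintro h'
    have := key.1 (by tauto)
    tauto
  · rintro h'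
    have := key.2 (by tauto)
    tauto

variable {n w : ℕ} {β₁ β₂ γ κ₁ κ₂ : Type}

/-- The state of the discarded qubits after the fusion. -/
def fusionRest (hw : 0 < w) (ι : γ → Fin w) (c₁ : (κ₁ → ZMod 2) → State β₁)
    (c₂ : (κ₂ → ZMod 2) → State β₂) [Fintype γ] (k : κ₁ ⊕ κ₂ ⊕ Fin w → ZMod 2) :
    State (β₁ ⊕ β₂ ⊕ γ) := fun u =>
  (if ∀ j, k (checkBit j) = k (checkBit ⟨0, hw⟩) then 1 / (Real.sqrt 2 : ℂ) else 0) *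
    (c₁ (fun b => k (Sum.inl b)) (fun q => u (Sum.inl q)) *
      c₂ (fun b => k (Sum.inr (Sum.inl b))) (fun q => u (Sum.inr (Sum.inl q))) *
      recordState ι k fun a => u (Sum.inr (Sum.inr a)))

/-- A cat state together with a state of the discarded qubits. -/
def catTens {α β : Type} [Fintype α] [DecidableEq α] (φ : State β) : State (α ⊕ β) := fun s =>
  catState α (fun q => s (Sum.inl q)) * φ fun q => s (Sum.inr q)

variable [Fintype β₁] [Fintype β₂] [Fintype γ] [DecidableEq β₁] [DecidableEq β₂] [DecidableEq γ]
  [DecidableEq κ₁] [DecidableEq κ₂]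

lemma IsCheckList.run_fusion {h : w ≤ n} (hw : 0 < w) {ι : γ → Fin w}
    {l : List (Op ((Fin n ⊕ Fin n) ⊕ (β₁ ⊕ β₂ ⊕ γ)) (κ₁ ⊕ κ₂ ⊕ Fin w))} (hl : IsCheckList h ι l)
    (k : κ₁ ⊕ κ₂ ⊕ Fin w → ZMod 2) (t : ℕ) (c₁ : (κ₁ → ZMod 2) → State β₁)
    (c₂ : (κ₂ → ZMod 2) → State β₂) :
    run 0 k (l ++ corrections n w) t
      (tens (catTens (c₁ fun b => k (Sum.inl b))) (catTens (c₂ fun b => k (Sum.inr (Sum.inl b))))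
        (zeroState γ)) = catTens (fusionRest hw ι c₁ c₂ k) := by
  rw [run_append, run_corrections hw]
  funext s
  rw [hl.run_tens]
  have := catState_mul_catState h hw (fun q => s (Sum.inl q)) fun j => k (checkBit j)
  rw [catTens, fusionRest, ← mul_assoc, ← this, ite_mul, zero_mul]
  refine if_congr ?_ ?_ rfl
  · simp only [ParitiesAgree, leg₁, leg₂, legShift, Sum.elim_inl, Sum.elim_inr, add_zero]
  · simp only [tens, catTens, qubit₁, qubit₂, ancilla, legShift, Sum.map_inl, Sum.map_inr,
      Sum.elim_inl, Sum.elim_inr, add_zero]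
    ring

omit [DecidableEq κ₁] [DecidableEq κ₂] in
lemma IsCheckList.outcomes_eq {h : w ≤ n} {ι : γ → Fin w}
    {l : List (Op ((Fin n ⊕ Fin n) ⊕ (β₁ ⊕ β₂ ⊕ γ)) (κ₁ ⊕ κ₂ ⊕ Fin w))} (hl : IsCheckList h ι l)
    {k : κ₁ ⊕ κ₂ ⊕ Fin w → ZMod 2} {t : ℕ} {φ₁ : State β₁} {φ₂ : State β₂}
    (hk : run 0 k l t (tens (catTens φ₁) (catTens φ₂) (zeroState γ)) ≠ 0) (j j' : Fin w) :
    k (checkBit j) = k (checkBit j') := by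
  have : Nonempty (Fin n) := ⟨Fin.castLE h j⟩
  obtain ⟨s, hs⟩ := Function.ne_iff.1 hk
  rw [hl.run_tens] at hs
  split_ifs at hs with hp
  · have h1 : ∃ a, ∀ q, s (Sum.inl (Sum.inl q)) = a := by
      by_contra hne
      refine hs ?_
      simp only [tens, catTens, catState_eq_ite, qubit₁, Sum.map_inl]
      rw [if_neg hne]
      simp
    have h2 : ∃ a, ∀ q, s (Sum.inl (Sum.inr q)) = a := by
      by_contra hne
      refine hs ?_
      simp only [tens, catTens, catState_eq_ite, qubit₂, Sum.map_inl]
      rw [if_neg hne]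
      simp
    obtain ⟨a, ha⟩ := h1
    obtain ⟨b, hb⟩ := h2
    rw [← hp j, ← hp j']
    simp only [leg₁, leg₂, ha, hb]
  · exact absurd rfl hs

lemma sum_arrow_sum {A B M : Type*} [Fintype A] [Fintype B] [DecidableEq A] [DecidableEq B]
    [AddCommMonoid M] (g : (A ⊕ B → ZMod 2) → M) : ∑ f, g f = ∑ a, ∑ b, g (Sum.elim a b) := by
  rw [← Fintype.sum_prod_type']
  refine Fintype.sum_equiv (Equiv.sumArrowEquivProdArrow A B (ZMod 2)) _ _ fun f => ?_
  congr 1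
  funext q
  cases q <;> rfl

lemma sum_const_half (hw : 0 < w) :
    ∑ k : Fin w → ZMod 2, (if ∀ j, k j = k ⟨0, hw⟩ then (1 / 2 : ℝ) else 0) = 1 := by
  have h01 : (fun _ : Fin w => (0 : ZMod 2)) ≠ fun _ => 1 := fun h =>
    zero_ne_one (α := ZMod 2) (congrFun h ⟨0, hw⟩)
  have h : ∀ k : Fin w → ZMod 2, (if ∀ j, k j = k ⟨0, hw⟩ then (1 / 2 : ℝ) else 0) =
      (if k = (fun _ => 0) then 1 / 2 else 0) + if k = (fun _ => 1) then 1 / 2 else 0 := by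
    intro k
    by_cases h0 : k = fun _ => 0
    · subst h0; simp [h01]
    · by_cases h1 : k = fun _ => 1
      · subst h1; simp [h01.symm]
      · rw [if_neg, if_neg h0, if_neg h1, add_zero]
        intro hk
        rcases zmod2_cases (k ⟨0, hw⟩) with h' | h' <;> rw [h'] at hk
        exacts [h0 (funext hk), h1 (funext hk)]
  simp only [h, Finset.sum_add_distrib, Finset.sum_ite_eq', Finset.mem_univ, if_true]
  norm_num

lemma sum_norm_fusionRest [Fintype κ₁] [Fintype κ₂] (hw : 0 < w) (ι : γ → Fin w)
    {c₁ : (κ₁ → ZMod 2) → State β₁} {c₂ : (κ₂ → ZMod 2) → State β₂}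
    (h₁ : ∑ k, ∑ z, ‖c₁ k z‖ ^ 2 = 1) (h₂ : ∑ k, ∑ z, ‖c₂ k z‖ ^ 2 = 1) :
    ∑ k : κ₁ ⊕ κ₂ ⊕ Fin w → ZMod 2, ∑ z, ‖fusionRest hw ι c₁ c₂ k z‖ ^ 2 = 1 := by
  have hs : ‖((Real.sqrt 2 : ℝ) : ℂ)‖ ^ 2 = 2 := by
    rw [Complex.norm_real, Real.norm_eq_abs, sq_abs, Real.sq_sqrt (by norm_num)]
  have h : ∀ (k₁ : κ₁ → ZMod 2) (k₂ : κ₂ → ZMod 2) (k₃ : Fin w → ZMod 2) (z₁ : β₁ → ZMod 2)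
      (z₂ : β₂ → ZMod 2) (z₃ : γ → ZMod 2),
      ‖fusionRest hw ι c₁ c₂ (Sum.elim k₁ (Sum.elim k₂ k₃)) (Sum.elim z₁ (Sum.elim z₂ z₃))‖ ^ 2 =
      ‖c₁ k₁ z₁‖ ^ 2 * (‖c₂ k₂ z₂‖ ^ 2 * ((if ∀ j, k₃ j = k₃ ⟨0, hw⟩ then (1 / 2 : ℝ) else 0) *
        if z₃ = (fun a => k₃ (ι a)) then 1 else 0)) := by
    intro k₁ k₂ k₃ z₁ z₂ z₃
    change ‖(if ∀ j, k₃ j = k₃ ⟨0, hw⟩ then 1 / (Real.sqrt 2 : ℂ) else 0) *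
      (c₁ k₁ z₁ * c₂ k₂ z₂ * if ∀ a, z₃ a = k₃ (ι a) then 1 else 0)‖ ^ 2 = _
    have e1 : ‖(if ∀ j, k₃ j = k₃ ⟨0, hw⟩ then 1 / (Real.sqrt 2 : ℂ) else 0)‖ ^ 2 =
        if ∀ j, k₃ j = k₃ ⟨0, hw⟩ then (1 / 2 : ℝ) else 0 := by
      split_ifs
      · rw [norm_div, div_pow, hs]; simp
      · simp
    have e2 : ‖(if ∀ a, z₃ a = k₃ (ι a) then (1 : ℂ) else 0)‖ ^ 2 =
        if z₃ = (fun a => k₃ (ι a)) then (1 : ℝ) else 0 := by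
      by_cases hz : z₃ = fun a => k₃ (ι a)
      · simp [hz]
      · rw [if_neg hz, if_neg fun hz' => hz (funext hz')]; simp
    rw [norm_mul, norm_mul, norm_mul, mul_pow, mul_pow, mul_pow]
    rw [e1, e2]
    ring
  simp only [sum_arrow_sum, h, ← Finset.mul_sum, Finset.sum_ite_eq', Finset.mem_univ, if_true,
    mul_one, sum_const_half hw, ← Finset.sum_mul, h₁, h₂]

end CatFusion

section Fusion

variable {n w : ℕ} {β₁ β₂ γ κ₁ κ₂ : Type} [Fintype β₁] [Fintype β₂] [Fintype γ] [DecidableEq β₁]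
  [DecidableEq β₂] [DecidableEq γ] [Fintype κ₁] [DecidableEq κ₁] [Fintype κ₂] [DecidableEq κ₂]

/-- A Pauli string on the legs of both blocks. -/
def legPauli (β₁ β₂ γ : Type) (p₁ p₂ : PauliString (Fin n)) :
    PauliString ((Fin n ⊕ Fin n) ⊕ (β₁ ⊕ β₂ ⊕ γ)) :=
  Sum.elim (Sum.elim p₁ p₂) 0

/-- If both circuits prepare cat states up to Pauli errors, then these errors can be treated as
faults of the fusion. -/
lemma Circuit.exists_branch_join_cat [Nonempty (Fin n)] (A : Circuit (Fin n) β₁ κ₁)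
    (B : Circuit (Fin n) β₂ κ₂)
    (l : List (Op ((Fin n ⊕ Fin n) ⊕ (β₁ ⊕ β₂ ⊕ γ)) (κ₁ ⊕ κ₂ ⊕ Fin w)))
    (F G : Fault ((Fin n ⊕ Fin n) ⊕ (β₁ ⊕ β₂ ⊕ γ)))
    (hF : ∀ t, A.ops.length + B.ops.length < t → F t = 0) (hFa : ∀ t a, F t (ancilla a) = 0)
    (hG : ∀ t, t < A.ops.length + B.ops.length → G t = 0) {p₁ p₂ : PauliString (Fin n)}
    (hA : A.output (restrict₁ A B F) = catOutput p₁)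
    (hB : B.output (restrict₂ A B F) = catOutput p₂) :
    ∃ (c₁ : (κ₁ → ZMod 2) → State β₁) (c₂ : (κ₂ → ZMod 2) → State β₂),
      (∑ k, ∑ z, ‖c₁ k z‖ ^ 2 = 1) ∧ (∑ k, ∑ z, ‖c₂ k z‖ ^ 2 = 1) ∧ ∀ k,
      PhaseEq ((A.join B l).branch (F + G) k)
        (evolve (G + Pi.single (A.ops.length + B.ops.length) (legPauli β₁ β₂ γ p₁ p₂)) k l
          (A.ops.length + B.ops.length) (tens (catTens (c₁ fun b => k (Sum.inl b)))
            (catTens (c₂ fun b => k (Sum.inr (Sum.inl b)))) (zeroState γ))) := by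
  obtain ⟨c₁, hn₁, hc₁⟩ := exists_branch_eq_of_output hA
  obtain ⟨c₂, hn₂, hc₂⟩ := exists_branch_eq_of_output hB
  refine ⟨c₁, c₂, hn₁, hn₂, fun k => (branch_join A B l F G hF hFa hG k).trans ?_⟩
  have hP : ∀ (φ₁ : State β₁) (φ₂ : State β₂),
      applyPauli (legPauli β₁ β₂ γ p₁ p₂) (tens (catTens φ₁) (catTens φ₂) (zeroState γ)) =
      tens (fun s => applyPauli p₁ (catState (Fin n)) (fun q => s (Sum.inl q)) *
          φ₁ fun q => s (Sum.inr q))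
        (fun s => applyPauli p₂ (catState (Fin n)) (fun q => s (Sum.inl q)) *
          φ₂ fun q => s (Sum.inr q)) (zeroState γ) := by
    intro φ₁ φ₂
    have e1 : (fun q => legPauli β₁ β₂ γ p₁ p₂ (qubit₁ q)) = Sum.elim p₁ 0 := by
      funext q; cases q <;> rfl
    have e2 : (fun q => legPauli β₁ β₂ γ p₁ p₂ (qubit₂ q)) = Sum.elim p₂ 0 := by
      funext q; cases q <;> rfl
    have e3 : (fun a => legPauli β₁ β₂ γ p₁ p₂ (ancilla a)) = 0 := rfl
    have e4 : ∀ {β : Type} [Fintype β] (p : PauliString (Fin n)) (φ : State β),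
        applyPauli (Sum.elim p 0) (catTens φ) = fun s =>
          applyPauli p (catState (Fin n)) (fun q => s (Sum.inl q)) * φ fun q => s (Sum.inr q) := by
      intro β _ p φ
      refine (applyPauli_sum (Sum.elim p 0) (catState (Fin n)) φ).trans ?_
      have : applyPauli (fun q : β => (Sum.elim p 0 : PauliString (Fin n ⊕ β)) (Sum.inr q)) φ = φ :=
        applyPauli_zero φ
      rw [this]
      rfl
    rw [applyPauli_tens, e1, e2, e3, applyPauli_zero, e4, e4]
  rw [hc₁, hc₂, ← hP]
  refine evolve_applyPauli _ _ _ _ _ _ _ _ ?_ fun i hi => ?_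
  · rw [Pi.add_apply, Pi.single_eq_same]
  · rw [Pi.add_apply, Pi.single_eq_of_ne (by omega), add_zero]

omit [Fintype β₁] [Fintype β₂] [Fintype γ] [Fintype κ₁] [Fintype κ₂] in
lemma writes_corrections : (corrections n w :
    List (Op ((Fin n ⊕ Fin n) ⊕ (β₁ ⊕ β₂ ⊕ γ)) (κ₁ ⊕ κ₂ ⊕ Fin w))).filterMap Op.writes = [] := by
  rw [List.filterMap_eq_nil_iff]
  intro o ho
  obtain ⟨i, -, rfl⟩ := List.mem_map.1 ho
  rfl

omit [Fintype β₁] [Fintype β₂] [Fintype γ] [Fintype κ₁] [Fintype κ₂] in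
lemma fusionOp_of_mem_corrections {h : w ≤ n} {ι : γ → Fin w}
    {o : Op ((Fin n ⊕ Fin n) ⊕ (β₁ ⊕ β₂ ⊕ γ)) (κ₁ ⊕ κ₂ ⊕ Fin w)} (ho : o ∈ corrections n w) :
    FusionOp h ι o := by
  obtain ⟨i, -, rfl⟩ := List.mem_map.1 ho
  exact .correct i _

variable {h : w ≤ n} {ι : γ → Fin w}
  {l : List (Op ((Fin n ⊕ Fin n) ⊕ (β₁ ⊕ β₂ ⊕ γ)) (κ₁ ⊕ κ₂ ⊕ Fin w))}

omit [Fintype κ₁] [Fintype κ₂] in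
lemma IsCheckList.fusionOp (hl : IsCheckList h ι l)
    {o : Op ((Fin n ⊕ Fin n) ⊕ (β₁ ⊕ β₂ ⊕ γ)) (κ₁ ⊕ κ₂ ⊕ Fin w)}
    (ho : o ∈ l ++ corrections n w) : FusionOp h ι o :=
  (List.mem_append.1 ho).elim (hl.op o) fusionOp_of_mem_corrections

omit [Fintype κ₁] [Fintype κ₂] [DecidableEq κ₁] [DecidableEq κ₂] in
lemma IsCheckList.nodup_writes (hl : IsCheckList h ι l) : (l.filterMap Op.writes).Nodup := by
  rw [hl.writes]
  exact (List.nodup_finRange w).map (Sum.inr_injective.comp Sum.inr_injective)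

/-- The output of a fusion with a fault that flips no check. -/
lemma IsCheckList.output_join (hl : IsCheckList h ι l) (hw : 0 < w) (A : Circuit (Fin n) β₁ κ₁)
    (B : Circuit (Fin n) β₂ κ₂) (F G : Fault ((Fin n ⊕ Fin n) ⊕ (β₁ ⊕ β₂ ⊕ γ)))
    (hF : ∀ t, A.ops.length + B.ops.length < t → F t = 0) (hFa : ∀ t a, F t (ancilla a) = 0)
    (hG : ∀ t, t < A.ops.length + B.ops.length → G t = 0) {p₁ p₂ : PauliString (Fin n)}
    (hA : A.output (restrict₁ A B F) = catOutput p₁)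
    (hB : B.output (restrict₂ A B F) = catOutput p₂)
    {G' : Fault ((Fin n ⊕ Fin n) ⊕ (β₁ ⊕ β₂ ⊕ γ))}
    (hG' : G' = G + Pi.single (A.ops.length + B.ops.length) (legPauli β₁ β₂ γ p₁ p₂))
    (hf : ∀ j, flips G' l (A.ops.length + B.ops.length) 0 (checkBit j) = 0) :
    (A.join B (l ++ corrections n w)).output (F + G) = catOutput fun q =>
      (G' (A.ops.length + B.ops.length + (l ++ corrections n w).length) +
        frame G' (l ++ corrections n w) (A.ops.length + B.ops.length) 0) (Sum.inl q) := by
  have : Nonempty (Fin n) := ⟨Fin.castLE h ⟨0, hw⟩⟩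
  obtain ⟨c₁, c₂, hn₁, hn₂, hb⟩ := Circuit.exists_branch_join_cat A B (l ++ corrections n w) F G
    hF hFa hG hA hB
  rw [← hG'] at hb
  set T := A.ops.length + B.ops.length
  set P := G' (T + (l ++ corrections n w).length) + frame G' (l ++ corrections n w) T 0 with hP
  have hwr : (l ++ corrections n w).filterMap Op.writes = l.filterMap Op.writes := by
    rw [List.filterMap_append, writes_corrections, List.append_nil]
  have key : ∀ k, PhaseEq ((A.join B (l ++ corrections n w)).branch (F + G) k) fun s =>
      applyPauli (fun q => P (Sum.inl q)) (catState (Fin n ⊕ Fin n)) (fun q => s (Sum.inl q)) *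
        applyPauli (fun q => P (Sum.inr q)) (fusionRest hw ι c₁ c₂ k) fun q => s (Sum.inr q) := by
    intro k
    refine (hb k).trans ?_
    have h1 := run_applyPauli G' k k (l ++ corrections n w)
      (fun o ho => (hl.fusionOp ho).isClifford) (by rw [hwr]; exact hl.nodup_writes) T 0 ?_
      (fun _ _ _ _ => rfl) (tens (catTens (c₁ fun b => k (Sum.inl b)))
            (catTens (c₂ fun b => k (Sum.inr (Sum.inl b)))) (zeroState γ))
    · rw [applyPauli_zero, hl.run_fusion hw] at h1
      rw [evolve_eq_run, ← applyPauli_sum]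
      exact (h1.applyPauli _).trans (applyPauli_comp _ _ _)
    · intro b hb
      rw [flips_append, Pi.add_apply, flips_eq_zero_of_not_written G' (corrections n w) _ _ (by
        rw [writes_corrections]; simp), add_zero]
      rw [hwr, hl.writes] at hb
      obtain ⟨j, -, rfl⟩ := List.mem_map.1 hb
      rw [hf, add_zero]
  ext x y
  simp only [Circuit.output, catOutput, Matrix.of_apply, (key _).mul_conj, Sum.elim_inl,
    Sum.elim_inr, map_mul]
  have hn := sum_norm_fusionRest hw ι hn₁ hn₂
  have hn' : ∑ k, ∑ z, applyPauli (fun q => P (Sum.inr q)) (fusionRest hw ι c₁ c₂ k) z *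
      conj (applyPauli (fun q => P (Sum.inr q)) (fusionRest hw ι c₁ c₂ k) z) = 1 := by
    simp only [Complex.mul_conj, Complex.normSq_eq_norm_sq, ← Complex.ofReal_sum,
      sum_norm_applyPauli, hn, Complex.ofReal_one]
  rw [← mul_one (_ * conj _), ← hn', Finset.mul_sum]
  refine Finset.sum_congr rfl fun k _ => ?_
  rw [Finset.mul_sum]
  exact Finset.sum_congr rfl fun z _ => by ring

/-- A fault that flips some but not all checks is detectable. -/
lemma IsCheckList.detectable_join (hl : IsCheckList h ι l) (A : Circuit (Fin n) β₁ κ₁)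
    (B : Circuit (Fin n) β₂ κ₂) (F G : Fault ((Fin n ⊕ Fin n) ⊕ (β₁ ⊕ β₂ ⊕ γ)))
    (hF : ∀ t, A.ops.length + B.ops.length < t → F t = 0) (hFa : ∀ t a, F t (ancilla a) = 0)
    (hG : ∀ t, t < A.ops.length + B.ops.length → G t = 0) {p₁ p₂ : PauliString (Fin n)}
    (hA₀ : A.output 0 = catOutput 0) (hB₀ : B.output 0 = catOutput 0)
    (hA : A.output (restrict₁ A B F) = catOutput p₁)
    (hB : B.output (restrict₂ A B F) = catOutput p₂)
    {G' : Fault ((Fin n ⊕ Fin n) ⊕ (β₁ ⊕ β₂ ⊕ γ))}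
    (hG' : G' = G + Pi.single (A.ops.length + B.ops.length) (legPauli β₁ β₂ γ p₁ p₂))
    {j j' : Fin w} (hj : flips G' l (A.ops.length + B.ops.length) 0 (checkBit j) ≠
      flips G' l (A.ops.length + B.ops.length) 0 (checkBit j')) :
    (A.join B (l ++ corrections n w)).Detectable (F + G) := by
  have : Nonempty (Fin n) := ⟨Fin.castLE h j⟩
  have hne : (checkBit j : κ₁ ⊕ κ₂ ⊕ Fin w) ≠ checkBit j' := fun h' => hj (by rw [h'])
  obtain ⟨c₁, c₂, -, -, hb⟩ := Circuit.exists_branch_join_cat A B (l ++ corrections n w) F G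
    hF hFa hG hA hB
  rw [← hG'] at hb
  obtain ⟨d₁, d₂, -, -, hb₀⟩ := Circuit.exists_branch_join_cat A B (l ++ corrections n w) 0 0
    (fun _ _ => rfl) (fun _ _ => rfl) (fun _ _ => rfl) (p₁ := 0) (p₂ := 0)
    (by rw [map_zero]; exact hA₀) (by rw [map_zero]; exact hB₀)
  have h0 : legPauli β₁ β₂ γ (0 : PauliString (Fin n)) 0 = 0 := by
    funext q; rcases q with (q | q) | q <;> rfl
  rw [h0, Pi.single_zero, add_zero] at hb₀
  refine ⟨{checkBit j, checkBit j'}, 0, fun k hk => ?_, fun k hk => ?_⟩ <;>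
    rw [Finset.sum_pair hne]
  · rw [zmod2_add_eq_zero]
    by_contra hkj
    refine hk ((hb₀ k).eq_zero ?_)
    rw [evolve_append]
    by_cases hr : run 0 k l (A.ops.length + B.ops.length)
        (tens (catTens (d₁ fun b => k (Sum.inl b)))
          (catTens (d₂ fun b => k (Sum.inr (Sum.inl b)))) (zeroState γ)) = 0
    · rw [hr, evolve_zero]
    · exact absurd (hl.outcomes_eq hr j j') hkj
  · by_contra hkj
    refine hk ((hb k).eq_zero ?_)
    rw [evolve_append]
    let k' : κ₁ ⊕ κ₂ ⊕ Fin w → ZMod 2 := k + flips G' l (A.ops.length + B.ops.length) 0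
    have h1 := run_applyPauli G' k k' l (fun o ho => (hl.op o ho).isClifford) hl.nodup_writes
      (A.ops.length + B.ops.length) 0 (fun _ _ => rfl)
      (fun o ho b hb => by rw [hl.reads o ho] at hb; simp at hb)
      (tens (catTens (c₁ fun b => k (Sum.inl b)))
        (catTens (c₂ fun b => k (Sum.inr (Sum.inl b)))) (zeroState γ))
    rw [applyPauli_zero] at h1
    by_cases hr : run 0 k' l (A.ops.length + B.ops.length)
        (tens (catTens (c₁ fun b => k (Sum.inl b)))
          (catTens (c₂ fun b => k (Sum.inr (Sum.inl b)))) (zeroState γ)) = 0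
    · rw [hr] at h1
      have h2 : applyPauli (frame G' l (A.ops.length + B.ops.length) 0)
          (0 : State ((Fin n ⊕ Fin n) ⊕ (β₁ ⊕ β₂ ⊕ γ))) = 0 := by
        have := applyPauli_smul (frame G' l (A.ops.length + B.ops.length) 0) 0
          (0 : State ((Fin n ⊕ Fin n) ⊕ (β₁ ⊕ β₂ ⊕ γ)))
        simpa using this
      rw [h1.eq_zero h2, evolve_zero]
    · refine absurd (hl.outcomes_eq hr j j') fun h3 => hkj ?_
      simp only [k', Pi.add_apply] at h3
      revert h3 hj
      generalize flips G' l (A.ops.length + B.ops.length) 0 (checkBit j) = a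
      generalize flips G' l (A.ops.length + B.ops.length) 0 (checkBit j') = b
      generalize k (checkBit j) = c
      generalize k (checkBit j') = d
      revert a b c d
      decide

lemma exists_mem_of_sum_ne_zero {M N : Type*} [AddCommMonoid M] [AddCommMonoid N] (φ : M →+ N)
    (L : List M) (h : φ L.sum ≠ 0) : ∃ a ∈ L, φ a ≠ 0 := by
  by_contra! h'
  rw [map_list_sum] at h
  refine h (List.sum_eq_zero fun x hx => ?_)
  obtain ⟨a, ha, rfl⟩ := List.mem_map.1 hx
  exact h' a ha

lemma card_le_length {X Y : Type*} [DecidableEq Y] [Nonempty Y] (S : Finset X) (L : List Y) (R : Y → X → Prop)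
    (hR : ∀ a ∈ L, ∀ x y, R a x → R a y → x = y) (hS : ∀ x ∈ S, ∃ a ∈ L, R a x) :
    S.card ≤ L.length := by
  choose! f hf using hS
  refine (Finset.card_le_card_of_injOn f (fun x hx => ?_) fun x hx y hy hxy => ?_).trans
    (List.toFinset_card_le L)
  · exact Finset.mem_coe.2 (List.mem_toFinset.2 (hf x (Finset.mem_coe.1 hx)).1)
  · have h1 := hf x (Finset.mem_coe.1 hx)
    have h2 := hf y (Finset.mem_coe.1 hy)
    rw [← hxy] at h2
    exact hR _ h1.1 x y h1.2 h2.2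

omit [Fintype β₁] [Fintype β₂] [Fintype γ] [Fintype κ₁] [Fintype κ₂] [DecidableEq κ₁] [DecidableEq κ₂] in
lemma totalX_eq (T : ℕ) {q : Fin n ⊕ Fin n} (G : Fault ((Fin n ⊕ Fin n) ⊕ (β₁ ⊕ β₂ ⊕ γ)))
    (hl : ∀ o ∈ l, FusionOp h ι o) :
    ((G (T + l.length) + frame G l T 0) (Sum.inl q)).1 = totalX T l.length (Sum.inl q) G := by
  rw [Pi.add_apply, Prod.fst_add, frame_fst G l (fun i c hc => FusionOp.not_target (hl _ hc)),
    totalX_apply, Finset.sum_range_succ, add_comm]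
  simp

omit [Fintype κ₁] [Fintype κ₂] in
/-- The checks flipped by a sum of small faults, and the legs on which its `X` part acts, are at
most as many as these faults. -/
lemma card_le_of_isSmall (hl : IsCheckList h ι l) {T : ℕ}
    {L : List (Fault ((Fin n ⊕ Fin n) ⊕ (β₁ ⊕ β₂ ⊕ γ)))}
    (hL : ∀ f ∈ L, IsSmall h ι T (l ++ corrections n w).length f) :
    (Finset.univ.filter fun j : Fin w => flips L.sum l T 0 (checkBit j) ≠ 0).card ≤ L.length ∧
    (Finset.univ.filter fun q : Fin n ⊕ Fin n =>
      ((L.sum (T + (l ++ corrections n w).length) + frame L.sum (l ++ corrections n w) T 0)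
        (Sum.inl q)).1 ≠ 0).card ≤ L.length := by
  classical
  constructor
  · refine card_le_length _ L (fun f j => ∃ t, ∃ q ∈ checkQubits h ι j, f t q ≠ 0)
      (fun f hf => (hL f hf).check) fun j hj => ?_
    by_contra! hne
    refine (Finset.mem_filter.1 hj).2 (flips_eq_zero_of_confined l
      (fun o ho => (hl.op o ho).confined j) (fun t q hq => ?_) T 0 fun _ _ => rfl)
    by_contra hz
    obtain ⟨f, hf, h1⟩ := exists_mem_of_sum_ne_zero ((Pi.evalAddMonoidHom (fun _ => Pauli) q).comp
      (Pi.evalAddMonoidHom (fun _ : ℕ => PauliString _) t)) L hz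
    exact h1 (hne f hf t q hq)
  · refine card_le_length _ L (fun f q => totalX T (l ++ corrections n w).length (Sum.inl q) f ≠ 0)
      (fun f hf => (hL f hf).leg) fun q hq => ?_
    refine exists_mem_of_sum_ne_zero _ L ?_
    rw [← totalX_eq T L.sum fun o ho => hl.fusionOp ho]
    exact (Finset.mem_filter.1 hq).2

omit [DecidableEq β₁] [DecidableEq β₂] [DecidableEq γ] in
lemma card_supp_legPauli_le (p₁ p₂ : PauliString (Fin n)) :
    (supp (legPauli β₁ β₂ γ p₁ p₂)).card ≤ (supp p₁).card + (supp p₂).card := by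
  rw [← Finset.card_disjSum]
  refine Finset.card_le_card_of_surjOn Sum.inl ?_
  rintro ((q | q) | q) hq <;> have := mem_supp.1 (Finset.mem_coe.1 hq)
  · exact ⟨Sum.inl q, Finset.mem_coe.2 (Finset.inl_mem_disjSum.2 (mem_supp.2 this)), rfl⟩
  · exact ⟨Sum.inr q, Finset.mem_coe.2 (Finset.inr_mem_disjSum.2 (mem_supp.2 this)), rfl⟩
  · exact absurd rfl this

omit [Fintype κ₁] [Fintype κ₂] in
lemma IsLateFault.isSmall (hl : IsCheckList h ι l) {T : ℕ}
    {F : Fault ((Fin n ⊕ Fin n) ⊕ (β₁ ⊕ β₂ ⊕ γ))} (hF : IsLateFault (l ++ corrections n w) T F) :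
    IsSmall h ι T (l ++ corrections n w).length F := by
  rcases hF.cases with ⟨t, q, p, rfl⟩ | ⟨t, o, ho, hF⟩
  · exact isSmall_wire _ _ _ _ _
  · exact (hl.fusionOp (List.mem_of_getElem? ho)).isSmall (List.getElem?_eq_some_iff.1 ho).1 hF

/-- A fault of a cat state preparation whose weight is less than `w` is detectable, or acts as a
Pauli string of at most the same weight on the legs. -/
lemma PreparesCat.detectable_or_exists {α β κ : Type} [Fintype α] [DecidableEq α] [Fintype β]
    [DecidableEq β] [Fintype κ] [DecidableEq κ] {C : Circuit α β κ} (hC : PreparesCat w C)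
    {L : List (Fault (α ⊕ β))} (hL : ∀ f ∈ L, f ∈ C.noise) (hw : L.length < w) :
    C.Detectable L.sum ∨ ∃ p, (supp p).card ≤ L.length ∧ C.output L.sum = catOutput p := by
  have hle := Circuit.wt_sum_le hL
  rcases hC.1 L.sum (Circuit.mem_faults_iff.2 ⟨L, hL, rfl⟩) (hle.trans_lt hw) with hd | ⟨G, hG, h1, h2⟩
  · exact Or.inl hd
  · exact Or.inr ⟨_, (card_supp_le_wt_idealCat hG).trans (h1.trans hle),
      h2.trans (idealCat_output G)⟩

/-- The fault-boundedness of a fusion by the idealised cat state preparation. -/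
lemma IsCheckList.faultBounded_join (hl : IsCheckList h ι l) (A : Circuit (Fin n) β₁ κ₁)
    (B : Circuit (Fin n) β₂ κ₂) (hA : PreparesCat w A) (hB : PreparesCat w B) :
    FaultBounded w (A.join B (l ++ corrections n w)) (idealCat (Fin n ⊕ Fin n)) := by
  intro F hF hFw
  have hw : 0 < w := by omega
  have : Nonempty (Fin n) := ⟨Fin.castLE h ⟨0, hw⟩⟩
  obtain ⟨L, hL, hLn, rfl⟩ := Circuit.exists_list_of_mem_faults hF
  rw [← hL] at hFw ⊢
  clear hF hL
  obtain ⟨L₁, L₂, L₃, hlen, hsum, h1, h2, h3⟩ := Circuit.exists_split_noise_join A B _ L hLn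
  rw [← hsum]
  set T := A.ops.length + B.ops.length with hT
  have hsum0 : ∀ (L' : List (Fault ((Fin n ⊕ Fin n) ⊕ (β₁ ⊕ β₂ ⊕ γ)))) t q,
      (∀ f ∈ L', f t q = 0) → L'.sum t q = 0 := by
    intro L' t q hz
    by_contra hne
    obtain ⟨f, hf, hf'⟩ := exists_mem_of_sum_ne_zero
      ((Pi.evalAddMonoidHom (fun _ => Pauli) q).comp
        (Pi.evalAddMonoidHom (fun _ : ℕ => PauliString _) t)) L' hne
    exact hf' (hz f hf)
  have hlate : ∀ t, T < t → (L₁.sum + L₂.sum) t = 0 := by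
    intro t ht
    funext q
    rw [Pi.add_apply, Pi.add_apply, hsum0 L₁ t q fun f hf => by rw [(h1 f hf).late t ht]; rfl,
      hsum0 L₂ t q fun f hf => by rw [(h2 f hf).late t ht]; rfl]
    rfl
  have hanc : ∀ t a, (L₁.sum + L₂.sum) t (ancilla a) = 0 := by
    intro t a
    rw [Pi.add_apply, Pi.add_apply,
      hsum0 L₁ t _ fun f hf => (h1 f hf).outside t _ (by
        rintro ⟨q, hq⟩; exact qubit₁_ne_ancilla _ _ hq),
      hsum0 L₂ t _ fun f hf => (h2 f hf).outside t _ (by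
        rintro ⟨q, hq⟩; exact qubit₂_ne_ancilla _ _ hq)]
    rfl
  have hearly : ∀ t, t < T → L₃.sum t = 0 := by
    intro t ht
    funext q
    exact hsum0 L₃ t q fun f hf => by rw [(h3 f hf).early t ht]; rfl
  have hr₁ : restrict₁ A B (L₁.sum + L₂.sum) = (L₁.map (restrict₁ A B)).sum := by
    rw [map_add, reindex_eq_zero _ _ _ L₂.sum fun t q => hsum0 _ _ _ fun f hf =>
      (h2 f hf).outside _ _ (by rintro ⟨q', hq⟩; exact qubit₁_ne_qubit₂ _ _ hq.symm), add_zero,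
      map_list_sum]
  have hr₂ : restrict₂ A B (L₁.sum + L₂.sum) = (L₂.map (restrict₂ A B)).sum := by
    rw [map_add, reindex_eq_zero _ _ _ L₁.sum fun t q => hsum0 _ _ _ fun f hf =>
      (h1 f hf).outside _ _ (by rintro ⟨q', hq⟩; exact qubit₁_ne_qubit₂ _ _ hq), zero_add,
      map_list_sum]
  have hm₁ : ∀ f ∈ L₁.map (restrict₁ A B), f ∈ A.noise := by
    intro f hf
    obtain ⟨f', hf', rfl⟩ := List.mem_map.1 hf
    exact (h1 f' hf').mem
  have hm₂ : ∀ f ∈ L₂.map (restrict₂ A B), f ∈ B.noise := by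
    intro f hf
    obtain ⟨f', hf', rfl⟩ := List.mem_map.1 hf
    exact (h2 f' hf').mem
  rcases hA.detectable_or_exists hm₁ (by rw [List.length_map]; omega) with hd | ⟨p₁, hp₁, hA₁⟩
  · rw [← hr₁] at hd
    exact Or.inl (hd.join₁ A B _ hlate hanc hearly)
  rcases hB.detectable_or_exists hm₂ (by rw [List.length_map]; omega) with hd | ⟨p₂, hp₂, hB₁⟩
  · rw [← hr₂] at hd
    exact Or.inl (hd.join₂ A B _ hlate hanc hearly)
  rw [← hr₁] at hA₁
  rw [← hr₂] at hB₁
  rw [List.length_map] at hp₁ hp₂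
  let L' := L₃ ++ (supp (legPauli β₁ β₂ γ p₁ p₂)).toList.map fun q =>
    (Pi.single T (Pi.single q (legPauli β₁ β₂ γ p₁ p₂ q)) :
      Fault ((Fin n ⊕ Fin n) ⊕ (β₁ ⊕ β₂ ⊕ γ)))
  have hL'sum : L'.sum = L₃.sum + Pi.single T (legPauli β₁ β₂ γ p₁ p₂) := by
    have := map_list_sum (AddMonoidHom.single
      (fun _ : ℕ => PauliString ((Fin n ⊕ Fin n) ⊕ (β₁ ⊕ β₂ ⊕ γ))) T)
      ((supp (legPauli β₁ β₂ γ p₁ p₂)).toList.map fun q =>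
        (Pi.single q (legPauli β₁ β₂ γ p₁ p₂ q) :
          PauliString ((Fin n ⊕ Fin n) ⊕ (β₁ ⊕ β₂ ⊕ γ))))
    rw [sum_single_supp, List.map_map] at this
    rw [List.sum_append]
    exact congrArg (L₃.sum + ·) this.symm
  have hL'len : L'.length ≤ L.length := by
    have := card_supp_legPauli_le (β₁ := β₁) (β₂ := β₂) (γ := γ) p₁ p₂
    rw [List.length_append, List.length_map, Finset.length_toList]
    omega
  have hL'small : ∀ f ∈ L', IsSmall h ι T (l ++ corrections n w).length f := by
    intro f hf
    rcases List.mem_append.1 hf with hf | hf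
    · exact (h3 f hf).isSmall hl
    · obtain ⟨q, -, rfl⟩ := List.mem_map.1 hf
      exact isSmall_wire _ _ _ _ _
  obtain ⟨hc1, hc2⟩ := card_le_of_isSmall hl hL'small
  by_cases hf : ∃ j j' : Fin w, flips L'.sum l T 0 (checkBit j) ≠ flips L'.sum l T 0 (checkBit j')
  · obtain ⟨j, j', hj⟩ := hf
    exact Or.inl (hl.detectable_join A B _ _ hlate hanc hearly (hA.output_zero hw)
      (hB.output_zero hw) hA₁ hB₁ hL'sum hj)
  · push Not at hf
    have hf0 : ∀ j, flips L'.sum l T 0 (checkBit j) = 0 := by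
      obtain ⟨j₀, hj₀⟩ : ∃ j₀ : Fin w, flips L'.sum l T 0 (checkBit j₀) = 0 := by
        by_contra! hne
        rw [Finset.filter_true_of_mem fun j _ => hne j, Finset.card_univ, Fintype.card_fin] at hc1
        omega
      exact fun j => (hf j j₀).trans hj₀
    have ho := hl.output_join hw A B _ _ hlate hanc hearly hA₁ hB₁ hL'sum hf0
    have hP0 : L.length = 0 → L'.sum (T + (l ++ corrections n w).length) +
        frame L'.sum (l ++ corrections n w) T 0 = 0 := by
      intro h0
      have : L' = [] := List.length_eq_zero_iff.1 (by omega)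
      rw [this, List.sum_nil, frame_eq_zero _ _ _ fun _ _ => rfl]
      rfl
    revert ho hP0 hc2
    generalize L'.sum (T + (l ++ corrections n w).length) +
      frame L'.sum (l ++ corrections n w) T 0 = P
    intro hc2 ho hP0
    obtain ⟨p, hp, hpo⟩ := exists_catOutput_eq (fun q => P (Sum.inl q)) (hc2.trans hL'len)
      fun h0 => by rw [hP0 h0]; rfl
    obtain ⟨hG1, hG2⟩ := single_mem_faults_idealCat p
    refine Or.inr ⟨_, hG1, hG2.trans hp, ?_⟩
    rw [idealCat_output, ho, hpo, Pi.single_eq_same]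
    rfl

/-- The fault-boundedness of the idealised cat state preparation by a fusion. -/
lemma IsCheckList.faultBounded_idealCat (hl : IsCheckList h ι l) (A : Circuit (Fin n) β₁ κ₁)
    (B : Circuit (Fin n) β₂ κ₂) (hA : PreparesCat w A) (hB : PreparesCat w B) :
    FaultBounded w (idealCat (Fin n ⊕ Fin n)) (A.join B (l ++ corrections n w)) := by
  intro G hG hGw
  have hw : 0 < w := by omega
  have : Nonempty (Fin n) := ⟨Fin.castLE h ⟨0, hw⟩⟩
  right
  set T := A.ops.length + B.ops.length with hT
  set N := (l ++ corrections n w : List (Op ((Fin n ⊕ Fin n) ⊕ (β₁ ⊕ β₂ ⊕ γ))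
    (κ₁ ⊕ κ₂ ⊕ Fin w))).length with hN
  have hNl : l.length < N := by
    rw [hN, List.length_append, corrections, List.length_map, List.length_finRange]
    have := Fin.pos_iff_nonempty.2 this
    omega
  let p : PauliString (Fin n ⊕ Fin n) := fun q => G 0 (Sum.inl q)
  let P : PauliString ((Fin n ⊕ Fin n) ⊕ (β₁ ⊕ β₂ ⊕ γ)) := Sum.elim p 0
  have hops : (A.join B (l ++ corrections n w)).ops.length = T + N := by
    simp only [Circuit.join, List.length_append, List.length_map, hT, hN]
    omega
  obtain ⟨hF1, hF2⟩ := Circuit.single_mem_faults (C := A.join B (l ++ corrections n w))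
    (t := T + N) hops.ge (p := P) fun q _ => Or.inr (Or.inr (Nat.le_add_right _ _))
  refine ⟨_, hF1, hF2.trans (le_trans ?_ (card_supp_le_wt_idealCat hG)), ?_⟩
  · refine Finset.card_le_card_of_surjOn Sum.inl ?_
    rintro (q | q) hq <;> have := mem_supp.1 (Finset.mem_coe.1 hq)
    · exact ⟨q, Finset.mem_coe.2 (mem_supp.2 this), rfl⟩
    · exact absurd rfl this
  · have hz : ∀ t, t < T + N → (Pi.single (T + N) P : Fault _) t = 0 := fun t ht =>
      Pi.single_eq_of_ne ht.ne _
    have h0 : legPauli β₁ β₂ γ (0 : PauliString (Fin n)) 0 = 0 := by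
      funext q; rcases q with (q | q) | q <;> rfl
    have ho := hl.output_join hw A B 0 (Pi.single (T + N) P) (fun _ _ => rfl) (fun _ _ => rfl)
      (fun t ht => hz t (by omega)) (p₁ := 0) (p₂ := 0)
      (by rw [map_zero]; exact hA.output_zero hw) (by rw [map_zero]; exact hB.output_zero hw)
      (G' := Pi.single (T + N) P) (by rw [h0, Pi.single_zero, add_zero])
      (fun j => by rw [flips_eq_zero _ _ _ fun i hi => hz _ (by omega)]; rfl)
    rw [zero_add] at ho
    rw [ho, idealCat_output, frame_eq_zero _ _ _ fun i hi => hz _ (by omega), add_zero,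
      Pi.single_eq_same]
    rfl

/-- A fusion by parity checks of fault-tolerantly prepared cat states fault-tolerantly prepares the
joint cat state. -/
theorem IsCheckList.preparesCat_join (hl : IsCheckList h ι l) (A : Circuit (Fin n) β₁ κ₁)
    (B : Circuit (Fin n) β₂ κ₂) (hA : PreparesCat w A) (hB : PreparesCat w B) :
    PreparesCat w (A.join B (l ++ corrections n w)) :=
  ⟨hl.faultBounded_join A B hA hB, hl.faultBounded_idealCat A B hA hB⟩

end Fusion

section CheckLists

variable {n w : ℕ} {β₁ β₂ γ κ₁ κ₂ : Type} [Fintype β₁] [Fintype β₂] [Fintype γ] [DecidableEq β₁]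
  [DecidableEq β₂] [DecidableEq γ] [DecidableEq κ₁] [DecidableEq κ₂]

/-! ### The two implementations of the checks -/

lemma Op.meas_apply_of_fst_eq_zero {Q κ : Type} [Fintype Q] [DecidableEq Q] {p : PauliString Q}
    (hp : ∀ q, (p q).1 = 0) (g : Grade) (b : κ) (k : κ → ZMod 2) (ψ : State Q) :
    (Op.meas g p b).apply k ψ = fun s => if ∑ q, (p q).2 * s q = k b then ψ s else 0 := by
  funext s
  have h := one_add_sgn_mul (k b) (∑ q, (p q).2 * s q)
  simp only [Op.apply, applyPauli_of_fst_eq_zero hp]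
  split_ifs with h1
  · rw [if_pos h1] at h
    linear_combination ψ s * h
  · rw [if_neg h1] at h
    linear_combination ψ s * h

lemma pauliZ_single_snd {Q : Type} [DecidableEq Q] (a q : Q) :
    ((Pi.single a pauliZ : PauliString Q) q).2 = if q = a then 1 else 0 := by
  rw [Pi.single_apply]; split_ifs <;> rfl

lemma pauliZ_single_fst {Q : Type} [DecidableEq Q] (a q : Q) :
    ((Pi.single a pauliZ : PauliString Q) q).1 = 0 := by
  rw [Pi.single_apply]; split_ifs <;> rfl

omit [DecidableEq κ₁] [DecidableEq κ₂] in
lemma run_idealChecks (h : w ≤ n) (js : List (Fin w)) (k : κ₁ ⊕ κ₂ ⊕ Fin w → ZMod 2) (t : ℕ)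
    (ψ : State ((Fin n ⊕ Fin n) ⊕ (β₁ ⊕ β₂ ⊕ γ))) :
    run 0 k (js.map fun j => Op.meas Grade.faultTolerant
      (Pi.single (leg₁ (Fin.castLE h j)) pauliZ + Pi.single (leg₂ (Fin.castLE h j)) pauliZ)
      (checkBit j)) t ψ = fun s =>
      if ∀ j ∈ js, s (leg₁ (Fin.castLE h j)) + s (leg₂ (Fin.castLE h j)) = k (checkBit j)
      then ψ s else 0 := by
  induction js generalizing t ψ with
  | nil => simp [run]
  | cons j js ih =>
    rw [List.map_cons, run, ih, Pi.zero_apply, applyPauli_zero, Op.meas_apply_of_fst_eq_zero]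
    · funext s
      have hs : ∑ q, ((Pi.single (leg₁ (Fin.castLE h j)) pauliZ +
          Pi.single (leg₂ (Fin.castLE h j)) pauliZ :
            PauliString ((Fin n ⊕ Fin n) ⊕ (β₁ ⊕ β₂ ⊕ γ))) q).2 * s q =
          s (leg₁ (Fin.castLE h j)) + s (leg₂ (Fin.castLE h j)) := by
        simp only [Pi.add_apply, Prod.snd_add, pauliZ_single_snd, add_mul, ite_mul, one_mul,
          zero_mul, Finset.sum_add_distrib, Finset.sum_ite_eq', Finset.mem_univ, if_true]
      simp only [hs, ← ite_and]
      refine if_congr ?_ rfl rfl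
      rw [List.forall_mem_cons, and_comm]
    · intro q
      rw [Pi.add_apply, Prod.fst_add, pauliZ_single_fst, pauliZ_single_fst, add_zero]

omit [DecidableEq κ₁] [DecidableEq κ₂] in
lemma isCheckList_idealChecks (h : w ≤ n) :
    IsCheckList (β₁ := β₁) (β₂ := β₂) (κ₁ := κ₁) (κ₂ := κ₂) h Empty.elim (idealChecks h) where
  op o ho := by
    obtain ⟨j, -, rfl⟩ := List.mem_map.1 ho
    exact .measLegs j
  reads o ho := by
    obtain ⟨j, -, rfl⟩ := List.mem_map.1 ho
    rfl
  writes := by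
    rw [idealChecks, List.filterMap_map, ← List.filterMap_eq_map]
    rfl
  run_tens k t ψ₁ ψ₂ s := by
    rw [idealChecks, run_idealChecks]
    refine if_congr (by simp [ParitiesAgree]) ?_ rfl
    have : (zeroState Empty) = recordState (w := w) (κ₁ := κ₁) (κ₂ := κ₂) Empty.elim k := by
      funext u; simp [zeroState, recordState]
    rw [this]

omit [DecidableEq κ₁] [DecidableEq κ₂] in
lemma run_cnotCheck (h : w ≤ n) (j : Fin w) (k : κ₁ ⊕ κ₂ ⊕ Fin w → ZMod 2) (t : ℕ)
    (ψ : State ((Fin n ⊕ Fin n) ⊕ (β₁ ⊕ β₂ ⊕ Fin w))) :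
    run 0 k [Op.cnot false (leg₁ (Fin.castLE h j)) (ancilla j),
      Op.cnot false (leg₂ (Fin.castLE h j)) (ancilla j),
      Op.meas Grade.faulty (Pi.single (ancilla j) pauliZ) (checkBit j)] t ψ = fun s =>
      if s (ancilla j) = k (checkBit j) then ψ (Function.update s (ancilla j)
        (s (ancilla j) + s (leg₂ (Fin.castLE h j)) + s (leg₁ (Fin.castLE h j)))) else 0 := by
  simp only [run, Pi.zero_apply, applyPauli_zero]
  rw [Op.meas_apply_of_fst_eq_zero fun q => pauliZ_single_fst _ _]
  funext s
  have hs : ∑ q, ((Pi.single (ancilla j) pauliZ :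
      PauliString ((Fin n ⊕ Fin n) ⊕ (β₁ ⊕ β₂ ⊕ Fin w))) q).2 * s q = s (ancilla j) := by
    simp only [pauliZ_single_snd, ite_mul, one_mul, zero_mul, Finset.sum_ite_eq', Finset.mem_univ,
      if_true]
  rw [hs]
  refine if_congr Iff.rfl ?_ rfl
  have hne : (leg₁ (Fin.castLE h j) : (Fin n ⊕ Fin n) ⊕ (β₁ ⊕ β₂ ⊕ Fin w)) ≠ ancilla j := by
    simp [leg₁, ancilla]
  simp only [Op.apply, Function.update_self, Function.update_of_ne hne, Function.update_idem]

omit [DecidableEq κ₁] [DecidableEq κ₂] in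
lemma run_cnotChecks (h : w ≤ n) (js : List (Fin w)) (hjs : js.Nodup)
    (k : κ₁ ⊕ κ₂ ⊕ Fin w → ZMod 2) (t : ℕ) (θ : State ((Fin n ⊕ Fin n) ⊕ (β₁ ⊕ β₂ ⊕ Fin w)))
    (hθ : ∀ j ∈ js, ∀ s v, θ (Function.update s (ancilla j) v) = θ s) :
    run 0 k (js.flatMap fun j => [Op.cnot false (leg₁ (Fin.castLE h j)) (ancilla j),
      Op.cnot false (leg₂ (Fin.castLE h j)) (ancilla j),
      Op.meas Grade.faulty (Pi.single (ancilla j) pauliZ) (checkBit j)]) t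
      (fun s => if ∀ j ∈ js, s (ancilla j) = 0 then θ s else 0) = fun s =>
      if ∀ j ∈ js, s (leg₁ (Fin.castLE h j)) + s (leg₂ (Fin.castLE h j)) = k (checkBit j) ∧
        s (ancilla j) = k (checkBit j) then θ s else 0 := by
  induction js generalizing t θ with
  | nil => simp [run]
  | cons j js ih =>
    obtain ⟨hj, hjs'⟩ := List.nodup_cons.1 hjs
    rw [List.flatMap_cons, run_append, run_cnotCheck]
    have hl₁ : ∀ i a, (leg₁ i : (Fin n ⊕ Fin n) ⊕ (β₁ ⊕ β₂ ⊕ Fin w)) ≠ ancilla a := by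
      simp [leg₁, ancilla]
    have hl₂ : ∀ i a, (leg₂ i : (Fin n ⊕ Fin n) ⊕ (β₁ ⊕ β₂ ⊕ Fin w)) ≠ ancilla a := by
      simp [leg₂, ancilla]
    have hanc : ∀ i ∈ js, (ancilla i : (Fin n ⊕ Fin n) ⊕ (β₁ ⊕ β₂ ⊕ Fin w)) ≠ ancilla j := by
      rintro i hi h'
      have : i = j := by simpa [ancilla] using h'
      exact hj (this ▸ hi)
    let θ' : State ((Fin n ⊕ Fin n) ⊕ (β₁ ⊕ β₂ ⊕ Fin w)) := fun s =>
      if s (leg₁ (Fin.castLE h j)) + s (leg₂ (Fin.castLE h j)) = k (checkBit j) ∧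
        s (ancilla j) = k (checkBit j) then θ s else 0
    have hθ' : ∀ i ∈ js, ∀ s v, θ' (Function.update s (ancilla i) v) = θ' s := by
      intro i hi s v
      simp only [θ', Function.update_of_ne (hl₁ _ _), Function.update_of_ne (hl₂ _ _),
        Function.update_of_ne (hanc i hi).symm, hθ i (List.mem_cons_of_mem _ hi)]
    have := ih hjs' (t + 3) θ' hθ'
    simp only [θ', ← ite_and] at this
    refine Eq.trans ?_ (this.trans ?_)
    · congr 1
      funext s
      rw [← ite_and, hθ j List.mem_cons_self]
      refine if_congr ?_ rfl rfl
      rw [List.forall_mem_cons, Function.update_self]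
      have h1 : (∀ i ∈ js, Function.update s (ancilla j) (s (ancilla j) +
          s (leg₂ (Fin.castLE h j)) + s (leg₁ (Fin.castLE h j))) (ancilla i) = 0) ↔
          ∀ i ∈ js, s (ancilla i) = 0 :=
        forall₂_congr fun i hi => by rw [Function.update_of_ne (hanc i hi)]
      rw [h1, add_assoc, zmod2_add_eq_zero, add_comm (s (leg₂ _))]
      constructor
      · rintro ⟨h2, h3, h4⟩
        exact ⟨h4, by rw [← h3, h2], h2⟩
      · rintro ⟨h4, h3, h2⟩
        exact ⟨h2, by rw [h3, h2], h4⟩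
    · funext s
      refine if_congr ?_ rfl rfl
      rw [List.forall_mem_cons, and_comm]

omit [DecidableEq κ₁] [DecidableEq κ₂] in
lemma isCheckList_cnotChecks (h : w ≤ n) :
    IsCheckList (β₁ := β₁) (β₂ := β₂) (κ₁ := κ₁) (κ₂ := κ₂) h id (cnotChecks h) where
  op o ho := by
    obtain ⟨j, -, ho⟩ := List.mem_flatMap.1 ho
    simp only [List.mem_cons, List.not_mem_nil, or_false] at ho
    rcases ho with rfl | rfl | rfl
    exacts [.cnot₁ j, .cnot₂ j, .measAncilla j]
  reads o ho := by
    obtain ⟨j, -, ho⟩ := List.mem_flatMap.1 ho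
    simp only [List.mem_cons, List.not_mem_nil, or_false] at ho
    rcases ho with rfl | rfl | rfl <;> rfl
  writes := by
    rw [cnotChecks]
    induction List.finRange w with
    | nil => rfl
    | cons j js ih => 
      rw [List.flatMap_cons, List.filterMap_append, ih]
      rfl
  run_tens k t ψ₁ ψ₂ s := by
    have h1 := run_cnotChecks h (List.finRange w) (List.nodup_finRange w) k t
      (fun s => ψ₁ (fun q => s (qubit₁ q)) * ψ₂ fun q => s (qubit₂ q)) fun j _ s v => by
        simp only [Function.update_of_ne (qubit₁_ne_ancilla _ _),
          Function.update_of_ne (qubit₂_ne_ancilla _ _)]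
    have h2 : tens ψ₁ ψ₂ (zeroState (Fin w)) = fun s => if ∀ j ∈ List.finRange w,
        s (ancilla j) = 0 then ψ₁ (fun q => s (qubit₁ q)) * ψ₂ fun q => s (qubit₂ q) else 0 := by
      funext s
      simp [tens, zeroState]
    rw [cnotChecks, h2, h1]
    simp only [tens, recordState, mul_ite, mul_one, mul_zero, ← ite_and, id]
    refine if_congr ?_ rfl rfl
    simp only [ParitiesAgree, List.mem_finRange, forall_true_left]
    exact forall_and

end CheckLists

/-! ### Validity -/

section Valid

/-- Classical bits are read only after they have been written, if those in `W` have been written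
before. -/
def CausalAfter {Q κ : Type} (W : List κ) (l : List (Op Q κ)) : Prop :=
  ∀ l₁ l₂ o, l = l₁ ++ o :: l₂ → ∀ b ∈ o.reads, b ∈ W ∨ b ∈ l₁.filterMap Op.writes

lemma CausalAfter.append {Q κ : Type} {W : List κ} {l l' : List (Op Q κ)} (hl : CausalAfter W l)
    (hl' : CausalAfter (W ++ l.filterMap Op.writes) l') : CausalAfter W (l ++ l') := by
  intro l₁ l₂ o h b hb
  rcases List.append_eq_append_iff.1 h with ⟨m, rfl, h2⟩ | ⟨m, h1, h2⟩
  · rcases hl' m l₂ o h2 b hb with h3 | h3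
    · rcases List.mem_append.1 h3 with h3 | h3
      · exact Or.inl h3
      · exact Or.inr (by rw [List.filterMap_append]; exact List.mem_append_left _ h3)
    · exact Or.inr (by rw [List.filterMap_append]; exact List.mem_append_right _ h3)
  · cases m with
    | nil =>
      rw [List.append_nil] at h1
      subst h1
      rcases hl' [] l₂ o (by simpa using h2.symm) b hb with h3 | h3
      · exact List.mem_append.1 h3
      · simp at h3
    | cons o' m =>
      rw [List.cons_append, List.cons.injEq] at h2
      obtain ⟨rfl, -⟩ := h2
      exact hl l₁ m o h1 b hb

lemma CausalAfter.of_reads_subset {Q κ : Type} {W : List κ} {l : List (Op Q κ)}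
    (hl : ∀ o ∈ l, ∀ b ∈ o.reads, b ∈ W) : CausalAfter W l := by
  rintro l₁ l₂ o rfl b hb
  exact Or.inl (hl o (by simp) b hb)

lemma Op.writes_map {Q Q' κ κ' : Type} [DecidableEq κ'] (f : Q → Q') (g : κ → κ') (o : Op Q κ) :
    (o.map f g).writes = o.writes.map g := by
  cases o <;> rfl

lemma Op.reads_map {Q Q' κ κ' : Type} [DecidableEq κ'] (f : Q → Q') (g : κ → κ') (o : Op Q κ) :
    (o.map f g).reads = o.reads.image g := by
  cases o <;> rfl

lemma Op.filterMap_writes_map {Q Q' κ κ' : Type} [DecidableEq κ'] (f : Q → Q') (g : κ → κ')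
    (l : List (Op Q κ)) :
    (l.map (Op.map f g)).filterMap Op.writes = (l.filterMap Op.writes).map g := by
  rw [List.filterMap_map, List.map_filterMap]
  exact List.filterMap_congr fun o _ => Op.writes_map f g o

lemma CausalAfter.map {Q Q' κ κ' : Type} [DecidableEq κ'] (f : Q → Q') (g : κ → κ') (W : List κ')
    {l : List (Op Q κ)} (hl : CausalAfter [] l) : CausalAfter W (l.map (Op.map f g)) := by
  intro l₁ l₂ o h b hb
  obtain ⟨m₁, m', rfl, rfl, h2⟩ := List.map_eq_append_iff.1 h
  obtain ⟨o', m₂, rfl, rfl, rfl⟩ := List.map_eq_cons_iff.1 h2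
  rw [Op.reads_map] at hb
  obtain ⟨b', hb', rfl⟩ := Finset.mem_image.1 hb
  rw [Op.filterMap_writes_map]
  refine Or.inr (List.mem_map_of_mem ?_)
  rcases hl m₁ m₂ o' rfl b' hb' with h3 | h3
  · simp at h3
  · exact h3

lemma Op.DistinctQubits.map {Q Q' κ κ' : Type} [DecidableEq κ'] {f : Q → Q'} (hf : f.Injective)
    (g : κ → κ') {o : Op Q κ} (ho : o.DistinctQubits) : (o.map f g).DistinctQubits := by
  cases o with
  | cnot i c t => exact hf.ne ho
  | gate i r e U => exact hf.comp ho
  | _ => trivial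

variable {α₁ α₂ β₁ β₂ γ κ₁ κ₂ δ : Type} [Fintype α₁] [Fintype α₂] [Fintype β₁] [Fintype β₂]
  [Fintype γ] [DecidableEq α₁] [DecidableEq α₂] [DecidableEq β₁] [DecidableEq β₂] [DecidableEq γ]
  [DecidableEq κ₁] [DecidableEq κ₂] [DecidableEq δ]

lemma Circuit.init_norm_join (A : Circuit α₁ β₁ κ₁) (B : Circuit α₂ β₂ κ₂)
    (l : List (Op ((α₁ ⊕ α₂) ⊕ (β₁ ⊕ β₂ ⊕ γ)) (κ₁ ⊕ κ₂ ⊕ δ))) (hA : ∑ s, ‖A.init s‖ ^ 2 = 1)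
    (hB : ∑ s, ‖B.init s‖ ^ 2 = 1) : ∑ s, ‖(A.join B l).init s‖ ^ 2 = 1 := by
  have h : ∀ (x₁ : α₁ → ZMod 2) (x₂ : α₂ → ZMod 2) (y₁ : β₁ → ZMod 2) (y₂ : β₂ → ZMod 2)
      (u : γ → ZMod 2), ‖(A.join B l).init
        (Sum.elim (Sum.elim x₁ x₂) (Sum.elim y₁ (Sum.elim y₂ u)))‖ ^ 2 =
      ‖A.init (Sum.elim x₁ y₁)‖ ^ 2 * (‖B.init (Sum.elim x₂ y₂)‖ ^ 2 *
        if u = 0 then 1 else 0) := by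
    intro x₁ x₂ y₁ y₂ u
    have e1 : (fun q : α₁ ⊕ β₁ => (Sum.elim (Sum.elim x₁ x₂) (Sum.elim y₁ (Sum.elim y₂ u)) :
        (α₁ ⊕ α₂) ⊕ (β₁ ⊕ β₂ ⊕ γ) → ZMod 2) (qubit₁ q)) = Sum.elim x₁ y₁ := by
      funext q; cases q <;> rfl
    have e2 : (fun q : α₂ ⊕ β₂ => (Sum.elim (Sum.elim x₁ x₂) (Sum.elim y₁ (Sum.elim y₂ u)) :
        (α₁ ⊕ α₂) ⊕ (β₁ ⊕ β₂ ⊕ γ) → ZMod 2) (qubit₂ q)) = Sum.elim x₂ y₂ := by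
      funext q; cases q <;> rfl
    change ‖A.init _ * B.init _ * (if ∀ a, u a = 0 then (1 : ℂ) else 0)‖ ^ 2 = _
    rw [e1, e2]
    by_cases hu : u = 0
    · subst hu; simp [mul_pow]
    · have hu' : ¬ ∀ a, u a = 0 := fun hu' => hu (funext hu')
      rw [if_neg hu, if_neg hu']; simp
  rw [sum_arrow_sum] at hA hB
  simp only [sum_arrow_sum, h, ← Finset.mul_sum, Finset.sum_ite_eq', Finset.mem_univ, if_true,
    mul_one, ← Finset.sum_mul, hA, hB]

lemma Circuit.Valid.join {A : Circuit α₁ β₁ κ₁} {B : Circuit α₂ β₂ κ₂} (hA : A.Valid)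
    (hB : B.Valid) {l : List (Op ((α₁ ⊕ α₂) ⊕ (β₁ ⊕ β₂ ⊕ γ)) (κ₁ ⊕ κ₂ ⊕ δ))}
    (hd : ∀ o ∈ l, o.DistinctQubits) {D : List δ} (hD : D.Nodup) (hD' : ∀ d, d ∈ D)
    (hw : l.filterMap Op.writes = D.map fun d => Sum.inr (Sum.inr d)) (hc : CausalAfter [] l) :
    (A.join B l).Valid := by
  have hwr : (A.join B l).ops.filterMap Op.writes =
      (A.ops.filterMap Op.writes).map Sum.inl ++ ((B.ops.filterMap Op.writes).map
        (fun b => Sum.inr (Sum.inl b)) ++ D.map fun d => Sum.inr (Sum.inr d)) := by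
    simp only [Circuit.join, List.filterMap_append, Op.filterMap_writes_map, hw]
  refine ⟨init_norm_join A B l hA.init_norm hB.init_norm, ?_, ?_, ?_, ?_⟩
  · intro o ho
    rcases List.mem_append.1 ho with ho | ho
    · obtain ⟨o', ho', rfl⟩ := List.mem_map.1 ho
      exact (hA.distinct o' ho').map qubit₁_injective _
    · rcases List.mem_append.1 ho with ho | ho
      · obtain ⟨o', ho', rfl⟩ := List.mem_map.1 ho
        exact (hB.distinct o' ho').map qubit₂_injective _
      · exact hd o ho
  · rw [hwr, List.nodup_append', List.nodup_append']
    refine ⟨hA.bits_nodup.map Sum.inl_injective, ⟨hB.bits_nodup.map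
      (Sum.inr_injective.comp Sum.inl_injective), hD.map
      (Sum.inr_injective.comp Sum.inr_injective), ?_⟩, ?_⟩ <;>
    · intro b hb hb'
      simp only [List.mem_append, List.mem_map] at hb hb'
      aesop
  · rintro (b | b | b) <;> rw [hwr]
    · exact List.mem_append_left _ (List.mem_map_of_mem (hA.bits_written b))
    · exact List.mem_append_right _ (List.mem_append_left _
        (List.mem_map.2 ⟨b, hB.bits_written b, rfl⟩))
    · exact List.mem_append_right _ (List.mem_append_right _ (List.mem_map.2 ⟨b, hD' b, rfl⟩))
  · have hcA : CausalAfter [] A.ops := fun l₁ l₂ o h b hb => Or.inr (hA.causal l₁ l₂ o h b hb)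
    have hcB : CausalAfter [] B.ops := fun l₁ l₂ o h b hb => Or.inr (hB.causal l₁ l₂ o h b hb)
    have hcl : ∀ W, CausalAfter W l := fun W l₁ l₂ o h b hb =>
      Or.inr ((hc l₁ l₂ o h b hb).resolve_left (by simp))
    intro l₁ l₂ o h b hb
    exact ((hcA.map qubit₁ Sum.inl []).append ((hcB.map qubit₂ _ _).append (hcl _)) l₁ l₂ o h b
      hb).resolve_left (by simp)

end Valid

/-! ### Counting operations -/

lemma Op.isCnot_map {Q Q' κ κ' : Type} [DecidableEq κ'] (f : Q → Q') (g : κ → κ') (o : Op Q κ) :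
    (o.map f g).isCnot = o.isCnot := by
  cases o <;> rfl

lemma Op.isMeas_map {Q Q' κ κ' : Type} [DecidableEq κ'] (f : Q → Q') (g : κ → κ') (o : Op Q κ) :
    (o.map f g).isMeas = o.isMeas := by
  cases o <;> rfl

section Counts

variable {α₁ α₂ β₁ β₂ γ κ₁ κ₂ δ : Type} [Fintype γ] [DecidableEq γ] [DecidableEq κ₁]
  [DecidableEq κ₂] [DecidableEq δ]

lemma Circuit.cnotCount_join (A : Circuit α₁ β₁ κ₁) (B : Circuit α₂ β₂ κ₂)
    (l : List (Op ((α₁ ⊕ α₂) ⊕ (β₁ ⊕ β₂ ⊕ γ)) (κ₁ ⊕ κ₂ ⊕ δ))) :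
    (A.join B l).cnotCount = A.cnotCount + B.cnotCount + l.countP Op.isCnot := by
  simp only [cnotCount, join, List.countP_append, List.countP_map, Function.comp_def,
    Op.isCnot_map, add_assoc]

lemma Circuit.measCount_join (A : Circuit α₁ β₁ κ₁) (B : Circuit α₂ β₂ κ₂)
    (l : List (Op ((α₁ ⊕ α₂) ⊕ (β₁ ⊕ β₂ ⊕ γ)) (κ₁ ⊕ κ₂ ⊕ δ))) :
    (A.join B l).measCount = A.measCount + B.measCount + l.countP Op.isMeas := by
  simp only [measCount, join, List.countP_append, List.countP_map, Function.comp_def,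
    Op.isMeas_map, add_assoc]

end Counts

section FusionValid

variable {n w : ℕ} {β₁ β₂ γ κ₁ κ₂ : Type} [Fintype β₁] [Fintype β₂] [Fintype γ] [DecidableEq β₁]
  [DecidableEq β₂] [DecidableEq γ] [DecidableEq κ₁] [DecidableEq κ₂]

omit [Fintype β₁] [Fintype β₂] [Fintype γ] [DecidableEq κ₁]
  [DecidableEq κ₂] in
lemma FusionOp.distinctQubits {h : w ≤ n} {ι : γ → Fin w}
    {o : Op ((Fin n ⊕ Fin n) ⊕ (β₁ ⊕ β₂ ⊕ γ)) (κ₁ ⊕ κ₂ ⊕ Fin w)} (ho : FusionOp h ι o) :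
    o.DistinctQubits := by
  cases ho <;> simp [Op.DistinctQubits, leg₁, leg₂, ancilla]

lemma IsCheckList.valid_join {h : w ≤ n} {ι : γ → Fin w}
    {l : List (Op ((Fin n ⊕ Fin n) ⊕ (β₁ ⊕ β₂ ⊕ γ)) (κ₁ ⊕ κ₂ ⊕ Fin w))} (hl : IsCheckList h ι l)
    {A : Circuit (Fin n) β₁ κ₁} {B : Circuit (Fin n) β₂ κ₂} (hA : A.Valid) (hB : B.Valid) :
    (A.join B (l ++ corrections n w)).Valid := by
  refine hA.join hB (fun o ho => (hl.fusionOp ho).distinctQubits) (List.nodup_finRange w)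
    List.mem_finRange ?_ (CausalAfter.append ?_ ?_)
  · rw [List.filterMap_append, writes_corrections, List.append_nil, hl.writes]
    rfl
  · exact .of_reads_subset fun o ho b hb => by rw [hl.reads o ho] at hb; simp at hb
  · refine .of_reads_subset fun o ho b hb => ?_
    obtain ⟨i, -, rfl⟩ := List.mem_map.1 ho
    obtain ⟨j, -, rfl⟩ := Finset.mem_image.1 hb
    rw [List.nil_append, hl.writes]
    exact List.mem_map_of_mem (List.mem_finRange j)

end FusionValid

section FusionCounts

variable {n w : ℕ} {β₁ β₂ γ κ₁ κ₂ : Type} [DecidableEq β₁] [DecidableEq β₂] [DecidableEq γ]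

lemma countP_corrections [DecidableEq κ₁] [DecidableEq κ₂]
    (p : Op ((Fin n ⊕ Fin n) ⊕ (β₁ ⊕ β₂ ⊕ γ)) (κ₁ ⊕ κ₂ ⊕ Fin w) → Bool)
    (hp : ∀ i q S, p (Op.condPauli i q S) = false) : (corrections n w).countP p = 0 := by
  rw [List.countP_eq_zero]
  intro o ho
  obtain ⟨i, -, rfl⟩ := List.mem_map.1 ho
  simp [hp]

omit [DecidableEq γ] in
lemma countP_isCnot_idealChecks (h : w ≤ n) :
    (idealChecks (β₁ := β₁) (β₂ := β₂) (κ₁ := κ₁) (κ₂ := κ₂) h).countP Op.isCnot = 0 := by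
  rw [List.countP_eq_zero]
  intro o ho
  obtain ⟨i, -, rfl⟩ := List.mem_map.1 ho
  simp [Op.isCnot]

omit [DecidableEq γ] in
lemma countP_isMeas_idealChecks (h : w ≤ n) :
    (idealChecks (β₁ := β₁) (β₂ := β₂) (κ₁ := κ₁) (κ₂ := κ₂) h).countP Op.isMeas = w := by
  rw [List.countP_eq_length.2, idealChecks, List.length_map, List.length_finRange]
  intro o ho
  obtain ⟨i, -, rfl⟩ := List.mem_map.1 ho
  rfl

omit [DecidableEq γ] in
lemma countP_isCnot_cnotChecks (h : w ≤ n) :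
    (cnotChecks (β₁ := β₁) (β₂ := β₂) (κ₁ := κ₁) (κ₂ := κ₂) h).countP Op.isCnot = 2 * w := by
  rw [cnotChecks, List.countP_flatMap]
  change ((List.finRange w).map fun _ => 2).sum = 2 * w
  simp [mul_comm]

omit [DecidableEq γ] in
lemma countP_isMeas_cnotChecks (h : w ≤ n) :
    (cnotChecks (β₁ := β₁) (β₂ := β₂) (κ₁ := κ₁) (κ₂ := κ₂) h).countP Op.isMeas = w := by
  rw [cnotChecks, List.countP_flatMap]
  change ((List.finRange w).map fun _ => 1).sum = w
  simp

end FusionCounts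

end FaultCircuit

end

theorem mainTheorem7 (n w : ℕ) (hw : w ≤ n) {β₁ β₂ κ₁ κ₂ : Type}
    [Fintype β₁] [DecidableEq β₁] [Fintype β₂] [DecidableEq β₂]
    [Fintype κ₁] [DecidableEq κ₁] [Fintype κ₂] [DecidableEq κ₂]
    (A : FaultCircuit.Circuit (Fin n) β₁ κ₁) (B : FaultCircuit.Circuit (Fin n) β₂ κ₂)
    (hA : A.Valid) (hB : B.Valid)
    (hAcat : FaultCircuit.PreparesCat w A) (hBcat : FaultCircuit.PreparesCat w B) :
    ((FaultCircuit.fuseIdeal hw A B).Valid ∧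
      FaultCircuit.PreparesCat w (FaultCircuit.fuseIdeal hw A B) ∧
      (FaultCircuit.fuseIdeal hw A B).cnotCount = A.cnotCount + B.cnotCount ∧
      (FaultCircuit.fuseIdeal hw A B).measCount = A.measCount + B.measCount + w) ∧
    ((FaultCircuit.fuseCnot hw A B).Valid ∧
      FaultCircuit.PreparesCat w (FaultCircuit.fuseCnot hw A B) ∧
      (FaultCircuit.fuseCnot hw A B).cnotCount = A.cnotCount + B.cnotCount + 2 * w ∧
      (FaultCircuit.fuseCnot hw A B).measCount = A.measCount + B.measCount + w) := by
  have h₁ := FaultCircuit.isCheckList_idealChecks (β₁ := β₁) (β₂ := β₂) (κ₁ := κ₁) (κ₂ := κ₂) hw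
  have h₂ := FaultCircuit.isCheckList_cnotChecks (β₁ := β₁) (β₂ := β₂) (κ₁ := κ₁) (κ₂ := κ₂) hw
  refine ⟨⟨h₁.valid_join hA hB, h₁.preparesCat_join A B hAcat hBcat, ?_, ?_⟩,
    ⟨h₂.valid_join hA hB, h₂.preparesCat_join A B hAcat hBcat, ?_, ?_⟩⟩
  · rw [FaultCircuit.fuseIdeal, FaultCircuit.Circuit.cnotCount_join, List.countP_append,
      FaultCircuit.countP_isCnot_idealChecks, FaultCircuit.countP_corrections _ fun _ _ _ => rfl]
    rfl
  · rw [FaultCircuit.fuseIdeal, FaultCircuit.Circuit.measCount_join, List.countP_append,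
      FaultCircuit.countP_isMeas_idealChecks, FaultCircuit.countP_corrections _ fun _ _ _ => rfl,
      add_zero]
  · rw [FaultCircuit.fuseCnot, FaultCircuit.Circuit.cnotCount_join, List.countP_append,
      FaultCircuit.countP_isCnot_cnotChecks, FaultCircuit.countP_corrections _ fun _ _ _ => rfl,
      add_zero]
  · rw [FaultCircuit.fuseCnot, FaultCircuit.Circuit.measCount_join, List.countP_append,
      FaultCircuit.countP_isMeas_cnotChecks, FaultCircuit.countP_corrections _ fun _ _ _ => rfl,
      add_zero]
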